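/- Consider the two-user real Gaussian interference channel $Y_1=h_{11}X_1+h_{12}X_2+Z_1$, $Y_2=h_{21}X_1+h_{22}X_2+Z_2$ with fixed gains $h=(h_{11},h_{12},h_{21},h_{22})\in\mathbb{R}^4$, standard Gaussian noises and inputs of power at most one. Rates and mutual informations are in bits, and $I_g(x)=\frac12\log_2(1+x)$. A mixed input with parameters $N\in\{1,2,\dots\}$ and $\delta\in[0,1]$ is $X=\sqrt{1-\delta}\,X_D+\sqrt{\delta}\,X_G$, where $X_D$ is uniform on $N$ equally spaced points centred at $0$ with spacing $\sqrt{12/(N^2-1)}$ ($X_D=0$ if $N=1$) and $X_G\sim\mathcal N(0,1)$ is independent of $X_D$. Let $\mathcal R_{\rm in}(h)$ be the region achieved with mixed inputs by treating interference as noise without time sharing, that is, the union, over all pairs of independent mixed inputs $X_1,X_2$ (independent of the noise), of the sets $\{(R_1,R_2): 0\le R_1\le I(X_1;Y_1),\ 0\le R_2\le I(X_2;Y_2)\}$. Let $\mathcal R_{\rm out}(h)$ be the set of all $(R_1,R_2)$ with $R_1,R_2\ge 0$ such that \begin{align*} R_1&\le I_g(|h_{11}|^2),\qquad R_2\le I_g(|h_{22}|^2),\\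 R_1+R_2&\le [I_g(|h_{11}|^2)-I_g(|h_{21}|^2)]^+ + I_g(|h_{21}|^2+|h_{22}|^2),\\ R_1+R_2&\le [I_g(|h_{22}|^2)-I_g(|h_{12}|^2)]^+ + I_g(|h_{11}|^2+|h_{12}|^2),\\ R_1+R_2&\le I_g\Big(|h_{12}|^2+\tfrac{|h_{11}|^2}{1+|h_{21}|^2}\Big)+I_g\Big(|h_{21}|^2+\tfrac{|h_{22}|^2}{1+|h_{12}|^2}\Big),\\ 2R_1+R_2&\le I_g(|h_{11}|^2+|h_{12}|^2)+I_g\Big(|h_{21}|^2+\tfrac{|h_{22}|^2}{1+|h_{12}|^2}\Big)+[I_g(|h_{11}|^2)-I_g(|h_{21}|^2)]^+,\\ R_1+2R_2&\le I_g(|h_{21}|^2+|h_{22}|^2)+I_g\Big(|h_{12}|^2+\tfrac{|h_{11}|^2}{1+|h_{21}|^2}\Big)+[I_g(|h_{22}|^2)-I_g(|h_{12}|^2)]^+ , \end{align*} which is a known outer bound on the capacity region. Say that $\mathcal R_{\rm in}(h)$ and $\mathcal R_{\rm out}(h)$ are to within a gap $g$ if $([R_1-g]^+,[R_2-g]^+)\in\mathcal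 R_{\rm in}(h)$ for every $(R_1,R_2)\in\mathcal R_{\rm out}(h)$. Theorem. There is an absolute constant $C>0$ such that the following holds for all $h\in\mathbb R^4$. (1) If the interference is very strong, i.e. $|h_{11}|^2(1+|h_{22}|^2)\le|h_{21}|^2$ and $|h_{22}|^2(1+|h_{11}|^2)\le|h_{12}|^2$, or very weak, i.e. $|h_{12}|^2\le\frac{|h_{22}|^2}{1+|h_{21}|^2}$ and $|h_{21}|^2\le\frac{|h_{11}|^2}{1+|h_{12}|^2}$, then $\mathcal R_{\rm in}(h)$ and $\mathcal R_{\rm out}(h)$ are to within the constant gap $C$. (2) Unless $h$ satisfies both $$\frac{|h_{22}|^2}{1+|h_{21}|^2}<|h_{12}|^2<\frac{|h_{22}|^2}{1+|h_{21}|^2}(1+|h_{11}|^2)\quad\text{and}\quad \frac{|h_{11}|^2}{1+|h_{12}|^2}<|h_{21}|^2<\frac{|h_{11}|^2}{1+|h_{12}|^2}(1+|h_{22}|^2),$$ $\mathcal R_{\rm in}(h)$ and $\mathcal R_{\rm out}(h)$ are to within a gap $C\log_2\ln\max(|h_{11}|^2,|h_{22}|^2,16)$, i.e. of the order $O(\log\ln\max(|h_{11}|^2,|h_{22}|^2))$.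 The channels of (2) include those in strong interference ($|h_{21}|^2\ge|h_{11}|^2$ and $|h_{12}|^2\ge|h_{22}|^2$) and those in mixed interference with $|h_{21}|^2\ge\frac{|h_{11}|^2}{1+|h_{12}|^2}(1+|h_{22}|^2)$, $|h_{12}|^2\le|h_{22}|^2$, or the same with the users swapped. -/

import Mathlib

open MeasureTheory ProbabilityTheory
open scoped ENNReal

noncomputable section

namespace GaussianIC

/-- The gains of a two-user real Gaussian interference channel
`Y₁ = h₁₁ X₁ + h₁₂ X₂ + Z₁`, `Y₂ = h₂₁ X₁ + h₂₂ X₂ + Z₂`, where `Z₁, Z₂` are standard Gaussian and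
the inputs have power at most one. -/
structure Channel where
  h11 : ℝ
  h12 : ℝ
  h21 : ℝ
  h22 : ℝ

/-! ### Mutual information and treating interference as noise without time sharing -/

/-- Mutual information, in bits, of a pair of random variables with joint law `μ`: the
Kullback-Leibler divergence of the joint law from the product of its marginals. -/
def mutualInfo {α β : Type*} [MeasurableSpace α] [MeasurableSpace β] (μ : Measure (α × β)) : ℝ≥0∞ :=
  InformationTheory.klDiv μ (μ.fst.prod μ.snd) / ENNReal.ofReal (Real.log 2)

/-- Joint law of the desired input `X` and the output `Y = g X + g' X' + Z`, where `X ∼ P`, the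
interfering input `X' ∼ P'` and `Z ∼ 𝒩(0,1)` are independent. -/
def inputOutputLaw (g g' : ℝ) (P P' : Measure ℝ) : Measure (ℝ × ℝ) :=
  (P.prod (P'.prod (gaussianReal 0 1))).map
    (fun w => (w.1, g * w.1 + g' * w.2.1 + w.2.2))

/-- `I(X₁;Y₁)` in bits, for independent inputs `X₁ ∼ P₁`, `X₂ ∼ P₂`. -/
def info1 (h : Channel) (P₁ P₂ : Measure ℝ) : ℝ≥0∞ :=
  mutualInfo (inputOutputLaw h.h11 h.h12 P₁ P₂)

/-- `I(X₂;Y₂)` in bits, for independent inputs `X₁ ∼ P₁`, `X₂ ∼ P₂`. -/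
def info2 (h : Channel) (P₁ P₂ : Measure ℝ) : ℝ≥0∞ :=
  mutualInfo (inputOutputLaw h.h22 h.h21 P₂ P₁)

/-- The rate region achieved by treating interference as noise without time sharing when both
users choose their input law, independently, in the class `inputs`: the union over `P₁, P₂ ∈ inputs` of
`{0 ≤ R₁ ≤ I(X₁;Y₁), 0 ≤ R₂ ≤ I(X₂;Y₂)}`. -/
def tinNoTSRegion (h : Channel) (inputs : Set (Measure ℝ)) : Set (ℝ × ℝ) :=
  {R | ∃ P₁ ∈ inputs, ∃ P₂ ∈ inputs,
    (0 ≤ R.1 ∧ ENNReal.ofReal R.1 ≤ info1 h P₁ P₂) ∧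
    (0 ≤ R.2 ∧ ENNReal.ofReal R.2 ≤ info2 h P₁ P₂)}

/-! ### Mixed inputs -/

/-- `PAM(N, d)`: the uniform law on the `N` equally spaced points `d (i - (N-1)/2)`, `0 ≤ i < N`. -/
def pam (N : ℕ) (d : ℝ) : Measure ℝ :=
  (N : ℝ≥0∞)⁻¹ • ∑ i ∈ Finset.range N, Measure.dirac (d * ((i : ℝ) - ((N : ℝ) - 1) / 2))

/-- The law of the mixed input `√(1-δ) X_D + √δ X_G`, where `X_D ∼ PAM(N, √(12/(N²-1)))` and
`X_G ∼ 𝒩(0,1)` are independent. For `N = 1` the discrete part is the constant `0`. -/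
def mixedInput (N : ℕ) (δ : ℝ) : Measure ℝ :=
  ((pam N (Real.sqrt (12 / ((N : ℝ) ^ 2 - 1)))).prod (gaussianReal 0 1)).map
    (fun w => Real.sqrt (1 - δ) * w.1 + Real.sqrt δ * w.2)

/-- The class of all mixed inputs. They have power at most one (exactly one when `2 ≤ N`). -/
def mixedInputs : Set (Measure ℝ) :=
  {P | ∃ (N : ℕ) (δ : ℝ), 1 ≤ N ∧ 0 ≤ δ ∧ δ ≤ 1 ∧ P = mixedInput N δ}

/-! ### The outer bound on the capacity region -/

/-- `I_g(x) = (1/2) log₂ (1 + x)`. -/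
def Ig (x : ℝ) : ℝ := 1 / 2 * Real.logb 2 (1 + x)

/-- The outer bound on the capacity region (rates in bits). -/
def outerBound (h : Channel) : Set (ℝ × ℝ) :=
  {R | (0 ≤ R.1 ∧ 0 ≤ R.2) ∧
    R.1 ≤ Ig (h.h11 ^ 2) ∧
    R.2 ≤ Ig (h.h22 ^ 2) ∧
    R.1 + R.2 ≤ max (Ig (h.h11 ^ 2) - Ig (h.h21 ^ 2)) 0 + Ig (h.h21 ^ 2 + h.h22 ^ 2) ∧
    R.1 + R.2 ≤ max (Ig (h.h22 ^ 2) - Ig (h.h12 ^ 2)) 0 + Ig (h.h11 ^ 2 + h.h12 ^ 2) ∧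
    R.1 + R.2 ≤ Ig (h.h12 ^ 2 + h.h11 ^ 2 / (1 + h.h21 ^ 2))
      + Ig (h.h21 ^ 2 + h.h22 ^ 2 / (1 + h.h12 ^ 2)) ∧
    2 * R.1 + R.2 ≤ Ig (h.h11 ^ 2 + h.h12 ^ 2)
      + Ig (h.h21 ^ 2 + h.h22 ^ 2 / (1 + h.h12 ^ 2))
      + max (Ig (h.h11 ^ 2) - Ig (h.h21 ^ 2)) 0 ∧
    R.1 + 2 * R.2 ≤ Ig (h.h21 ^ 2 + h.h22 ^ 2)
      + Ig (h.h12 ^ 2 + h.h11 ^ 2 / (1 + h.h21 ^ 2))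
      + max (Ig (h.h22 ^ 2) - Ig (h.h12 ^ 2)) 0}

/-- The inner region `Rin` and the outer region `Rout` are to within a gap of `g` bits (per user):
lowering both rates of any point of `Rout` by `g` (and not below zero) gives a point of `Rin`. -/
def WithinGap (Rin Rout : Set (ℝ × ℝ)) (g : ℝ) : Prop :=
  ∀ R ∈ Rout, (max (R.1 - g) 0, max (R.2 - g) 0) ∈ Rin

/-! ### Regimes of the channel gains -/

/-- Very strong interference. -/
def VeryStrong (h : Channel) : Prop :=
  h.h11 ^ 2 * (1 + h.h22 ^ 2) ≤ h.h21 ^ 2 ∧ h.h22 ^ 2 * (1 + h.h11 ^ 2) ≤ h.h12 ^ 2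

/-- Very weak interference. -/
def VeryWeak (h : Channel) : Prop :=
  h.h12 ^ 2 ≤ h.h22 ^ 2 / (1 + h.h21 ^ 2) ∧ h.h21 ^ 2 ≤ h.h11 ^ 2 / (1 + h.h12 ^ 2)

/-- The excluded regime, akin to moderately weak interference. -/
def OpenRegime (h : Channel) : Prop :=
  (h.h22 ^ 2 / (1 + h.h21 ^ 2) < h.h12 ^ 2 ∧
    h.h12 ^ 2 < h.h22 ^ 2 / (1 + h.h21 ^ 2) * (1 + h.h11 ^ 2)) ∧
  (h.h11 ^ 2 / (1 + h.h12 ^ 2) < h.h21 ^ 2 ∧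
    h.h21 ^ 2 < h.h11 ^ 2 / (1 + h.h12 ^ 2) * (1 + h.h22 ^ 2))

end GaussianIC

end

noncomputable section
namespace GaussianIC

/-! ### A variational lower bound on the Kullback-Leibler divergence -/

/-! The achievability side rests on a single-letter estimate, `le_mutualInfo`. With `w` the Gaussian
noise plus the Gaussian part of the interference, and `s` the same plus the Gaussian part of the
signal, a mixed input with `N₁` points conveys at least `log N₁ + (1/2) log (s / w)` bits, minus the
log of a collision sum `coll` and a constant. The collision sum counts, with exponential weights at
scale `√s`, the pairs of superposed constellation points that the receiver cannot tell apart. The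
estimate is the Donsker–Varadhan inequality for the test function `log (X + q)`, where `q` is a sum
of Gaussian bumps over the interfering constellation.

What remains is to choose the two sizes and the two power splits so that collisions are few. A
constant bound on `coll` holds when one constellation is a single point and the other is well
separated, or when the two are layered, one being far coarser than the span of the other
(`coll_le_of_layered`). This serves very strong interference. Very weak interference is settled by
Gaussian inputs with power control (`achieves_gaussian`), except where one cross gain is at most the
noise level while the other dominates the direct gain; there `achieves_of_weak_of_strong` applies.

In general the sum of two constellations may have accidental near-coincidences for arithmetic
reasons, at particular gains. They are avoided by averaging over the size of the larger
constellation: fractions `j / p` with distinct prime denominators are well separated, so the mean of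
`coll` over primes `p ≤ M` is polylogarithmic in `M` (`sum_primes_coll_le`). One prime then serves
both receivers at once (`exists_sizes`). The loss in each rate is the logarithm of a power of `Λ`, a
quantity of the order of the log of the direct gains: this is the `log ln` gap.

The outer bound is used in the exponentiated variables `u = 2 ^ (2 R₁)`, `v = 2 ^ (2 R₂)`, so that a
gap becomes a factor `Γ`. Each input splits into a Gaussian private part, below the noise at the
unintended receiver, and a discrete public part. Outside the open regime, and up to exchanging the
users, either both receivers resolve both public parts (`achieves_of_strong`), or one of them pays
for the unresolved interference (`achieves_of_noisy`), or one of the bounded-gap schemes above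
applies. -/

theorem ofReal_le_klDiv {α : Type*} [MeasurableSpace α] {μ ν : Measure α}
    [IsProbabilityMeasure μ] [IsProbabilityMeasure ν] {f : α → ℝ}
    (hμ : Integrable f μ) (hν : Integrable (fun x => Real.exp (f x)) ν) :
    ENNReal.ofReal (∫ x, f x ∂μ - Real.log (∫ x, Real.exp (f x) ∂ν)) ≤
      InformationTheory.klDiv μ ν := by
  by_cases h1 : μ ≪ ν
  swap
  · simp [InformationTheory.klDiv_of_not_ac h1]
  by_cases h2 : Integrable (llr μ ν) μ
  swap
  · simp [InformationTheory.klDiv_of_not_integrable h2]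
  rw [InformationTheory.klDiv_of_ac_of_integrable h1 h2]
  apply ENNReal.ofReal_le_ofReal
  have : IsProbabilityMeasure (ν.tilted f) := isProbabilityMeasure_tilted hν
  -- Gibbs' inequality for `μ` against the exponential tilt of `ν` by `f`; expanding the
  -- log-likelihood ratio of the tilt gives the bound.
  have h3 := InformationTheory.integral_llr_add_sub_measure_univ_nonneg
    (h1.trans (absolutelyContinuous_tilted hν)) (integrable_llr_tilted_right h1 hμ h2 hν)
  rw [integral_llr_tilted_right h1 hμ hν h2] at h3
  simp at h3 ⊢
  linarith

/-! ### Gaussian kernels -/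

/-- The kernel `exp (-a² / (2 w))`, as an extended nonnegative real. -/
def gker (w a : ℝ) : ℝ≥0∞ := ENNReal.ofReal (Real.exp (-a ^ 2 / (2 * w)))

/-- Completing the square: variances add under convolution, and the square root is the loss of
height of the unnormalised kernel. -/
theorem lintegral_gker (w a b : ℝ) (hw : 0 < w) :
    ∫⁻ z, gker w (a + b * z) ∂(gaussianReal 0 1) =
      ENNReal.ofReal (Real.sqrt (w / (w + b ^ 2))) * gker (w + b ^ 2) a := by
  have hwb : 0 < w + b ^ 2 := by positivity
  rw [gaussianReal_of_var_ne_zero _ one_ne_zero,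
    lintegral_withDensity_eq_lintegral_mul _ (measurable_gaussianPDF 0 1)
      (by unfold gker; fun_prop)]
  set p : ℝ := (w + b ^ 2) / (2 * w) with hp
  have hp0 : 0 < p := by positivity
  have key : ∀ z : ℝ, (gaussianPDF 0 1 * fun z => gker w (a + b * z)) z =
      ENNReal.ofReal ((Real.sqrt (2 * Real.pi))⁻¹ * Real.exp (-a ^ 2 / (2 * (w + b ^ 2))) *
        Real.exp (-p * (z + a * b / (w + b ^ 2)) ^ 2)) := by
    intro z
    simp only [Pi.mul_apply, gaussianPDF, gker, gaussianPDFReal]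
    rw [← ENNReal.ofReal_mul (by positivity)]
    congr 1
    simp only [NNReal.coe_one, mul_one, sub_zero]
    rw [mul_assoc, mul_assoc, ← Real.exp_add, ← Real.exp_add]
    congr 2
    rw [hp]
    field_simp
    ring
  simp_rw [key]
  have hint : Integrable (fun z : ℝ => Real.exp (-p * (z + a * b / (w + b ^ 2)) ^ 2)) :=
    (integrable_exp_neg_mul_sq hp0).comp_add_right (a * b / (w + b ^ 2))
  rw [← ofReal_integral_eq_lintegral_ofReal (hint.const_mul _)
    (Filter.Eventually.of_forall fun z => by positivity), integral_const_mul,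
    integral_add_right_eq_self (fun z => Real.exp (-p * z ^ 2)), integral_gaussian, gker,
    ← ENNReal.ofReal_mul (by positivity)]
  congr 1
  have : Real.sqrt (Real.pi / p) = Real.sqrt (2 * Real.pi) * Real.sqrt (w / (w + b ^ 2)) := by
    rw [← Real.sqrt_mul (by positivity)]
    congr 1
    rw [hp]
    field_simp
  rw [this]
  field_simp

theorem measurable_gker (w : ℝ) : Measurable (gker w) := by
  unfold gker; fun_prop

/-! ### Averages over mixed inputs. -/

/-- The position of the `i`-th point of the discrete part of a mixed input. -/
def pamPoint (N : ℕ) (i : ℕ) : ℝ :=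
  Real.sqrt (12 / ((N : ℝ) ^ 2 - 1)) * ((i : ℝ) - ((N : ℝ) - 1) / 2)

theorem isProbabilityMeasure_pam {N : ℕ} (hN : 1 ≤ N) (d : ℝ) :
    IsProbabilityMeasure (pam N d) := by
  constructor
  simp only [pam, Measure.smul_apply, Measure.coe_finsetSum, Finset.sum_apply, measure_univ,
    Finset.sum_const, Finset.card_range, smul_eq_mul, nsmul_eq_mul, mul_one]
  exact ENNReal.inv_mul_cancel (by simp; omega) (by simp)

theorem isProbabilityMeasure_mixedInput {N : ℕ} (hN : 1 ≤ N) (δ : ℝ) :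
    IsProbabilityMeasure (mixedInput N δ) := by
  have := isProbabilityMeasure_pam hN (Real.sqrt (12 / ((N : ℝ) ^ 2 - 1)))
  exact Measure.isProbabilityMeasure_map (by fun_prop)

theorem lintegral_mixedInput {N : ℕ} (hN : 1 ≤ N) (δ : ℝ) {F : ℝ → ℝ≥0∞} (hF : Measurable F) :
    ∫⁻ x, F x ∂(mixedInput N δ) = (N : ℝ≥0∞)⁻¹ * ∑ i ∈ Finset.range N,
      ∫⁻ z, F (Real.sqrt (1 - δ) * pamPoint N i + Real.sqrt δ * z) ∂(gaussianReal 0 1) := by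
  have := isProbabilityMeasure_pam hN (Real.sqrt (12 / ((N : ℝ) ^ 2 - 1)))
  rw [mixedInput, lintegral_map hF (by fun_prop), lintegral_prod _ (by fun_prop), pam,
    lintegral_smul_measure, lintegral_finsetSum_measure, smul_eq_mul]
  congr 1
  refine Finset.sum_congr rfl fun i _ => ?_
  rw [lintegral_dirac']
  · rfl
  · apply Measurable.lintegral_prod_right' (f := fun w : ℝ × ℝ =>
      F (Real.sqrt (1 - δ) * w.1 + Real.sqrt δ * w.2))
    fun_prop

theorem lintegral_gker_mixedInput {N : ℕ} (hN : 1 ≤ N) {δ : ℝ} (hδ : 0 ≤ δ) (w a g : ℝ)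
    (hw : 0 < w) :
    ∫⁻ x, gker w (a + g * x) ∂(mixedInput N δ) =
      ENNReal.ofReal (Real.sqrt (w / (w + g ^ 2 * δ))) * ((N : ℝ≥0∞)⁻¹ * ∑ i ∈ Finset.range N,
        gker (w + g ^ 2 * δ) (a + g * (Real.sqrt (1 - δ) * pamPoint N i))) := by
  rw [lintegral_mixedInput hN δ (F := fun x => gker w (a + g * x))
    ((measurable_gker w).comp (by fun_prop)), mul_left_comm]
  congr 1
  rw [Finset.mul_sum]
  refine Finset.sum_congr rfl fun i _ => ?_
  have h := lintegral_gker w (a + g * (Real.sqrt (1 - δ) * pamPoint N i)) (g * Real.sqrt δ) hw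
  rw [mul_pow, Real.sq_sqrt hδ] at h
  rw [← h]
  congr 1
  ext z
  congr 1
  ring

@[fun_prop]
theorem measurable_gker_comp {α : Type*} [MeasurableSpace α] (w : ℝ) {f : α → ℝ}
    (hf : Measurable f) : Measurable (fun x => gker w (f x)) :=
  (measurable_gker w).comp hf

/-- Serves to average, one Gaussian variable at a time, the quadratic exponent left by the logarithm
of a single bump. -/
theorem lintegral_quadratic (A k c b : ℝ) (hA : 0 ≤ A) (hk : 0 ≤ k) :
    ∫⁻ z, ENNReal.ofReal (A + k * (c + b * z) ^ 2) ∂(gaussianReal 0 1) =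
      ENNReal.ofReal (A + k * (c ^ 2 + b ^ 2)) := by
  have h1 : Integrable (fun z : ℝ => z) (gaussianReal 0 1) :=
    (memLp_id_gaussianReal 1).integrable (by simp)
  have h2 : Integrable (fun z : ℝ => z ^ 2) (gaussianReal 0 1) :=
    (memLp_id_gaussianReal 2).integrable_sq
  have m1 : ∫ z : ℝ, z ∂(gaussianReal 0 1) = 0 := integral_id_gaussianReal
  have m2 : ∫ z : ℝ, z ^ 2 ∂(gaussianReal 0 1) = 1 := by
    have h := variance_fun_id_gaussianReal (μ := 0) (v := 1)
    rw [variance_of_integral_eq_zero (by fun_prop) m1] at h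
    simpa using h
  have e : (fun z : ℝ => A + k * (c + b * z) ^ 2) =
      fun z => (A + k * c ^ 2) + ((2 * k * c * b) * z + (k * b ^ 2) * z ^ 2) := by
    ext z; ring
  have i1 : Integrable (fun z : ℝ => (2 * k * c * b) * z) (gaussianReal 0 1) := h1.const_mul _
  have i2 : Integrable (fun z : ℝ => (k * b ^ 2) * z ^ 2) (gaussianReal 0 1) := h2.const_mul _
  have i3 : Integrable (fun z : ℝ => (2 * k * c * b) * z + (k * b ^ 2) * z ^ 2)
    (gaussianReal 0 1) := i1.add i2
  rw [← ofReal_integral_eq_lintegral_ofReal]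
  · congr 1
    rw [e, integral_add (integrable_const _) i3, integral_add i1 i2, integral_const_mul,
      integral_const_mul, m1, m2]
    simp
    ring
  · rw [e]
    exact (integrable_const _).add i3
  · exact Filter.Eventually.of_forall fun z => by positivity

/-! ### Collision sums -/

/-- The collision sum of the superposition of two equally spaced constellations with `N₁`, `N₂`
points and amplitudes `G₁`, `G₂`. -/
def coll (N₁ : ℕ) (G₁ : ℝ) (N₂ : ℕ) (G₂ : ℝ) : ℝ :=
  ∑ i ∈ Finset.Ioo (-(N₁ : ℤ)) N₁, ∑ j ∈ Finset.Ioo (-(N₂ : ℤ)) N₂,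
    Real.exp (-|G₁ / Real.sqrt ((N₁ : ℝ) ^ 2 - 1) * i + G₂ / Real.sqrt ((N₂ : ℝ) ^ 2 - 1) * j|)

theorem one_le_coll {N₁ N₂ : ℕ} (h₁ : 1 ≤ N₁) (h₂ : 1 ≤ N₂) (G₁ G₂ : ℝ) :
    1 ≤ coll N₁ G₁ N₂ G₂ := by
  have h0 : (0 : ℤ) ∈ Finset.Ioo (-(N₁ : ℤ)) N₁ := by simp; omega
  have h0' : (0 : ℤ) ∈ Finset.Ioo (-(N₂ : ℤ)) N₂ := by simp; omega
  unfold coll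
  refine le_trans ?_ (Finset.single_le_sum (fun i _ => Finset.sum_nonneg
    fun j _ => (Real.exp_pos _).le) h0)
  refine le_trans ?_ (Finset.single_le_sum (fun j _ => (Real.exp_pos _).le) h0')
  simp

theorem sum_range_sub_le (N : ℕ) (F : ℤ → ℝ) (hF : ∀ a, 0 ≤ F a) {k : ℕ} (hk : k < N) :
    ∑ i ∈ Finset.range N, F ((i : ℤ) - k) ≤ ∑ a ∈ Finset.Ioo (-(N : ℤ)) N, F a := by
  rw [← Finset.sum_image (f := F) (g := fun i : ℕ => (i : ℤ) - k) (s := Finset.range N)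
    (by intro a _ b _ h; simpa using h)]
  refine Finset.sum_le_sum_of_subset_of_nonneg ?_ fun _ _ _ => hF _
  intro a ha
  simp only [Finset.mem_image, Finset.mem_range, Finset.mem_Ioo] at ha ⊢
  obtain ⟨i, hi, rfl⟩ := ha
  omega

/-- For a fixed first index, each difference occurs at most once. -/
theorem sum_range_sum_range_sub_le (N : ℕ) (F : ℤ → ℝ) (hF : ∀ a, 0 ≤ F a) :
    ∑ i ∈ Finset.range N, ∑ k ∈ Finset.range N, F ((k : ℤ) - i) ≤
      N * ∑ a ∈ Finset.Ioo (-(N : ℤ)) N, F a := by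
  refine (Finset.sum_le_sum fun i hi =>
    sum_range_sub_le N F hF (Finset.mem_range.mp hi)).trans ?_
  simp

theorem pamPoint_sub (N i k : ℕ) : pamPoint N i - pamPoint N k =
    Real.sqrt 12 / Real.sqrt ((N : ℝ) ^ 2 - 1) * (((i : ℤ) - k : ℤ) : ℝ) := by
  rw [pamPoint, pamPoint, Real.sqrt_div (by norm_num)]
  push_cast
  ring

/-- From `(t / 2 - 1) ^ 2 ≥ 0` with `t = |a| / √s`. An exponential weight turns later sums over
equally spaced points into geometric series. -/
theorem gker_le_exp {s : ℝ} (hs : 0 < s) (a : ℝ) :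
    gker (2 * s) a ≤ ENNReal.ofReal (Real.exp 1 * Real.exp (-|a / Real.sqrt s|)) := by
  unfold gker
  apply ENNReal.ofReal_le_ofReal
  rw [← Real.exp_add]
  apply Real.exp_le_exp.mpr
  have h : a ^ 2 = (a / Real.sqrt s) ^ 2 * s := by
    rw [div_pow, Real.sq_sqrt hs.le]; field_simp
  rw [h, ← sq_abs (a / Real.sqrt s)]
  have : -(|a / Real.sqrt s| ^ 2 * s) / (2 * (2 * s)) = -(|a / Real.sqrt s| ^ 2) / 4 := by
    field_simp; ring
  rw [this]
  nlinarith [sq_nonneg (|a / Real.sqrt s| / 2 - 1)]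

/-- The sum over all pairs of pairs of constellation points is controlled by the collision sum. -/
theorem sum_gker_le (N₁ N₂ : ℕ) (x y : ℝ) {s : ℝ} (hs : 0 < s) :
    ∑ i ∈ Finset.range N₁, ∑ i' ∈ Finset.range N₁, ∑ j ∈ Finset.range N₂,
      ∑ j' ∈ Finset.range N₂,
        gker (2 * s) (x * (pamPoint N₁ i' - pamPoint N₁ i) + y * (pamPoint N₂ j' - pamPoint N₂ j)) ≤
      ENNReal.ofReal (N₁ * N₂ * (Real.exp 1 * coll N₁ (Real.sqrt 12 * x / Real.sqrt s)
        N₂ (Real.sqrt 12 * y / Real.sqrt s))) := by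
  set G₁ := Real.sqrt 12 * x / Real.sqrt s
  set G₂ := Real.sqrt 12 * y / Real.sqrt s
  set F : ℤ → ℤ → ℝ := fun a b => Real.exp (-|G₁ / Real.sqrt ((N₁ : ℝ) ^ 2 - 1) * a +
    G₂ / Real.sqrt ((N₂ : ℝ) ^ 2 - 1) * b|) with hF
  have hF0 : ∀ a b, 0 ≤ F a b := fun a b => (Real.exp_pos _).le
  have step : ∀ i i' j j' : ℕ,
      gker (2 * s) (x * (pamPoint N₁ i' - pamPoint N₁ i) +
        y * (pamPoint N₂ j' - pamPoint N₂ j)) ≤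
      ENNReal.ofReal (Real.exp 1 * F ((i' : ℤ) - i) ((j' : ℤ) - j)) := by
    intro i i' j j'
    refine (gker_le_exp hs _).trans (le_of_eq ?_)
    rw [pamPoint_sub, pamPoint_sub, hF]
    congr 5
    simp only [G₁, G₂]
    ring
  refine (Finset.sum_le_sum fun i _ => Finset.sum_le_sum fun i' _ => Finset.sum_le_sum fun j _ =>
    Finset.sum_le_sum fun j' _ => step i i' j j').trans ?_
  simp_rw [← ENNReal.ofReal_sum_of_nonneg (fun _ _ => mul_nonneg (Real.exp_pos 1).le (hF0 _ _))]
  simp_rw [← ENNReal.ofReal_sum_of_nonneg (fun _ _ => Finset.sum_nonneg fun _ _ =>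
    mul_nonneg (Real.exp_pos 1).le (hF0 _ _))]
  simp_rw [← ENNReal.ofReal_sum_of_nonneg (fun _ _ => Finset.sum_nonneg fun _ _ =>
    Finset.sum_nonneg fun _ _ => mul_nonneg (Real.exp_pos 1).le (hF0 _ _))]
  rw [← ENNReal.ofReal_sum_of_nonneg (fun _ _ => Finset.sum_nonneg fun _ _ =>
    Finset.sum_nonneg fun _ _ => Finset.sum_nonneg fun _ _ =>
      mul_nonneg (Real.exp_pos 1).le (hF0 _ _))]
  apply ENNReal.ofReal_le_ofReal
  simp_rw [← Finset.mul_sum]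
  have h1 := sum_range_sum_range_sub_le N₁ (fun a => ∑ j ∈ Finset.range N₂,
    ∑ j' ∈ Finset.range N₂, F a ((j' : ℤ) - j))
    (fun a => Finset.sum_nonneg fun _ _ => Finset.sum_nonneg fun _ _ => hF0 _ _)
  have h2 : ∑ a ∈ Finset.Ioo (-(N₁ : ℤ)) N₁, ∑ j ∈ Finset.range N₂,
      ∑ j' ∈ Finset.range N₂, F a ((j' : ℤ) - j) ≤
      ∑ a ∈ Finset.Ioo (-(N₁ : ℤ)) N₁, N₂ * ∑ b ∈ Finset.Ioo (-(N₂ : ℤ)) N₂, F a b :=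
    Finset.sum_le_sum fun a _ => sum_range_sum_range_sub_le N₂ (F a) (hF0 a)
  rw [← Finset.mul_sum] at h2
  have h3 : coll N₁ G₁ N₂ G₂ = ∑ a ∈ Finset.Ioo (-(N₁ : ℤ)) N₁,
    ∑ b ∈ Finset.Ioo (-(N₂ : ℤ)) N₂, F a b := rfl
  rw [h3]
  calc _ ≤ Real.exp 1 * (N₁ * (N₂ * ∑ a ∈ Finset.Ioo (-(N₁ : ℤ)) N₁,
        ∑ b ∈ Finset.Ioo (-(N₂ : ℤ)) N₂, F a b)) := by
        gcongr
        exact h1.trans (by gcongr)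
    _ = _ := by ring

/-! ### Lower bound on the mutual information for mixed inputs -/

/-- Four successive convolutions: the noise, the interference, the input, and an independent copy of
the input. The square-root factors telescope. -/
theorem lintegral_gker_output {N₁ N₂ : ℕ} (h₁ : 1 ≤ N₁) (h₂ : 1 ≤ N₂) {δ₁ δ₂ : ℝ}
    (hδ₁ : 0 ≤ δ₁) (hδ₂ : 0 ≤ δ₂) (g g' w a : ℝ) (hw : 0 < w) :
    ∫⁻ x', ∫⁻ x, ∫⁻ x₂, ∫⁻ z, gker w (a + -g * x' + g * x + g' * x₂ + 1 * z) ∂(gaussianReal 0 1)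
        ∂(mixedInput N₂ δ₂) ∂(mixedInput N₁ δ₁) ∂(mixedInput N₁ δ₁) =
      ENNReal.ofReal (Real.sqrt (w / (w + 1 + g' ^ 2 * δ₂ + 2 * (g ^ 2 * δ₁)))) *
        ((N₁ : ℝ≥0∞)⁻¹ * ((N₁ : ℝ≥0∞)⁻¹ * ((N₂ : ℝ≥0∞)⁻¹ *
        ∑ i ∈ Finset.range N₁, ∑ i' ∈ Finset.range N₁, ∑ j ∈ Finset.range N₂,
          gker (w + 1 + g' ^ 2 * δ₂ + 2 * (g ^ 2 * δ₁))
            (a + -g * (Real.sqrt (1 - δ₁) * pamPoint N₁ i) +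
              g * (Real.sqrt (1 - δ₁) * pamPoint N₁ i') +
              g' * (Real.sqrt (1 - δ₂) * pamPoint N₂ j))))) := by
  have hw1 : 0 < w + 1 ^ 2 := by positivity
  have hw2 : 0 < w + 1 ^ 2 + g' ^ 2 * δ₂ := by positivity
  have hw3 : 0 < w + 1 ^ 2 + g' ^ 2 * δ₂ + g ^ 2 * δ₁ := by positivity
  have hw4 : 0 < w + 1 ^ 2 + g' ^ 2 * δ₂ + g ^ 2 * δ₁ + g ^ 2 * δ₁ := by positivity
  have e : w + 1 + g' ^ 2 * δ₂ + 2 * (g ^ 2 * δ₁) =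
    w + 1 ^ 2 + g' ^ 2 * δ₂ + g ^ 2 * δ₁ + g ^ 2 * δ₁ := by ring
  simp_rw [lintegral_gker w _ 1 hw]
  simp_rw [lintegral_const_mul' _ _ ENNReal.ofReal_ne_top,
    lintegral_gker_mixedInput h₂ hδ₂ _ _ _ hw1]
  simp_rw [lintegral_const_mul' _ _ ENNReal.ofReal_ne_top,
    lintegral_const_mul' _ _ (ENNReal.inv_ne_top.mpr (show (N₂ : ℝ≥0∞) ≠ 0 by simp; omega))]
  have f1 : ∀ x' : ℝ, ∫⁻ x, ∑ j ∈ Finset.range N₂, gker (w + 1 ^ 2 + g' ^ 2 * δ₂)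
      (a + -g * x' + g * x + g' * (Real.sqrt (1 - δ₂) * pamPoint N₂ j)) ∂(mixedInput N₁ δ₁) =
      ∑ j ∈ Finset.range N₂, ENNReal.ofReal (Real.sqrt ((w + 1 ^ 2 + g' ^ 2 * δ₂) /
        (w + 1 ^ 2 + g' ^ 2 * δ₂ + g ^ 2 * δ₁))) * ((N₁ : ℝ≥0∞)⁻¹ * ∑ i ∈ Finset.range N₁,
        gker (w + 1 ^ 2 + g' ^ 2 * δ₂ + g ^ 2 * δ₁)
          (a + -g * x' + g' * (Real.sqrt (1 - δ₂) * pamPoint N₂ j) +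
            g * (Real.sqrt (1 - δ₁) * pamPoint N₁ i))) := by
    intro x'
    rw [lintegral_finsetSum _ (fun j _ => by fun_prop)]
    refine Finset.sum_congr rfl fun j _ => ?_
    rw [← lintegral_gker_mixedInput h₁ hδ₁ _ _ _ hw2]
    congr 1; ext x; congr 1; ring
  simp_rw [f1, ← Finset.mul_sum]
  simp_rw [lintegral_const_mul' _ _ ENNReal.ofReal_ne_top,
    lintegral_const_mul' _ _ (ENNReal.inv_ne_top.mpr (show (N₁ : ℝ≥0∞) ≠ 0 by simp; omega))]
  have f2 : ∫⁻ x', ∑ j ∈ Finset.range N₂, ∑ i ∈ Finset.range N₁,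
        gker (w + 1 ^ 2 + g' ^ 2 * δ₂ + g ^ 2 * δ₁)
          (a + -g * x' + g' * (Real.sqrt (1 - δ₂) * pamPoint N₂ j) +
            g * (Real.sqrt (1 - δ₁) * pamPoint N₁ i)) ∂(mixedInput N₁ δ₁) =
      ∑ j ∈ Finset.range N₂, ∑ i ∈ Finset.range N₁,
        ENNReal.ofReal (Real.sqrt ((w + 1 ^ 2 + g' ^ 2 * δ₂ + g ^ 2 * δ₁) /
        (w + 1 ^ 2 + g' ^ 2 * δ₂ + g ^ 2 * δ₁ + g ^ 2 * δ₁))) *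
        ((N₁ : ℝ≥0∞)⁻¹ * ∑ i' ∈ Finset.range N₁,
        gker (w + 1 ^ 2 + g' ^ 2 * δ₂ + g ^ 2 * δ₁ + g ^ 2 * δ₁)
          (a + g' * (Real.sqrt (1 - δ₂) * pamPoint N₂ j) +
            g * (Real.sqrt (1 - δ₁) * pamPoint N₁ i) +
            -g * (Real.sqrt (1 - δ₁) * pamPoint N₁ i'))) := by
    rw [lintegral_finsetSum _ (fun j _ => by fun_prop)]
    refine Finset.sum_congr rfl fun j _ => ?_
    rw [lintegral_finsetSum _ (fun j _ => by fun_prop)]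
    refine Finset.sum_congr rfl fun i _ => ?_
    have h := lintegral_gker_mixedInput h₁ hδ₁ _ (a + g' * (Real.sqrt (1 - δ₂) * pamPoint N₂ j) +
            g * (Real.sqrt (1 - δ₁) * pamPoint N₁ i)) (-g) hw3
    rw [neg_sq] at h
    rw [← h]
    congr 1; ext x; congr 1; ring
  rw [f2]
  simp_rw [← Finset.mul_sum]
  have hs : Real.sqrt (w / (w + 1 + g' ^ 2 * δ₂ + 2 * (g ^ 2 * δ₁))) =
      Real.sqrt (w / (w + 1 ^ 2)) * (Real.sqrt ((w + 1 ^ 2) / (w + 1 ^ 2 + g' ^ 2 * δ₂)) *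
      (Real.sqrt ((w + 1 ^ 2 + g' ^ 2 * δ₂) / (w + 1 ^ 2 + g' ^ 2 * δ₂ + g ^ 2 * δ₁)) *
      Real.sqrt ((w + 1 ^ 2 + g' ^ 2 * δ₂ + g ^ 2 * δ₁) /
        (w + 1 ^ 2 + g' ^ 2 * δ₂ + g ^ 2 * δ₁ + g ^ 2 * δ₁)))) := by
    rw [← Real.sqrt_mul (by positivity), ← Real.sqrt_mul (by positivity),
      ← Real.sqrt_mul (by positivity), e]
    congr 1
    field_simp
  rw [hs, ENNReal.ofReal_mul (by positivity), ENNReal.ofReal_mul (by positivity),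
    ENNReal.ofReal_mul (by positivity), e]
  have hsum : ∑ j ∈ Finset.range N₂, ∑ i ∈ Finset.range N₁, ∑ i' ∈ Finset.range N₁,
        gker (w + 1 ^ 2 + g' ^ 2 * δ₂ + g ^ 2 * δ₁ + g ^ 2 * δ₁)
          (a + g' * (Real.sqrt (1 - δ₂) * pamPoint N₂ j) +
            g * (Real.sqrt (1 - δ₁) * pamPoint N₁ i) +
            -g * (Real.sqrt (1 - δ₁) * pamPoint N₁ i')) =
      ∑ i ∈ Finset.range N₁, ∑ i' ∈ Finset.range N₁, ∑ j ∈ Finset.range N₂,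
          gker (w + 1 ^ 2 + g' ^ 2 * δ₂ + g ^ 2 * δ₁ + g ^ 2 * δ₁)
            (a + -g * (Real.sqrt (1 - δ₁) * pamPoint N₁ i) +
              g * (Real.sqrt (1 - δ₁) * pamPoint N₁ i') +
              g' * (Real.sqrt (1 - δ₂) * pamPoint N₂ j)) := by
    rw [Finset.sum_comm]
    simp_rw [fun i => Finset.sum_comm (s := Finset.range N₂) (t := Finset.range N₁)
      (f := fun j i' => gker (w + 1 ^ 2 + g' ^ 2 * δ₂ + g ^ 2 * δ₁ + g ^ 2 * δ₁)
          (a + g' * (Real.sqrt (1 - δ₂) * pamPoint N₂ j) +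
            g * (Real.sqrt (1 - δ₁) * pamPoint N₁ i) +
            -g * (Real.sqrt (1 - δ₁) * pamPoint N₁ i')))]
    rw [Finset.sum_comm]
    refine Finset.sum_congr rfl fun i _ => Finset.sum_congr rfl fun i' _ =>
      Finset.sum_congr rfl fun j _ => ?_
    congr 1; ring
  rw [hsum]
  ring

theorem lintegral_inputOutputLaw {P P' : Measure ℝ} [IsProbabilityMeasure P]
    [IsProbabilityMeasure P'] (g g' : ℝ) {F : ℝ × ℝ → ℝ≥0∞} (hF : Measurable F) :
    ∫⁻ p, F p ∂(inputOutputLaw g g' P P') =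
      ∫⁻ x, ∫⁻ x₂, ∫⁻ z, F (x, g * x + g' * x₂ + z) ∂(gaussianReal 0 1) ∂P' ∂P := by
  rw [inputOutputLaw, lintegral_map hF (by fun_prop), lintegral_prod _ (by fun_prop)]
  refine lintegral_congr fun x => ?_
  rw [lintegral_prod _ (by fun_prop)]

/-- Under the product of the marginals, the input is a fresh copy `x'`, independent of the `x` that
produced the output. -/
theorem lintegral_prod_marginals {P P' : Measure ℝ} [IsProbabilityMeasure P]
    [IsProbabilityMeasure P'] (g g' : ℝ) {F : ℝ × ℝ → ℝ≥0∞} (hF : Measurable F) :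
    ∫⁻ p, F p ∂((inputOutputLaw g g' P P').fst.prod (inputOutputLaw g g' P P').snd) =
      ∫⁻ x', ∫⁻ x, ∫⁻ x₂, ∫⁻ z, F (x', g * x + g' * x₂ + z) ∂(gaussianReal 0 1) ∂P' ∂P ∂P := by
  have : IsProbabilityMeasure (inputOutputLaw g g' P P') :=
    Measure.isProbabilityMeasure_map (by fun_prop)
  rw [lintegral_prod _ hF.aemeasurable, Measure.fst,
    lintegral_map (by fun_prop) measurable_fst, lintegral_inputOutputLaw g g'
      (F := fun p => ∫⁻ y, F (p.1, y) ∂(inputOutputLaw g g' P P').snd) (by fun_prop)]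
  simp only [lintegral_const, measure_univ, mul_one]
  refine lintegral_congr fun x' => ?_
  rw [Measure.snd, lintegral_map (by fun_prop) measurable_snd,
    lintegral_inputOutputLaw g g' (F := fun p => F (x', p.2)) (by fun_prop)]

/-- The amplitude of a constellation, relative to the noise variance `s`. -/
def amp (g δ s : ℝ) : ℝ := Real.sqrt 12 * (g * Real.sqrt (1 - δ)) / Real.sqrt s

/-- The width `w` of the bumps and the Gaussian variances of noise, interference and two copies of
the input add up to `2 s`. Only differences of constellation points remain, and these are what the
collision sum counts. -/
theorem lintegral_kernel_le {N₁ N₂ : ℕ} (h₁ : 1 ≤ N₁) (h₂ : 1 ≤ N₂) {δ₁ δ₂ : ℝ}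
    (hδ₁ : 0 ≤ δ₁) (hδ₂ : 0 ≤ δ₂) {g g' w s : ℝ} (hw : w = 1 + g' ^ 2 * δ₂)
    (hs : s = w + g ^ 2 * δ₁) :
    ∫⁻ p, ∑ j ∈ Finset.range N₂,
        gker w (p.2 - g * p.1 - g' * (Real.sqrt (1 - δ₂) * pamPoint N₂ j))
      ∂((inputOutputLaw g g' (mixedInput N₁ δ₁) (mixedInput N₂ δ₂)).fst.prod
        (inputOutputLaw g g' (mixedInput N₁ δ₁) (mixedInput N₂ δ₂)).snd) ≤
    ENNReal.ofReal (Real.sqrt (w / (2 * s)) *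
      (Real.exp 1 * coll N₁ (amp g δ₁ s) N₂ (amp g' δ₂ s)) / N₁) := by
  have := isProbabilityMeasure_mixedInput h₁ δ₁
  have := isProbabilityMeasure_mixedInput h₂ δ₂
  have hw0 : 0 < w := by rw [hw]; positivity
  have hs0 : 0 < s := by rw [hs]; positivity
  have hN1 : (0 : ℝ) < N₁ := by exact_mod_cast h₁
  have hN2 : (0 : ℝ) < N₂ := by exact_mod_cast h₂
  have h2s : w + 1 + g' ^ 2 * δ₂ + 2 * (g ^ 2 * δ₁) = 2 * s := by rw [hs, hw]; ring
  rw [lintegral_finsetSum _ (fun j _ => by fun_prop)]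
  have key : ∀ j ∈ Finset.range N₂,
      ∫⁻ p, gker w (p.2 - g * p.1 - g' * (Real.sqrt (1 - δ₂) * pamPoint N₂ j))
      ∂((inputOutputLaw g g' (mixedInput N₁ δ₁) (mixedInput N₂ δ₂)).fst.prod
        (inputOutputLaw g g' (mixedInput N₁ δ₁) (mixedInput N₂ δ₂)).snd) =
      ENNReal.ofReal (Real.sqrt (w / (2 * s))) *
        ((N₁ : ℝ≥0∞)⁻¹ * ((N₁ : ℝ≥0∞)⁻¹ * ((N₂ : ℝ≥0∞)⁻¹ *
        ∑ i ∈ Finset.range N₁, ∑ i' ∈ Finset.range N₁, ∑ j' ∈ Finset.range N₂,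
          gker (2 * s) (g * Real.sqrt (1 - δ₁) * (pamPoint N₁ i' - pamPoint N₁ i) +
            g' * Real.sqrt (1 - δ₂) * (pamPoint N₂ j' - pamPoint N₂ j))))) := by
    intro j _
    rw [lintegral_prod_marginals g g' (by fun_prop)]
    have h := lintegral_gker_output h₁ h₂ hδ₁ hδ₂ g g' w
      (-(g' * (Real.sqrt (1 - δ₂) * pamPoint N₂ j))) hw0
    rw [h2s] at h
    convert h using 1
    · refine lintegral_congr fun x' => lintegral_congr fun x => lintegral_congr fun x₂ =>
        lintegral_congr fun z => ?_
      congr 1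
      ring
    · congr 4
      refine Finset.sum_congr rfl fun i _ => Finset.sum_congr rfl fun i' _ =>
        Finset.sum_congr rfl fun j' _ => ?_
      congr 1
      ring
  rw [Finset.sum_congr rfl key]
  simp_rw [← Finset.mul_sum]
  have hsum : ∑ j ∈ Finset.range N₂, ∑ i ∈ Finset.range N₁, ∑ i' ∈ Finset.range N₁,
      ∑ j' ∈ Finset.range N₂,
          gker (2 * s) (g * Real.sqrt (1 - δ₁) * (pamPoint N₁ i' - pamPoint N₁ i) +
            g' * Real.sqrt (1 - δ₂) * (pamPoint N₂ j' - pamPoint N₂ j)) =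
      ∑ i ∈ Finset.range N₁, ∑ i' ∈ Finset.range N₁, ∑ j ∈ Finset.range N₂,
      ∑ j' ∈ Finset.range N₂,
          gker (2 * s) (g * Real.sqrt (1 - δ₁) * (pamPoint N₁ i' - pamPoint N₁ i) +
            g' * Real.sqrt (1 - δ₂) * (pamPoint N₂ j' - pamPoint N₂ j)) := by
    rw [Finset.sum_comm]
    refine Finset.sum_congr rfl fun i _ => ?_
    rw [Finset.sum_comm]
  rw [hsum]
  refine (mul_le_mul_right (mul_le_mul_right (mul_le_mul_right (mul_le_mul_right
    (sum_gker_le N₁ N₂ _ _ hs0) _) _) _) _).trans (le_of_eq ?_)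
  rw [← ENNReal.ofReal_natCast N₁, ← ENNReal.ofReal_natCast N₂, ← ENNReal.ofReal_inv_of_pos hN1,
    ← ENNReal.ofReal_inv_of_pos hN2, ← ENNReal.ofReal_mul (by positivity),
    ← ENNReal.ofReal_mul (by positivity), ← ENNReal.ofReal_mul (by positivity),
    ← ENNReal.ofReal_mul (by positivity)]
  congr 1
  unfold amp
  field_simp

/-- Under the true joint law the bump at the transmitted interfering point has as argument a centred
Gaussian of variance exactly `w`, so its mean exponent is `-1 / 2`. The shift `A` will make the
integrand nonnegative. -/
theorem lintegral_log_kernel_le {N₂ : ℕ} (h₂ : 1 ≤ N₂) {δ₂ : ℝ} (hδ₂ : 0 ≤ δ₂) {g' w ε A : ℝ}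
    (hw : w = 1 + g' ^ 2 * δ₂) (hε : 0 < ε) (hA : 0 ≤ A) :
    ∫⁻ x₂, ∫⁻ z, ENNReal.ofReal (A - Real.log (ε + ∑ j ∈ Finset.range N₂,
        Real.exp (-(g' * x₂ + z - g' * (Real.sqrt (1 - δ₂) * pamPoint N₂ j)) ^ 2 / (2 * w))))
      ∂(gaussianReal 0 1) ∂(mixedInput N₂ δ₂) ≤ ENNReal.ofReal (A + 1 / 2) := by
  have hw0 : 0 < w := by rw [hw]; positivity
  rw [lintegral_mixedInput h₂ _ (by
    refine Measurable.lintegral_prod_right' (f := fun p : ℝ × ℝ => ENNReal.ofReal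
      (A - Real.log (ε + ∑ j ∈ Finset.range N₂, Real.exp (-(g' * p.1 + p.2 -
        g' * (Real.sqrt (1 - δ₂) * pamPoint N₂ j)) ^ 2 / (2 * w))))) ?_
    fun_prop)]
  have key : ∀ i ∈ Finset.range N₂, ∫⁻ t, ∫⁻ z, ENNReal.ofReal (A - Real.log (ε +
      ∑ j ∈ Finset.range N₂, Real.exp (-(g' * (Real.sqrt (1 - δ₂) * pamPoint N₂ i +
        Real.sqrt δ₂ * t) + z - g' * (Real.sqrt (1 - δ₂) * pamPoint N₂ j)) ^ 2 / (2 * w))))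
      ∂(gaussianReal 0 1) ∂(gaussianReal 0 1) ≤ ENNReal.ofReal (A + 1 / 2) := by
    intro i hi
    calc _ ≤ ∫⁻ t, ∫⁻ z, ENNReal.ofReal (A + (1 / (2 * w)) *
          (g' * Real.sqrt δ₂ * t + 1 * z) ^ 2) ∂(gaussianReal 0 1) ∂(gaussianReal 0 1) := by
          refine lintegral_mono fun t => lintegral_mono fun z => ENNReal.ofReal_le_ofReal ?_
          have h1 : Real.exp (-(1 / (2 * w)) * (g' * Real.sqrt δ₂ * t + 1 * z) ^ 2) ≤
              ε + ∑ j ∈ Finset.range N₂, Real.exp (-(g' * (Real.sqrt (1 - δ₂) * pamPoint N₂ i +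
              Real.sqrt δ₂ * t) + z - g' * (Real.sqrt (1 - δ₂) * pamPoint N₂ j)) ^ 2 / (2 * w)) := by
            have := Finset.single_le_sum (f := fun j => Real.exp (-(g' * (Real.sqrt (1 - δ₂) *
              pamPoint N₂ i + Real.sqrt δ₂ * t) + z -
              g' * (Real.sqrt (1 - δ₂) * pamPoint N₂ j)) ^ 2 / (2 * w)))
              (fun j _ => (Real.exp_pos _).le) hi
            refine le_trans (le_of_eq ?_) (this.trans (by linarith))
            congr 1
            ring
          have h2 := Real.log_le_log (Real.exp_pos _) h1
          rw [Real.log_exp] at h2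
          linarith
      _ = ∫⁻ t, ENNReal.ofReal ((A + 1 / (2 * w)) + (1 / (2 * w)) *
          (0 + g' * Real.sqrt δ₂ * t) ^ 2) ∂(gaussianReal 0 1) := by
          refine lintegral_congr fun t => ?_
          rw [lintegral_quadratic _ _ _ _ hA (by positivity)]
          congr 1
          ring
      _ = ENNReal.ofReal (A + 1 / 2) := by
          rw [lintegral_quadratic _ _ _ _ (by positivity) (by positivity), mul_pow,
            Real.sq_sqrt hδ₂]
          congr 1
          rw [hw]
          have : 1 + g' ^ 2 * δ₂ ≠ 0 := by rw [← hw]; exact hw0.ne'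
          field_simp
          ring
  refine (mul_le_mul_right (Finset.sum_le_sum key) _).trans (le_of_eq ?_)
  rw [Finset.sum_const, Finset.card_range, nsmul_eq_mul, ← mul_assoc,
    ENNReal.inv_mul_cancel (by simp; omega) (by simp), one_mul]

/-- Lower bound on the mutual information of a Gaussian interference channel with mixed inputs. -/
theorem le_mutualInfo {N₁ N₂ : ℕ} (h₁ : 1 ≤ N₁) (h₂ : 1 ≤ N₂) {δ₁ δ₂ : ℝ}
    (hδ₁ : 0 ≤ δ₁) (hδ₂ : 0 ≤ δ₂) {g g' w s : ℝ} (hw : w = 1 + g' ^ 2 * δ₂)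
    (hs : s = w + g ^ 2 * δ₁) :
    ENNReal.ofReal (Real.logb 2 (N₁ * Real.sqrt (s / w) /
      (7 * coll N₁ (amp g δ₁ s) N₂ (amp g' δ₂ s)))) ≤
    mutualInfo (inputOutputLaw g g' (mixedInput N₁ δ₁) (mixedInput N₂ δ₂)) := by
  have hw0 : 0 < w := by rw [hw]; positivity
  have hs0 : 0 < s := by rw [hs]; positivity
  have hN1 : (0 : ℝ) < N₁ := by exact_mod_cast h₁
  have i1 := isProbabilityMeasure_mixedInput h₁ δ₁
  have i2 := isProbabilityMeasure_mixedInput h₂ δ₂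
  have hc := one_le_coll h₁ h₂ (amp g δ₁ s) (amp g' δ₂ s)
  have hq := lintegral_kernel_le h₁ h₂ hδ₁ hδ₂ hw hs
  set μ := inputOutputLaw g g' (mixedInput N₁ δ₁) (mixedInput N₂ δ₂) with hμ
  set K := coll N₁ (amp g δ₁ s) N₂ (amp g' δ₂ s)
  set X := Real.sqrt (w / (2 * s)) * (Real.exp 1 * K) / N₁ with hX
  have hX0 : 0 < X := by positivity
  have : IsProbabilityMeasure μ := Measure.isProbabilityMeasure_map (by fun_prop)
  set q : ℝ × ℝ → ℝ := fun p => ∑ j ∈ Finset.range N₂,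
    Real.exp (-(p.2 - g * p.1 - g' * (Real.sqrt (1 - δ₂) * pamPoint N₂ j)) ^ 2 / (2 * w)) with hqd
  have hqm : Measurable q := by fun_prop
  have hq0 : ∀ p, 0 ≤ q p := fun p => Finset.sum_nonneg fun _ _ => (Real.exp_pos _).le
  have hqN : ∀ p, q p ≤ N₂ := by
    intro p
    calc q p ≤ ∑ j ∈ Finset.range N₂, (1 : ℝ) := by
          refine Finset.sum_le_sum fun j _ => ?_
          rw [Real.exp_le_one_iff]
          have : 0 ≤ (p.2 - g * p.1 - g' * (Real.sqrt (1 - δ₂) * pamPoint N₂ j)) ^ 2 / (2 * w) := by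
            positivity
          rw [neg_div]
          linarith
      _ = N₂ := by simp
  have hqE : ∀ p, ENNReal.ofReal (q p) = ∑ j ∈ Finset.range N₂,
        gker w (p.2 - g * p.1 - g' * (Real.sqrt (1 - δ₂) * pamPoint N₂ j)) := by
    intro p
    rw [hqd, ENNReal.ofReal_sum_of_nonneg fun _ _ => (Real.exp_pos _).le]
    rfl
  -- Adding `X`, an upper bound for the mean of `q` under the product law, keeps `f` bounded below,
  -- hence integrable, and costs only a factor 2 in the exponential moment.
  set f : ℝ × ℝ → ℝ := fun p => Real.log (X + q p) with hf
  have hXq : ∀ p, 0 < X + q p := fun p => by linarith [hq0 p]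
  have hfm : Measurable f := by fun_prop
  have hfl : ∀ p, Real.log X ≤ f p := fun p => Real.log_le_log hX0 (by linarith [hq0 p])
  have hfu : ∀ p, f p ≤ Real.log (X + N₂) := fun p =>
    Real.log_le_log (hXq p) (by linarith [hqN p])
  have hfi : ∀ ν : Measure (ℝ × ℝ), IsProbabilityMeasure ν → Integrable f ν := fun ν _ =>
    Integrable.of_mem_Icc _ _ hfm.aemeasurable
      (Filter.Eventually.of_forall fun p => ⟨hfl p, hfu p⟩)
  have hexp : (fun p => Real.exp (f p)) = fun p => X + q p := by
    ext p
    exact Real.exp_log (hXq p)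
  have hqi : Integrable q (μ.fst.prod μ.snd) :=
    Integrable.of_mem_Icc 0 N₂ hqm.aemeasurable
      (Filter.Eventually.of_forall fun p => ⟨hq0 p, hqN p⟩)
  have hkl := ofReal_le_klDiv (μ := μ) (ν := μ.fst.prod μ.snd) (f := f) (hfi _ inferInstance)
    (by rw [hexp]; exact (integrable_const _).add hqi)
  rw [hexp, integral_add (integrable_const _) hqi] at hkl
  simp only [integral_const, probReal_univ, one_smul] at hkl
  have hqX : ∫ p, q p ∂(μ.fst.prod μ.snd) ≤ X := by
    rw [integral_eq_lintegral_of_nonneg_ae (Filter.Eventually.of_forall hq0)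
      hqm.aestronglyMeasurable]
    simp_rw [hqE]
    exact ENNReal.toReal_le_of_le_ofReal hX0.le hq
  have hqnn : 0 ≤ ∫ p, q p ∂(μ.fst.prod μ.snd) := integral_nonneg hq0
  have hfint : -(1 / 2) ≤ ∫ p, f p ∂μ := by
    set A := |Real.log (X + N₂)| with hA
    have hA0 : 0 ≤ A := abs_nonneg _
    have hAf : ∀ p, 0 ≤ A - f p := fun p => by linarith [hfu p, le_abs_self (Real.log (X + N₂))]
    have h := lintegral_log_kernel_le h₂ hδ₂ hw hX0 hA0
    have h' : ∫⁻ p, ENNReal.ofReal (A - f p) ∂μ ≤ ENNReal.ofReal (A + 1 / 2) := by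
      rw [hμ, lintegral_inputOutputLaw g g' (by fun_prop)]
      have e : ∀ x : ℝ, ∫⁻ x₂, ∫⁻ z, ENNReal.ofReal (A - f (x, g * x + g' * x₂ + z))
          ∂(gaussianReal 0 1) ∂(mixedInput N₂ δ₂) = ∫⁻ x₂, ∫⁻ z, ENNReal.ofReal (A -
          Real.log (X + ∑ j ∈ Finset.range N₂,
          Real.exp (-(g' * x₂ + z - g' * (Real.sqrt (1 - δ₂) * pamPoint N₂ j)) ^ 2 / (2 * w))))
          ∂(gaussianReal 0 1) ∂(mixedInput N₂ δ₂) := by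
        intro x
        refine lintegral_congr fun x₂ => lintegral_congr fun z => ?_
        simp only [hf, hqd]
        congr 4
        refine Finset.sum_congr rfl fun j _ => ?_
        congr 1
        ring
      simp_rw [e]
      simpa using h
    have h2 : ∫ p, (A - f p) ∂μ ≤ A + 1 / 2 := by
      rw [integral_eq_lintegral_of_nonneg_ae (Filter.Eventually.of_forall hAf)
        (by fun_prop)]
      exact ENNReal.toReal_le_of_le_ofReal (by linarith) h'
    rw [integral_sub (integrable_const _) (hfi _ inferInstance)] at h2
    simp at h2
    linarith
  have hlog : Real.log (X + ∫ p, q p ∂(μ.fst.prod μ.snd)) ≤ Real.log (2 * X) :=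
    Real.log_le_log (by linarith) (by linarith)
  unfold mutualInfo
  have hl2 : 0 < Real.log 2 := Real.log_pos (by norm_num)
  rw [ENNReal.le_div_iff_mul_le (by simp [hl2]) (by simp), ← ENNReal.ofReal_mul' hl2.le]
  refine le_trans (ENNReal.ofReal_le_ofReal ?_) hkl
  rw [Real.logb, div_mul_cancel₀ _ hl2.ne']
  -- The exact constant is `√2 * e ^ (3 / 2)`, about 6.34; it is rounded up to 7.
  have hmain : Real.log (N₁ * Real.sqrt (s / w) / (7 * K)) ≤ -(1 / 2) - Real.log (2 * X) := by
    rw [Real.log_le_iff_le_exp (by positivity), Real.exp_sub, Real.exp_log (by positivity),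
      le_div_iff₀ (by positivity), hX]
    have e1 : Real.sqrt (s / w) * Real.sqrt (w / (2 * s)) = Real.sqrt (1 / 2) := by
      rw [← Real.sqrt_mul (by positivity)]
      congr 1
      field_simp
    have e2 : N₁ * Real.sqrt (s / w) / (7 * K) *
        (2 * (Real.sqrt (w / (2 * s)) * (Real.exp 1 * K) / N₁)) =
        2 / 7 * (Real.sqrt (s / w) * Real.sqrt (w / (2 * s))) * Real.exp 1 := by
      field_simp
    rw [e2, e1]
    have e3 : Real.exp 1 = Real.exp (-(1 / 2)) * (Real.exp 1 * Real.exp (1 / 2)) := by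
      rw [← Real.exp_add, ← Real.exp_add]; norm_num
    have e4 : (Real.exp 1 * Real.exp (1 / 2)) ^ 2 = Real.exp 1 ^ 3 := by
      rw [mul_pow, ← Real.exp_nat_mul (1 / 2), ← Real.exp_nat_mul 1, ← Real.exp_nat_mul 1,
        ← Real.exp_add]
      norm_num
    have e5 : Real.exp 1 ^ 3 ≤ 2.7182818286 ^ 3 :=
      pow_le_pow_left₀ (Real.exp_pos 1).le Real.exp_one_lt_d9.le 3
    have e6 : 2 / 7 * Real.sqrt (1 / 2) * (Real.exp 1 * Real.exp (1 / 2)) ≤ 1 := by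
      apply le_of_sq_le_sq _ (by norm_num)
      rw [mul_pow, mul_pow, e4, Real.sq_sqrt (by norm_num)]
      norm_num at e5 ⊢
      linarith
    calc 2 / 7 * Real.sqrt (1 / 2) * Real.exp 1 = Real.exp (-(1 / 2)) *
          (2 / 7 * Real.sqrt (1 / 2) * (Real.exp 1 * Real.exp (1 / 2))) := by
          conv_lhs => rw [e3]
          ring
      _ ≤ Real.exp (-(1 / 2)) * 1 := by gcongr
      _ = _ := mul_one _
  linarith

/-! ### Exponential sums over separated points -/

theorem one_div_one_sub_exp_neg_le {η : ℝ} (hη : 0 < η) :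
    1 / (1 - Real.exp (-η)) ≤ 1 + 1 / η := by
  have h1 : Real.exp (-η) ≤ 1 / (1 + η) := by
    rw [Real.exp_neg, ← one_div]
    exact one_div_le_one_div_of_le (by linarith) (by linarith [Real.add_one_le_exp η])
  have h2 : η / (1 + η) ≤ 1 - Real.exp (-η) := by
    have : η / (1 + η) = 1 - 1 / (1 + η) := by field_simp; ring
    linarith
  calc 1 / (1 - Real.exp (-η)) ≤ 1 / (η / (1 + η)) :=
        one_div_le_one_div_of_le (by positivity) h2
    _ = 1 + 1 / η := by field_simp; ring

/-- If every unit interval contains at most `m` of the points `z x`, the sum of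
`exp (-η |z x + t|)` is at most `4 m (1 + 1 / η)`. -/
theorem sum_exp_neg_abs_le {ι : Type*} (s : Finset ι) (z : ι → ℝ) (m : ℕ) {η : ℝ} (hη : 0 < η)
    (t : ℝ) (h : ∀ k : ℤ, (s.filter fun x => ⌊z x⌋ = k).card ≤ m) :
    ∑ x ∈ s, Real.exp (-(η * |z x + t|)) ≤ 4 * m * (1 + 1 / η) := by
  classical
  -- The condition confines `z x` to two intervals of length one, one per sign, and each meets at
  -- most two unit cells.
  have hfib : ∀ n : ℕ, (s.filter fun x => ⌊|z x + t|⌋₊ = n).card ≤ 4 * m := by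
    intro n
    have hsub : (s.filter fun x => ⌊|z x + t|⌋₊ = n) ⊆
        ((s.filter fun x => ⌊z x⌋ = ⌊(n : ℝ) - t⌋) ∪ (s.filter fun x => ⌊z x⌋ = ⌊(n : ℝ) - t⌋ + 1)) ∪
        ((s.filter fun x => ⌊z x⌋ = ⌊-(n : ℝ) - 1 - t⌋) ∪
          (s.filter fun x => ⌊z x⌋ = ⌊-(n : ℝ) - 1 - t⌋ + 1)) := by
      intro x hx
      simp only [Finset.mem_filter, Finset.mem_union] at hx ⊢
      obtain ⟨hxs, hx⟩ := hx
      rw [Nat.floor_eq_iff (abs_nonneg _)] at hx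
      rcases le_total 0 (z x + t) with h0 | h0
      · rw [abs_of_nonneg h0] at hx
        have a1 : ⌊(n : ℝ) - t⌋ ≤ ⌊z x⌋ := Int.floor_le_floor (by linarith)
        have a2 : ⌊z x⌋ ≤ ⌊(n : ℝ) - t⌋ + 1 := by
          rw [← Int.floor_add_one]; exact Int.floor_le_floor (by linarith)
        have : ⌊z x⌋ = ⌊(n : ℝ) - t⌋ ∨ ⌊z x⌋ = ⌊(n : ℝ) - t⌋ + 1 := by omega
        tauto
      · rw [abs_of_nonpos h0] at hx
        have a1 : ⌊-(n : ℝ) - 1 - t⌋ ≤ ⌊z x⌋ := Int.floor_le_floor (by linarith)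
        have a2 : ⌊z x⌋ ≤ ⌊-(n : ℝ) - 1 - t⌋ + 1 := by
          rw [← Int.floor_add_one]; exact Int.floor_le_floor (by linarith)
        have : ⌊z x⌋ = ⌊-(n : ℝ) - 1 - t⌋ ∨ ⌊z x⌋ = ⌊-(n : ℝ) - 1 - t⌋ + 1 := by omega
        tauto
    refine (Finset.card_le_card hsub).trans ?_
    refine (Finset.card_union_le _ _).trans ?_
    have b1 := Finset.card_union_le (s.filter fun x => ⌊z x⌋ = ⌊(n : ℝ) - t⌋)
      (s.filter fun x => ⌊z x⌋ = ⌊(n : ℝ) - t⌋ + 1)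
    have b2 := Finset.card_union_le (s.filter fun x => ⌊z x⌋ = ⌊-(n : ℝ) - 1 - t⌋)
      (s.filter fun x => ⌊z x⌋ = ⌊-(n : ℝ) - 1 - t⌋ + 1)
    have c1 := h ⌊(n : ℝ) - t⌋
    have c2 := h (⌊(n : ℝ) - t⌋ + 1)
    have c3 := h ⌊-(n : ℝ) - 1 - t⌋
    have c4 := h (⌊-(n : ℝ) - 1 - t⌋ + 1)
    omega
  set T := s.sup (fun x => ⌊|z x + t|⌋₊) + 1 with hT
  have hmaps : ∀ x ∈ s, ⌊|z x + t|⌋₊ ∈ Finset.range T := by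
    intro x hx
    rw [Finset.mem_range, hT]
    exact Nat.lt_succ_of_le (Finset.le_sup (f := fun x => ⌊|z x + t|⌋₊) hx)
  rw [← Finset.sum_fiberwise_of_maps_to hmaps]
  have hr0 : 0 ≤ Real.exp (-η) := (Real.exp_pos _).le
  have hr1 : Real.exp (-η) < 1 := by rw [Real.exp_lt_one_iff]; linarith
  calc _ ≤ ∑ n ∈ Finset.range T, (4 * m : ℝ) * Real.exp (-η) ^ n := by
        refine Finset.sum_le_sum fun n _ => ?_
        calc _ ≤ ∑ x ∈ s.filter (fun x => ⌊|z x + t|⌋₊ = n), Real.exp (-η) ^ n := by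
              refine Finset.sum_le_sum fun x hx => ?_
              rw [← Real.exp_nat_mul]
              apply Real.exp_le_exp.mpr
              have := Nat.floor_le (abs_nonneg (z x + t))
              rw [(Finset.mem_filter.mp hx).2] at this
              nlinarith
          _ ≤ _ := by
              rw [Finset.sum_const, nsmul_eq_mul]
              gcongr
              exact_mod_cast hfib n
    _ = 4 * m * ∑ n ∈ Finset.range T, Real.exp (-η) ^ n := by rw [Finset.mul_sum]
    _ ≤ 4 * m * (1 / (1 - Real.exp (-η))) := by
        gcongr
        rw [geom_sum_eq hr1.ne, ← neg_div_neg_eq]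
        have hT0 := pow_nonneg hr0 T
        gcongr
        · linarith
        · linarith
    _ ≤ _ := by
        gcongr
        exact one_div_one_sub_exp_neg_le hη

theorem sum_exp_neg_abs_int_le (s : Finset ℤ) {α : ℝ} (hα : 0 < α) (t : ℝ) :
    ∑ i ∈ s, Real.exp (-|α * i + t|) ≤ 4 * (1 + 1 / α) := by
  have h := sum_exp_neg_abs_le s (fun i : ℤ => (i : ℝ)) 1 hα (t / α) (fun k => by
    simp only [Int.floor_intCast]
    rw [Finset.filter_eq']
    split_ifs <;> simp)
  simp only [Nat.cast_one, mul_one] at h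
  refine le_trans (Finset.sum_le_sum fun i _ => le_of_eq ?_) h
  congr 2
  rw [← abs_of_pos hα, ← abs_mul, abs_of_pos hα]
  congr 1
  field_simp

/-! ### Symmetries of the collision sum -/

theorem sum_Ioo_neg (N : ℕ) (f : ℤ → ℝ) :
    ∑ i ∈ Finset.Ioo (-(N : ℤ)) N, f (-i) = ∑ i ∈ Finset.Ioo (-(N : ℤ)) N, f i := by
  refine Finset.sum_nbij' (fun i => -i) (fun i => -i) ?_ ?_ ?_ ?_ ?_ <;> intro i hi <;>
    simp at hi ⊢ <;> omega

theorem coll_comm (N₁ : ℕ) (G₁ : ℝ) (N₂ : ℕ) (G₂ : ℝ) :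
    coll N₁ G₁ N₂ G₂ = coll N₂ G₂ N₁ G₁ := by
  unfold coll
  rw [Finset.sum_comm]
  simp_rw [add_comm]

/-- The index range is symmetric, so `i ↦ -i` absorbs the sign. Gains may be negative, while the
bounds below need nonnegative amplitudes. -/
theorem coll_abs_left (N₁ : ℕ) (G₁ : ℝ) (N₂ : ℕ) (G₂ : ℝ) :
    coll N₁ |G₁| N₂ G₂ = coll N₁ G₁ N₂ G₂ := by
  rcases abs_choice G₁ with h | h
  · rw [h]
  · rw [h]
    unfold coll
    rw [← sum_Ioo_neg]
    refine Finset.sum_congr rfl fun i _ => Finset.sum_congr rfl fun j _ => ?_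
    congr 3
    push_cast
    ring

theorem coll_abs (N₁ : ℕ) (G₁ : ℝ) (N₂ : ℕ) (G₂ : ℝ) :
    coll N₁ |G₁| N₂ |G₂| = coll N₁ G₁ N₂ G₂ := by
  rw [coll_abs_left, coll_comm, coll_abs_left, coll_comm]

theorem Ioo_neg_one_one : Finset.Ioo (-((1 : ℕ) : ℤ)) ((1 : ℕ) : ℤ) = {0} := by
  decide

theorem card_Ioo_neg {N : ℕ} (hN : 1 ≤ N) :
    ((Finset.Ioo (-(N : ℤ)) N).card : ℝ) ≤ 2 * N := by
  rw [Int.card_Ioo]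
  have : ((N : ℤ) - -(N : ℤ) - 1).toNat ≤ 2 * N := by omega
  exact_mod_cast this

theorem coll_one_one (G₁ G₂ : ℝ) : coll 1 G₁ 1 G₂ = 1 := by
  unfold coll
  rw [Ioo_neg_one_one]
  simp

theorem le_div_sqrt_sq_sub_one {N : ℕ} (hN : 2 ≤ N) {G : ℝ} (hG : 0 ≤ G) :
    G / N ≤ G / Real.sqrt ((N : ℝ) ^ 2 - 1) := by
  have hN' : (2 : ℝ) ≤ N := by exact_mod_cast hN
  have : 0 < Real.sqrt ((N : ℝ) ^ 2 - 1) := Real.sqrt_pos.mpr (by nlinarith)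
  gcongr
  rw [Real.sqrt_le_left (by linarith)]
  linarith

/-- If the second constellation is well separated, it produces few collisions per point of the
first constellation. -/
theorem coll_le_mul {N₁ N₂ : ℕ} (h₁ : 1 ≤ N₁) (h₂ : 1 ≤ N₂) {G₁ G₂ : ℝ} (hG₂ : 0 ≤ G₂)
    (h : (N₂ : ℝ) ≤ 1 + G₂) : coll N₁ G₁ N₂ G₂ ≤ 24 * N₁ := by
  have hN1 : (1 : ℝ) ≤ N₁ := by exact_mod_cast h₁
  have key : ∀ i ∈ Finset.Ioo (-(N₁ : ℤ)) N₁, ∑ j ∈ Finset.Ioo (-(N₂ : ℤ)) N₂,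
      Real.exp (-|G₁ / Real.sqrt ((N₁ : ℝ) ^ 2 - 1) * i +
        G₂ / Real.sqrt ((N₂ : ℝ) ^ 2 - 1) * j|) ≤ 12 := by
    intro i _
    rcases h₂.lt_or_eq with h2 | h2
    · have hN2 : (2 : ℝ) ≤ N₂ := by exact_mod_cast h2
      have hβ : 1 / 2 ≤ G₂ / Real.sqrt ((N₂ : ℝ) ^ 2 - 1) := by
        refine le_trans ?_ (le_div_sqrt_sq_sub_one h2 hG₂)
        rw [div_le_div_iff₀ (by norm_num) (by linarith)]
        linarith
      have := sum_exp_neg_abs_int_le (Finset.Ioo (-(N₂ : ℤ)) N₂) (lt_of_lt_of_le (by norm_num) hβ)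
        (G₁ / Real.sqrt ((N₁ : ℝ) ^ 2 - 1) * i)
      simp_rw [add_comm (G₁ / Real.sqrt ((N₁ : ℝ) ^ 2 - 1) * i)]
      refine this.trans ?_
      have : 1 / (G₂ / Real.sqrt ((N₂ : ℝ) ^ 2 - 1)) ≤ 1 / (1 / 2) :=
        one_div_le_one_div_of_le (by norm_num) hβ
      linarith
    · subst h2
      rw [Ioo_neg_one_one, Finset.sum_singleton]
      refine le_trans (Real.exp_le_one_iff.mpr (neg_nonpos.mpr (abs_nonneg _))) (by norm_num)
  unfold coll
  refine (Finset.sum_le_sum key).trans ?_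
  rw [Finset.sum_const, nsmul_eq_mul]
  have := card_Ioo_neg h₁
  nlinarith

theorem coll_one_right_le {N : ℕ} (hN : 1 ≤ N) {G G' : ℝ} (hG : 0 ≤ G) (h : (N : ℝ) ≤ 1 + G) :
    coll N G 1 G' ≤ 24 := by
  rw [coll_comm]
  simpa using coll_le_mul le_rfl hN hG h

/-- If the amplitude of the second constellation is much larger than that of the first one, and both
are well separated, then there are few collisions. -/
theorem coll_le_of_layered {N₁ N₂ : ℕ} (h₁ : 1 ≤ N₁) (h₂ : 1 ≤ N₂) {G₁ G₂ : ℝ} (hG₁ : 0 ≤ G₁)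
    (h : (N₁ : ℝ) ≤ 1 + G₁) (h' : N₂ = 1 ∨ (N₂ : ℝ) * (1 + 4 * G₁) ≤ G₂) :
    coll N₁ G₁ N₂ G₂ ≤ 100 := by
  rcases h₂.eq_or_lt with h2 | h2
  · subst h2
    exact (coll_one_right_le h₁ hG₁ h).trans (by norm_num)
  have hN1 : (1 : ℝ) ≤ N₁ := by exact_mod_cast h₁
  have hN2 : (2 : ℝ) ≤ N₂ := by exact_mod_cast h2
  have h' : (N₂ : ℝ) * (1 + 4 * G₁) ≤ G₂ := by
    rcases h' with h' | h'
    · omega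
    · exact h'
  have hG₂ : 0 ≤ G₂ := le_trans (by positivity) h'
  set α := G₁ / Real.sqrt ((N₁ : ℝ) ^ 2 - 1) with hα
  set β := G₂ / Real.sqrt ((N₂ : ℝ) ^ 2 - 1) with hβd
  have hα0 : 0 ≤ α := by positivity
  have hβ : 1 + 4 * G₁ ≤ β := by
    refine le_trans ?_ (le_div_sqrt_sq_sub_one h2 hG₂)
    rw [le_div_iff₀ (by linarith)]
    linarith
  have hspan : ∀ i ∈ Finset.Ioo (-(N₁ : ℤ)) N₁, |α * i| ≤ 2 * G₁ := by
    intro i hi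
    rcases h₁.lt_or_eq with h1 | h1
    · have hN1' : (2 : ℝ) ≤ N₁ := by exact_mod_cast h1
      rw [abs_mul, abs_of_nonneg hα0]
      have hi' : |(i : ℝ)| ≤ N₁ := by
        rw [Finset.mem_Ioo] at hi
        rw [abs_le]
        constructor
        · exact_mod_cast hi.1.le
        · exact_mod_cast hi.2.le
      have hs : (N₁ : ℝ) / 2 ≤ Real.sqrt ((N₁ : ℝ) ^ 2 - 1) := by
        apply Real.le_sqrt_of_sq_le
        nlinarith
      have : α ≤ G₁ / ((N₁ : ℝ) / 2) := by rw [hα]; gcongr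
      calc α * |(i : ℝ)| ≤ G₁ / ((N₁ : ℝ) / 2) * N₁ := by gcongr
        _ = 2 * G₁ := by field_simp
    · rw [← h1, Ioo_neg_one_one, Finset.mem_singleton] at hi
      subst hi
      simpa using hG₁
  -- For `j ≠ 0` the distance is at least `(1 + 4 G₁) |j| - 2 G₁ ≥ G₁ + |j| / 4`. The resulting
  -- factor `exp (-G₁)` pays for the `O(1 + G₁)` values of `i`.
  have hpt : ∀ i ∈ Finset.Ioo (-(N₁ : ℤ)) N₁, ∀ j ∈ Finset.Ioo (-(N₂ : ℤ)) N₂,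
      Real.exp (-|α * i + β * j|) ≤ (if j = 0 then Real.exp (-|α * i|) else 0) +
        Real.exp (-(2 * G₁ / 2)) * Real.exp (-|1 / 4 * (j : ℝ) + 0|) := by
    intro i hi j hj
    split_ifs with hj0
    · subst hj0
      simp
      positivity
    · rw [zero_add, ← Real.exp_add]
      apply Real.exp_le_exp.mpr
      have hj1 : (1 : ℝ) ≤ |(j : ℝ)| := by
        exact_mod_cast Int.one_le_abs hj0
      have a1 : |β * j| - |α * i| ≤ |α * i + β * j| := by
        have := abs_sub_abs_le_abs_sub (β * j) (-(α * i))
        rw [abs_neg, sub_neg_eq_add, add_comm (β * (j : ℝ))] at this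
        exact this
      have a2 := hspan i hi
      have a3 : |β * (j : ℝ)| = β * |(j : ℝ)| := by
        rw [abs_mul, abs_of_nonneg (by linarith)]
      rw [add_zero, abs_mul, abs_of_pos (show (0 : ℝ) < 1 / 4 by norm_num)]
      nlinarith
  unfold coll
  have hj0 : (0 : ℤ) ∈ Finset.Ioo (-(N₂ : ℤ)) N₂ := by simp; omega
  calc _ ≤ ∑ i ∈ Finset.Ioo (-(N₁ : ℤ)) N₁, ∑ j ∈ Finset.Ioo (-(N₂ : ℤ)) N₂,
        ((if j = 0 then Real.exp (-|α * i|) else 0) +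
        Real.exp (-(2 * G₁ / 2)) * Real.exp (-|1 / 4 * (j : ℝ) + 0|)) :=
        Finset.sum_le_sum fun i hi => Finset.sum_le_sum fun j hj => hpt i hi j hj
    _ = ∑ i ∈ Finset.Ioo (-(N₁ : ℤ)) N₁, (Real.exp (-|α * i|) + Real.exp (-(2 * G₁ / 2)) *
        ∑ j ∈ Finset.Ioo (-(N₂ : ℤ)) N₂, Real.exp (-|1 / 4 * (j : ℝ) + 0|)) := by
        refine Finset.sum_congr rfl fun i _ => ?_
        rw [Finset.sum_add_distrib, Finset.sum_ite_eq' , if_pos hj0, Finset.mul_sum]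
    _ ≤ ∑ i ∈ Finset.Ioo (-(N₁ : ℤ)) N₁, (Real.exp (-|α * i|) +
        Real.exp (-G₁) * 20) := by
        refine Finset.sum_le_sum fun i _ => ?_
        have := sum_exp_neg_abs_int_le (Finset.Ioo (-(N₂ : ℤ)) N₂)
          (show (0 : ℝ) < 1 / 4 by norm_num) 0
        rw [mul_div_cancel_left₀ _ (two_ne_zero)]
        gcongr
        refine this.trans (by norm_num)
    _ = coll N₁ G₁ 1 0 + ((Finset.Ioo (-(N₁ : ℤ)) N₁).card : ℝ) * (Real.exp (-G₁) * 20) := by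
        rw [Finset.sum_add_distrib, Finset.sum_const, nsmul_eq_mul]
        congr 1
        unfold coll
        rw [Ioo_neg_one_one]
        simp [hα]
    _ ≤ 24 + 2 * N₁ * (Real.exp (-G₁) * 20) := by
        gcongr
        · exact coll_one_right_le h₁ hG₁ h
        · exact card_Ioo_neg h₁
    _ ≤ 24 + 40 := by
        have e1 : N₁ * Real.exp (-G₁) ≤ 1 := by
          calc N₁ * Real.exp (-G₁) ≤ Real.exp G₁ * Real.exp (-G₁) := by
                gcongr
                linarith [Real.add_one_le_exp G₁]
            _ = 1 := by rw [← Real.exp_add]; simp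
        nlinarith
    _ ≤ 100 := by norm_num

/-! ### Averaging over prime constellation sizes -/

/-- There are many primes in `[M / (22 Λ), M]` if `log M ≤ Λ`. -/
theorem exists_finset_primes {M : ℕ} (hM : 2 ≤ M) {Λ : ℝ} (hΛ : Real.log M ≤ Λ) :
    ∃ P : Finset ℕ, (∀ p ∈ P, p.Prime ∧ p ≤ M ∧ (M : ℝ) ≤ 22 * Λ * p) ∧
      (M : ℝ) ≤ 22 * Λ * P.card := by
  have hM' : (2 : ℝ) ≤ M := by exact_mod_cast hM
  have hl0 : 0 < Real.log M := Real.log_pos (by linarith)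
  have hΛ0 : 0 < Λ := hl0.trans_le hΛ
  have h1 := Chebyshev.pi_ge M
  rw [div_le_iff₀ hl0] at h1
  have h2 : Real.log (M + 1) ≤ Real.log 2 + ((M - 1) / 2 : ℝ) := by
    have : ((M : ℝ) + 1) = 2 * ((M + 1) / 2) := by ring
    rw [this, Real.log_mul (by norm_num) (by positivity)]
    have := Real.log_le_sub_one_of_pos (show (0 : ℝ) < (M + 1) / 2 by positivity)
    linarith
  have h3 : (M : ℝ) / 11 ≤ Nat.primeCounting M * Λ := by
    have h4 := Real.log_two_gt_d9
    -- The right side is at least `(M - 1) (log 2 - 1 / 2)`, and `M - 1 ≥ M / 2`.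
    have h5 : (M : ℝ) / 11 ≤ M * Real.log 2 - Real.log (M + 1) := by nlinarith
    calc (M : ℝ) / 11 ≤ Nat.primeCounting M * Real.log M := h5.trans h1
      _ ≤ _ := by gcongr
  -- Half of the lower bound `M / (11 Λ)` for the prime count: at most `x` primes lie below `x`, so
  -- at least `x` survive.
  set x : ℝ := M / (22 * Λ) with hx
  have hx0 : 0 ≤ x := by positivity
  set P := (Nat.primesLE M).filter (fun p : ℕ => x ≤ (p : ℝ)) with hP
  set Q := (Nat.primesLE M).filter (fun p : ℕ => ¬ x ≤ (p : ℝ)) with hQ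
  have hcard : P.card + Q.card = Nat.primeCounting M := by
    rw [← Nat.primesLE_card_eq_primeCounting]
    exact Finset.card_filter_add_card_filter_not _
  have hQx : (Q.card : ℝ) ≤ x := by
    have hsub : Q ⊆ Finset.Ioc 0 ⌊x⌋₊ := by
      intro p hp
      rw [hQ, Finset.mem_filter] at hp
      rw [Finset.mem_Ioc]
      exact ⟨(Nat.prime_of_mem_primesLE hp.1).pos, Nat.le_floor (not_le.mp hp.2).le⟩
    have := Finset.card_le_card hsub
    rw [Nat.card_Ioc] at this
    calc (Q.card : ℝ) ≤ ⌊x⌋₊ := by exact_mod_cast (by omega : Q.card ≤ ⌊x⌋₊)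
      _ ≤ x := Nat.floor_le hx0
  refine ⟨P, ?_, ?_⟩
  · intro p hp
    rw [hP, Finset.mem_filter] at hp
    refine ⟨Nat.prime_of_mem_primesLE hp.1, (Nat.mem_primesLE.mp hp.1).1, ?_⟩
    have := hp.2
    rw [hx, div_le_iff₀ (by positivity)] at this
    linarith
  · have : (P.card : ℝ) + Q.card = Nat.primeCounting M := by exact_mod_cast hcard
    have hxx : x * (22 * Λ) = M := by rw [hx]; field_simp
    nlinarith

/-- Distinct fractions `j / p` with prime denominators at most `M` are `1 / M ^ 2` separated. -/
theorem one_le_abs_sub_of_ne {M p p' j j' : ℕ} (hp : p.Prime) (hp' : p'.Prime) (hpM : p ≤ M)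
    (hpM' : p' ≤ M) (hj : 0 < j) (hjp : j < p) (hjp' : j' < p')
    (hne : (p, j) ≠ (p', j')) :
    (1 : ℝ) ≤ |(M : ℝ) ^ 2 * (j / p) - (M : ℝ) ^ 2 * (j' / p')| := by
  have hp0 : (0 : ℝ) < p := by exact_mod_cast hp.pos
  have hp0' : (0 : ℝ) < p' := by exact_mod_cast hp'.pos
  have hint : ((j : ℤ) * p' - j' * p) ≠ 0 := by
    intro h
    have h1 : j * p' = j' * p := by
      have : (j : ℤ) * p' = j' * p := by linarith
      exact_mod_cast this
    have h2 : p ∣ j * p' := ⟨j', by rw [h1, mul_comm]⟩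
    -- Primality enters here: `p` cannot divide the smaller positive `j`, so equal fractions have
    -- equal denominators.
    rcases hp.dvd_mul.mp h2 with h3 | h3
    · exact absurd (Nat.le_of_dvd hj h3) (by omega)
    · have h4 : p = p' := (Nat.prime_dvd_prime_iff_eq hp hp').mp h3
      subst h4
      have h5 : j = j' := Nat.eq_of_mul_eq_mul_right hp.pos h1
      exact hne (by rw [h5])
  have h1 : (1 : ℝ) ≤ |(j : ℝ) * p' - j' * p| := by
    exact_mod_cast Int.one_le_abs hint
  have h2 : (M : ℝ) ^ 2 * (j / p) - (M : ℝ) ^ 2 * (j' / p') =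
      (M : ℝ) ^ 2 / (p * p') * ((j : ℝ) * p' - j' * p) := by
    field_simp
  have h3 : (1 : ℝ) ≤ (M : ℝ) ^ 2 / (p * p') := by
    rw [le_div_iff₀ (by positivity), one_mul, sq]
    have a1 : (p : ℝ) ≤ M := by exact_mod_cast hpM
    have a2 : (p' : ℝ) ≤ M := by exact_mod_cast hpM'
    gcongr
  rw [h2, abs_mul, abs_of_nonneg (by linarith)]
  nlinarith

/-- Unit power makes the spacing proportional to `1 / √(p² - 1)` and not `1 / p`. The resulting
shift is small enough to carry the separation of fractions over to the actual points. -/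
theorem div_sqrt_sub_bounds {p j : ℕ} (hp : 2 ≤ p) (hjp : j < p) :
    (j : ℝ) / p ≤ j / Real.sqrt ((p : ℝ) ^ 2 - 1) ∧
      (j : ℝ) / Real.sqrt ((p : ℝ) ^ 2 - 1) ≤ j / p + 1 / (p : ℝ) ^ 2 := by
  have hp' : (2 : ℝ) ≤ p := by exact_mod_cast hp
  have hj : (j : ℝ) ≤ p := by exact_mod_cast hjp.le
  refine ⟨le_div_sqrt_sq_sub_one hp (by positivity), ?_⟩
  set r := Real.sqrt ((p : ℝ) ^ 2 - 1) with hr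
  have hr0 : 0 < r := Real.sqrt_pos.mpr (by nlinarith)
  have hr2 : r ^ 2 = (p : ℝ) ^ 2 - 1 := Real.sq_sqrt (by nlinarith)
  have h1 : (p : ℝ) ^ 3 ≤ r * ((p : ℝ) ^ 2 + 1) := by
    apply le_of_sq_le_sq _ (by positivity)
    rw [mul_pow, hr2]
    nlinarith [pow_pos (show (0 : ℝ) < p by linarith) 2, pow_pos (show (0 : ℝ) < p by linarith) 4]
  have h2 : (1 : ℝ) / r ≤ 1 / p + 1 / p ^ 3 := by
    rw [div_add_div _ _ (by positivity) (by positivity), div_le_div_iff₀ hr0 (by positivity)]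
    nlinarith [pow_pos (show (0 : ℝ) < p by linarith) 2]
  calc (j : ℝ) / r = j * (1 / r) := by ring
    _ ≤ j * (1 / p + 1 / p ^ 3) := by gcongr
    _ = j / p + j * (1 / p ^ 3) := by ring
    _ ≤ j / p + p * (1 / p ^ 3) := by gcongr
    _ = _ := by field_simp

/-- Exponential sums over the points `j / √(p² - 1)` with `p` prime. -/
theorem sum_primes_exp_le {M : ℕ} (hM : 2 ≤ M) {L : ℝ} (hL : 1 ≤ L) {P : Finset ℕ}
    (hP : ∀ p ∈ P, p.Prime ∧ p ≤ M ∧ (M : ℝ) ≤ L * p) {G : ℝ} (hG : 0 < G) (t : ℝ) :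
    ∑ p ∈ P, ∑ j ∈ Finset.Ico 1 p,
      Real.exp (-|G / Real.sqrt ((p : ℝ) ^ 2 - 1) * j + t|) ≤
      16 * L ^ 2 * (1 + (M : ℝ) ^ 2 / G) := by
  have hM' : (2 : ℝ) ≤ M := by exact_mod_cast hM
  set m := ⌈L ^ 2⌉₊ + 2 with hm
  have hmL : (m : ℝ) ≤ 4 * L ^ 2 := by
    have := Nat.ceil_lt_add_one (show 0 ≤ L ^ 2 by positivity)
    rw [hm]
    push_cast
    nlinarith
  set η : ℝ := G / M ^ 2 with hη
  have hη0 : 0 < η := by positivity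
  set S := P.sigma (fun p => Finset.Ico 1 p) with hS
  set z : (Σ _ : ℕ, ℕ) → ℝ := fun x => (M : ℝ) ^ 2 * (x.2 / Real.sqrt ((x.1 : ℝ) ^ 2 - 1)) with hz
  have hcard : ∀ k : ℤ, (S.filter fun x => ⌊z x⌋ = k).card ≤ m := by
    intro k
    -- The scaled fractions `M² j / p` are 1-separated, so `y` is injective. Each lies at most `M² /
    -- p² ≤ L²` below `z x`, so a cell of `z` leaves `⌈L²⌉ + 2 = m` values for `y`.
    set y : (Σ _ : ℕ, ℕ) → ℤ := fun x => ⌊(M : ℝ) ^ 2 * (x.2 / x.1 : ℝ)⌋ with hy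
    have hmaps : ∀ x ∈ S.filter (fun x => ⌊z x⌋ = k), y x ∈ Finset.Icc (k - ⌈L ^ 2⌉₊ - 1) k := by
      intro x hx
      simp only [hS, Finset.mem_filter, Finset.mem_sigma, Finset.mem_Ico] at hx
      obtain ⟨⟨hxP, hx1, hx2⟩, hxk⟩ := hx
      obtain ⟨hp, hpM, hLp⟩ := hP _ hxP
      obtain ⟨b1, b2⟩ := div_sqrt_sub_bounds hp.two_le hx2
      have hp0 : (0 : ℝ) < x.1 := by exact_mod_cast hp.pos
      have c1 : (M : ℝ) ^ 2 * (x.2 / x.1 : ℝ) ≤ z x := by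
        simp only [hz]
        gcongr
      have c2 : z x - (⌈L ^ 2⌉₊ : ℝ) ≤ (M : ℝ) ^ 2 * (x.2 / x.1 : ℝ) := by
        have d1 : (M : ℝ) ^ 2 * (1 / (x.1 : ℝ) ^ 2) ≤ L ^ 2 := by
          rw [mul_one_div, div_le_iff₀ (by positivity), ← mul_pow]
          gcongr
        have d2 : z x ≤ (M : ℝ) ^ 2 * (x.2 / x.1 + 1 / (x.1 : ℝ) ^ 2) := by
          simp only [hz]
          gcongr
        have d3 := Nat.le_ceil (L ^ 2)
        rw [mul_add] at d2
        linarith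
      rw [Finset.mem_Icc]
      constructor
      · have := Int.floor_le_floor c2
        rw [Int.floor_sub_natCast, hxk] at this
        simp only [hy]
        linarith
      · have := Int.floor_le_floor c1
        rw [hxk] at this
        exact this
    have hinj : Set.InjOn y (S.filter (fun x => ⌊z x⌋ = k)) := by
      intro x hx x' hx' hxx
      simp only [hS, Finset.coe_filter, Set.mem_ofPred_eq, Finset.mem_sigma, Finset.mem_Ico]
        at hx hx'
      by_contra hne
      obtain ⟨hp, hpM, -⟩ := hP _ hx.1.1
      obtain ⟨hp', hpM', -⟩ := hP _ hx'.1.1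
      have h1 := one_le_abs_sub_of_ne hp hp' hpM hpM' (by omega) hx.1.2.2 hx'.1.2.2
        (fun h => hne (by
          rw [Prod.mk.injEq] at h
          exact Sigma.ext h.1 (heq_of_eq h.2)))
      have h2 := Int.abs_sub_lt_one_of_floor_eq_floor hxx
      linarith
    have := Finset.card_le_card_of_injOn y hmaps hinj
    rw [Int.card_Icc] at this
    omega
  have hmain := sum_exp_neg_abs_le S z m hη0 (t / η) hcard
  rw [hS, Finset.sum_sigma] at hmain
  calc _ = ∑ p ∈ P, ∑ j ∈ Finset.Ico 1 p, Real.exp (-(η * |z ⟨p, j⟩ + t / η|)) := by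
        refine Finset.sum_congr rfl fun p _ => Finset.sum_congr rfl fun j _ => ?_
        congr 2
        rw [← abs_of_pos hη0, ← abs_mul, abs_of_pos hη0]
        congr 1
        rw [mul_add, mul_div_cancel₀ _ hη0.ne']
        congr 1
        simp only [hz, hη]
        field_simp
    _ ≤ _ := hmain
    _ ≤ 4 * (4 * L ^ 2) * (1 + 1 / η) := by gcongr
    _ = _ := by
        rw [hη]
        field_simp
        ring

theorem sum_Ioo_neg_eq {p : ℕ} (hp : 1 ≤ p) (f : ℤ → ℝ) :
    ∑ j ∈ Finset.Ioo (-(p : ℤ)) p, f j = f 0 + ∑ j ∈ Finset.Ico 1 p, (f j + f (-j)) := by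
  induction p, hp using Nat.le_induction with
  | base => rw [Ioo_neg_one_one]; simp
  | succ p hp ih =>
    have h : Finset.Ioo (-((p + 1 : ℕ) : ℤ)) ((p + 1 : ℕ) : ℤ) =
        insert (p : ℤ) (insert (-(p : ℤ)) (Finset.Ioo (-(p : ℤ)) p)) := by
      ext j
      simp only [Finset.mem_Ioo, Finset.mem_insert]
      push_cast
      omega
    rw [h, Finset.sum_insert, Finset.sum_insert, ih, Finset.sum_Ico_succ_top hp]
    · ring
    · simp
    · simp only [Finset.mem_Ioo, Finset.mem_insert]
      omega

/-! ### Mean of the collision sum over prime sizes. -/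

/-- A weight which is `1` on `|x| ≤ 2 G` and decays exponentially outside. -/
def tailWeight (G x : ℝ) : ℝ := if |x| ≤ 2 * G then 1 else Real.exp (-(|x| / 4))

theorem tailWeight_nonneg (G x : ℝ) : 0 ≤ tailWeight G x := by
  unfold tailWeight
  split_ifs
  · norm_num
  · exact (Real.exp_pos _).le

theorem tailWeight_le_one (G x : ℝ) : tailWeight G x ≤ 1 := by
  unfold tailWeight
  split_ifs
  · norm_num
  · rw [Real.exp_le_one_iff]
    have := abs_nonneg x
    linarith

/-- For `|x| > 2 G` one has `|x + y| ≥ |x| / 2`. Half of the exponent then gives the decay in `x`;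
the other half is kept for the sum over `y`. -/
theorem exp_neg_abs_add_le {G x y : ℝ} (hy : |y| ≤ G) :
    Real.exp (-|x + y|) ≤ tailWeight G x * Real.exp (-|1 / 2 * y + 1 / 2 * x|) := by
  have e : |1 / 2 * y + 1 / 2 * x| = |x + y| / 2 := by
    rw [← mul_add, abs_mul, abs_of_pos (by norm_num : (0 : ℝ) < 1 / 2), add_comm y]
    ring
  rw [e]
  have h0 := abs_nonneg (x + y)
  unfold tailWeight
  split_ifs with h
  · rw [one_mul]
    apply Real.exp_le_exp.mpr
    linarith
  · rw [← Real.exp_add]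
    apply Real.exp_le_exp.mpr
    have := abs_sub_abs_le_abs_sub x (-y)
    rw [abs_neg, sub_neg_eq_add] at this
    linarith

theorem sum_tailWeight_le_card {N : ℕ} (hN : 1 ≤ N) (G α : ℝ) :
    ∑ i ∈ Finset.Ioo (-(N : ℤ)) N, tailWeight G (α * i) ≤ 2 * N := by
  refine (Finset.sum_le_sum fun i _ => tailWeight_le_one _ _).trans ?_
  rw [Finset.sum_const, nsmul_eq_mul, mul_one]
  exact card_Ioo_neg hN

theorem sum_tailWeight_le (N : ℕ) {G α : ℝ} (hG : 0 ≤ G) (hα : 0 < α) :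
    ∑ i ∈ Finset.Ioo (-(N : ℤ)) N, tailWeight G (α * i) ≤ 5 + (4 * G + 16) / α := by
  have hpt : ∀ i : ℤ, tailWeight G (α * i) ≤
      (if |(i : ℝ)| ≤ 2 * G / α then 1 else 0) + Real.exp (-|α / 4 * i + 0|) := by
    intro i
    have e : |α / 4 * i + 0| = |α * i| / 4 := by
      rw [add_zero, abs_mul, abs_mul, abs_of_pos hα, abs_of_pos (by positivity : 0 < α / 4)]
      ring
    rw [e]
    have e2 : |(i : ℝ)| ≤ 2 * G / α ↔ |α * i| ≤ 2 * G := by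
      rw [le_div_iff₀ hα, abs_mul, abs_of_pos hα, mul_comm]
    unfold tailWeight
    simp only [e2]
    have := Real.exp_pos (-(|α * i| / 4))
    split_ifs <;> linarith
  refine (Finset.sum_le_sum fun i _ => hpt i).trans ?_
  rw [Finset.sum_add_distrib]
  have h1 := sum_exp_neg_abs_int_le (Finset.Ioo (-(N : ℤ)) N) (by positivity : 0 < α / 4) 0
  have h2 : ∑ i ∈ Finset.Ioo (-(N : ℤ)) N, (if |(i : ℝ)| ≤ 2 * G / α then (1 : ℝ) else 0) ≤
      1 + 2 * (2 * G / α) := by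
    rw [Finset.sum_ite, Finset.sum_const_zero, add_zero, Finset.sum_const, nsmul_eq_mul, mul_one]
    set n := ⌊2 * G / α⌋₊ with hn
    have hsub : (Finset.Ioo (-(N : ℤ)) N).filter (fun i : ℤ => |(i : ℝ)| ≤ 2 * G / α) ⊆
        Finset.Icc (-(n : ℤ)) n := by
      intro i hi
      have hi := (Finset.mem_filter.mp hi).2
      have h3 : i.natAbs ≤ n := by
        apply Nat.le_floor
        rwa [Nat.cast_natAbs, Int.cast_abs]
      rw [Finset.mem_Icc]
      omega
    have hc := Finset.card_le_card hsub
    rw [Int.card_Icc] at hc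
    have hc' : ((Finset.Ioo (-(N : ℤ)) N).filter
        (fun i : ℤ => |(i : ℝ)| ≤ 2 * G / α)).card ≤ 2 * n + 1 := by omega
    have hn' : (n : ℝ) ≤ 2 * G / α := Nat.floor_le (by positivity)
    calc _ ≤ ((2 * n + 1 : ℕ) : ℝ) := by exact_mod_cast hc'
      _ ≤ _ := by push_cast; linarith
  calc _ ≤ 1 + 2 * (2 * G / α) + 4 * (1 + 1 / (α / 4)) := add_le_add h2 h1
    _ = _ := by field_simp; ring

/-- If `G'` is the larger amplitude, all `2 N` shifts may count, but `N M ≲ G'` makes `M² N / G'` of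
order `M`. If `G` is larger, only `O(1 + G' N / G)` shifts overlap the second constellation, and `M²
N / G` is again of order `M`. -/
theorem mul_sum_tailWeight_le {N M : ℕ} (hN : 1 ≤ N) (hNM : N ≤ M) (hM : 2 ≤ M) {G G' : ℝ}
    (hG : 0 ≤ G) (h1 : (N : ℝ) ≤ 1 + G) (h2 : (M : ℝ) ≤ 1 + G')
    (h3 : (N : ℝ) * M ≤ 1 + max G G') :
    (1 + 2 * (M : ℝ) ^ 2 / G') * ∑ i ∈ Finset.Ioo (-(N : ℤ)) N,
      tailWeight G' (G / Real.sqrt ((N : ℝ) ^ 2 - 1) * i) ≤ 115 * M := by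
  have hN' : (1 : ℝ) ≤ N := by exact_mod_cast hN
  have hM' : (2 : ℝ) ≤ M := by exact_mod_cast hM
  have hNM' : (N : ℝ) ≤ M := by exact_mod_cast hNM
  have hG' : (M : ℝ) / 2 ≤ G' := by linarith
  have hG'0 : 0 < G' := by linarith
  have hNMmax : (N : ℝ) * M / 2 ≤ max G G' := by nlinarith
  rcases le_total G G' with hGG | hGG
  · rw [max_eq_right hGG] at hNMmax
    have hq : 2 * (M : ℝ) ^ 2 / G' * (2 * N) ≤ 8 * M := by
      rw [div_mul_eq_mul_div, div_le_iff₀ hG'0]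
      nlinarith
    calc _ ≤ (1 + 2 * (M : ℝ) ^ 2 / G') * (2 * N) := by
          gcongr
          exact sum_tailWeight_le_card hN _ _
      _ = 2 * N + 2 * (M : ℝ) ^ 2 / G' * (2 * N) := by ring
      _ ≤ _ := by linarith
  · rcases hN.eq_or_lt with hN1 | hN1
    · subst hN1
      have hq : 2 * (M : ℝ) ^ 2 / G' ≤ 4 * M := by
        rw [div_le_iff₀ hG'0]
        nlinarith
      calc _ ≤ (1 + 2 * (M : ℝ) ^ 2 / G') * (2 * (1 : ℕ)) := by
            gcongr
            exact sum_tailWeight_le_card le_rfl _ _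
        _ ≤ _ := by push_cast; linarith
    rw [max_eq_left hGG] at hNMmax
    have hN2 : (2 : ℝ) ≤ N := by exact_mod_cast hN1
    have hG0 : 0 < G := by linarith
    set α := G / Real.sqrt ((N : ℝ) ^ 2 - 1) with hα
    have hαN : G / N ≤ α := le_div_sqrt_sq_sub_one hN1 hG
    have hα1 : 1 ≤ α := by
      refine le_trans ?_ hαN
      rw [le_div_iff₀ (by linarith)]
      nlinarith
    have hα0 : 0 < α := by linarith
    have hs := sum_tailWeight_le N hG'0.le hα0
    have e1 : (4 * G' + 16) / α ≤ 4 * (G' * N / G) + 16 := by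
      rw [add_div]
      have a1 : 4 * G' / α ≤ 4 * G' / (G / N) := by gcongr
      have a2 : 16 / α ≤ 16 / 1 := by gcongr
      have a3 : 4 * G' / (G / N) = 4 * (G' * N / G) := by field_simp
      linarith
    have e2 : (M : ℝ) ^ 2 / G' ≤ 2 * M := by
      rw [div_le_iff₀ hG'0]
      nlinarith
    have e3 : G' * N / G ≤ N := by
      rw [div_le_iff₀ hG0]
      nlinarith
    have e4 : (M : ℝ) ^ 2 / G' * (G' * N / G) ≤ 2 * M := by
      have : (M : ℝ) ^ 2 / G' * (G' * N / G) = (M : ℝ) ^ 2 * N / G := by field_simp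
      rw [this, div_le_iff₀ hG0]
      nlinarith
    calc _ ≤ (1 + 2 * (M : ℝ) ^ 2 / G') * (21 + 4 * (G' * N / G)) := by
          gcongr
          linarith
      _ = 21 + 42 * ((M : ℝ) ^ 2 / G') + 4 * (G' * N / G) +
          8 * ((M : ℝ) ^ 2 / G' * (G' * N / G)) := by ring
      _ ≤ _ := by linarith

/-- The terms with `j = 0` cost 24 per prime. For the others the sum over primes is done first,
uniformly in the shift produced by `i`, and the tail weights then limit the number of relevant `i`.
Division by `P.card ≥ M / L` will give a mean of order `L ^ 3`. -/
theorem sum_primes_coll_le {N M : ℕ} (hN : 1 ≤ N) (hNM : N ≤ M) (hM : 2 ≤ M) {L : ℝ} (hL : 1 ≤ L)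
    {P : Finset ℕ} (hP : ∀ p ∈ P, p.Prime ∧ p ≤ M ∧ (M : ℝ) ≤ L * p) {G G' : ℝ}
    (hG : 0 ≤ G) (h1 : (N : ℝ) ≤ 1 + G) (h2 : (M : ℝ) ≤ 1 + G')
    (h3 : (N : ℝ) * M ≤ 1 + max G G') :
    ∑ p ∈ P, coll N G p G' ≤ 24 * P.card + 3680 * L ^ 2 * M := by
  have hM' : (2 : ℝ) ≤ M := by exact_mod_cast hM
  have hG'0 : 0 < G' := by linarith
  set α := G / Real.sqrt ((N : ℝ) ^ 2 - 1) with hα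
  have hpt : ∀ p ∈ P, coll N G p G' ≤ 24 + ∑ i ∈ Finset.Ioo (-(N : ℤ)) N, tailWeight G' (α * i) *
      (∑ j ∈ Finset.Ico 1 p, Real.exp (-|G' / 2 / Real.sqrt ((p : ℝ) ^ 2 - 1) * j + 1 / 2 * (α * i)|)
      + ∑ j ∈ Finset.Ico 1 p,
        Real.exp (-|G' / 2 / Real.sqrt ((p : ℝ) ^ 2 - 1) * j + -(1 / 2 * (α * i))|)) := by
    intro p hp
    have hpp := (hP p hp).1
    have hp2 : (2 : ℝ) ≤ p := by exact_mod_cast hpp.two_le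
    set β := G' / Real.sqrt ((p : ℝ) ^ 2 - 1) with hβ
    have hβ0 : 0 ≤ β := by positivity
    have hy : ∀ j ∈ Finset.Ico 1 p, |β * (j : ℝ)| ≤ G' := by
      intro j hj
      have hjp : (j : ℝ) + 1 ≤ p := by exact_mod_cast (Finset.mem_Ico.mp hj).2
      have hj0 : (0 : ℝ) ≤ j := by positivity
      rw [abs_of_nonneg (by positivity), hβ, div_mul_eq_mul_div]
      apply div_le_of_le_mul₀ (by positivity) hG'0.le
      gcongr
      apply Real.le_sqrt_of_sq_le
      nlinarith
    have e0 : coll N G p G' = coll N G 1 0 + ∑ i ∈ Finset.Ioo (-(N : ℤ)) N,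
        ∑ j ∈ Finset.Ico 1 p, (Real.exp (-|α * i + β * j|) + Real.exp (-|α * i + -(β * j)|)) := by
      unfold coll
      rw [Ioo_neg_one_one, ← Finset.sum_add_distrib]
      refine Finset.sum_congr rfl fun i _ => ?_
      rw [sum_Ioo_neg_eq hpp.one_le]
      simp [hα, hβ]
    rw [e0]
    refine add_le_add (coll_one_right_le hN hG h1) (Finset.sum_le_sum fun i _ => ?_)
    rw [Finset.sum_add_distrib, mul_add, Finset.mul_sum, Finset.mul_sum]
    refine add_le_add (Finset.sum_le_sum fun j hj => ?_) (Finset.sum_le_sum fun j hj => ?_)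
    · refine (exp_neg_abs_add_le (hy j hj)).trans (le_of_eq ?_)
      congr 4
      rw [hβ]
      ring
    · have hy' : |-(β * (j : ℝ))| ≤ G' := by rw [abs_neg]; exact hy j hj
      refine (exp_neg_abs_add_le hy').trans (le_of_eq ?_)
      congr 2
      rw [← abs_neg]
      congr 2
      rw [hβ]
      ring
  have hsum : ∀ t : ℝ, ∑ p ∈ P, ∑ j ∈ Finset.Ico 1 p,
      Real.exp (-|G' / 2 / Real.sqrt ((p : ℝ) ^ 2 - 1) * j + t|) ≤
      16 * L ^ 2 * (1 + 2 * (M : ℝ) ^ 2 / G') := by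
    intro t
    refine (sum_primes_exp_le hM hL hP (by positivity : 0 < G' / 2) t).trans (le_of_eq ?_)
    field_simp
  calc _ ≤ ∑ p ∈ P, (24 + ∑ i ∈ Finset.Ioo (-(N : ℤ)) N, tailWeight G' (α * i) *
      (∑ j ∈ Finset.Ico 1 p, Real.exp (-|G' / 2 / Real.sqrt ((p : ℝ) ^ 2 - 1) * j + 1 / 2 * (α * i)|)
      + ∑ j ∈ Finset.Ico 1 p,
        Real.exp (-|G' / 2 / Real.sqrt ((p : ℝ) ^ 2 - 1) * j + -(1 / 2 * (α * i))|))) :=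
        Finset.sum_le_sum hpt
    _ = 24 * P.card + ∑ i ∈ Finset.Ioo (-(N : ℤ)) N, tailWeight G' (α * i) *
      (∑ p ∈ P, ∑ j ∈ Finset.Ico 1 p,
        Real.exp (-|G' / 2 / Real.sqrt ((p : ℝ) ^ 2 - 1) * j + 1 / 2 * (α * i)|)
      + ∑ p ∈ P, ∑ j ∈ Finset.Ico 1 p,
        Real.exp (-|G' / 2 / Real.sqrt ((p : ℝ) ^ 2 - 1) * j + -(1 / 2 * (α * i))|)) := by
        rw [Finset.sum_add_distrib, Finset.sum_const, nsmul_eq_mul, mul_comm (24 : ℝ),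
          Finset.sum_comm]
        congr 1
        refine Finset.sum_congr rfl fun i _ => ?_
        rw [← Finset.mul_sum, Finset.sum_add_distrib]
    _ ≤ 24 * P.card + ∑ i ∈ Finset.Ioo (-(N : ℤ)) N, tailWeight G' (α * i) *
        (2 * (16 * L ^ 2 * (1 + 2 * (M : ℝ) ^ 2 / G'))) := by
        gcongr with i _
        · exact tailWeight_nonneg _ _
        · have := hsum (1 / 2 * (α * i))
          have := hsum (-(1 / 2 * (α * i)))
          linarith
    _ = 24 * P.card + 32 * L ^ 2 * ((1 + 2 * (M : ℝ) ^ 2 / G') *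
        ∑ i ∈ Finset.Ioo (-(N : ℤ)) N, tailWeight G' (α * i)) := by
        rw [← Finset.sum_mul]
        ring
    _ ≤ 24 * P.card + 32 * L ^ 2 * (115 * M) := by
        have := mul_sum_tailWeight_le hN hNM hM hG h1 h2 h3
        have h32 : 0 ≤ 32 * L ^ 2 := by positivity
        linarith [mul_le_mul_of_nonneg_left this h32]
    _ = _ := by ring

/-! ### Choice of the constellation sizes. -/

/-- The amplitudes `G`, `G'` leave room for constellations of sizes about `A`, `B`. -/
def Fits (A B G G' : ℝ) : Prop :=
  0 ≤ G ∧ 0 ≤ G' ∧ A ≤ 1 + G ∧ B ≤ 1 + G' ∧ A * B ≤ 1 + max G G'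

theorem Fits.symm {A B G G' : ℝ} (h : Fits A B G G') : Fits B A G' G :=
  ⟨h.2.1, h.1, h.2.2.2.1, h.2.2.1, by rw [mul_comm, max_comm]; exact h.2.2.2.2⟩

/-- The smaller size is `⌊A⌋`. Unless `⌊B⌋ = 1`, the larger is a prime at which the total of the two
collision sums does not exceed its mean, so the same prime suits both receivers. -/
theorem exists_sizes_of_le {A B Λ : ℝ} (hA : 1 ≤ A) (hAB : A ≤ B) (hΛ : 1 ≤ Λ)
    (hB : Real.log B ≤ Λ) {G G' H H' : ℝ} (h : Fits A B G G') (h' : Fits A B H H') :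
    ∃ N₁ N₂ : ℕ, 1 ≤ N₁ ∧ 1 ≤ N₂ ∧ (N₁ : ℝ) ≤ A ∧ (N₂ : ℝ) ≤ B ∧ A ≤ 44 * Λ * N₁ ∧
      B ≤ 44 * Λ * N₂ ∧ coll N₁ G N₂ G' ≤ 10 ^ 8 * Λ ^ 3 ∧ coll N₁ H N₂ H' ≤ 10 ^ 8 * Λ ^ 3 := by
  have hB1 : 1 ≤ B := hA.trans hAB
  have hfl : ∀ x : ℝ, 1 ≤ x → 1 ≤ ⌊x⌋₊ ∧ x ≤ 2 * ⌊x⌋₊ ∧ (⌊x⌋₊ : ℝ) ≤ x := by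
    intro x hx
    have h1 : 1 ≤ ⌊x⌋₊ := Nat.one_le_floor_iff x |>.mpr hx
    have h2 := Nat.lt_floor_add_one x
    have h3 : (1 : ℝ) ≤ ⌊x⌋₊ := by exact_mod_cast h1
    exact ⟨h1, by linarith, Nat.floor_le (by linarith)⟩
  obtain ⟨n1, n2, n3⟩ := hfl A hA
  obtain ⟨m1, m2, m3⟩ := hfl B hB1
  set N := ⌊A⌋₊ with hN
  set M := ⌊B⌋₊ with hM
  have hNM : N ≤ M := Nat.floor_le_floor hAB
  have hN0 : (1 : ℝ) ≤ N := by exact_mod_cast n1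
  have hM0 : (1 : ℝ) ≤ M := by exact_mod_cast m1
  have hΛ3 : 1 ≤ Λ ^ 3 := one_le_pow₀ hΛ
  rcases m1.eq_or_lt with hM1 | hM1
  · refine ⟨1, 1, le_rfl, le_rfl, by simpa using hA, by simpa using hB1, ?_, ?_, ?_, ?_⟩
    · rw [← hM1] at m2
      push_cast at m2 ⊢
      linarith
    · rw [← hM1] at m2
      push_cast at m2 ⊢
      linarith
    · rw [coll_one_one]; linarith
    · rw [coll_one_one]; linarith
  have hlogM : Real.log M ≤ Λ := (Real.log_le_log (by linarith) m3).trans hB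
  obtain ⟨P, hP, hPc⟩ := exists_finset_primes hM1 hlogM
  have hPpos : 0 < P.card := by
    rcases Nat.eq_zero_or_pos P.card with h0 | h0
    · rw [h0] at hPc
      push_cast at hPc
      linarith
    · exact h0
  have hPpos' : (0 : ℝ) < P.card := by exact_mod_cast hPpos
  have hL : 1 ≤ 22 * Λ := by linarith
  have bound : ∀ X Y : ℝ, Fits A B X Y → ∑ p ∈ P, coll N X p Y ≤ 24 * P.card + 3680 * (22 * Λ) ^ 2 * M := by
    intro X Y hXY
    obtain ⟨x1, x2, x3, x4, x5⟩ := hXY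
    refine sum_primes_coll_le n1 hNM hM1 hL hP x1 (by linarith) (by linarith) ?_
    calc (N : ℝ) * M ≤ A * B := by gcongr
      _ ≤ _ := x5
  have b1 := bound G G' h
  have b2 := bound H H' h'
  -- With `L = 22 Λ` the constant is `2 * (24 + 3680 * 22 ^ 3)`, below `10 ^ 8`.
  have htot : ∑ p ∈ P, (coll N G p G' + coll N H p H') ≤ ∑ p ∈ P, 10 ^ 8 * Λ ^ 3 := by
    rw [Finset.sum_add_distrib, Finset.sum_const, nsmul_eq_mul]
    have c1 : 3680 * (22 * Λ) ^ 2 * M ≤ 3680 * (22 * Λ) ^ 2 * (22 * Λ * P.card) := by gcongr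
    have c2 : (24 : ℝ) * P.card ≤ 24 * (P.card * Λ ^ 3) := by nlinarith
    have c3 : 0 ≤ (P.card : ℝ) * Λ ^ 3 := by positivity
    have c4 : 3680 * (22 * Λ) ^ 2 * (22 * Λ * P.card) = 3680 * 22 ^ 3 * (P.card * Λ ^ 3) := by ring
    rw [c4] at c1
    nlinarith
  obtain ⟨p, hp, hpb⟩ := Finset.exists_le_of_sum_le (Finset.card_pos.mp hPpos) htot
  obtain ⟨hpp, hpM, hpL⟩ := hP p hp
  have k1 := one_le_coll n1 hpp.one_le G G'
  have k2 := one_le_coll n1 hpp.one_le H H'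
  have hpM' : (p : ℝ) ≤ M := by exact_mod_cast hpM
  refine ⟨N, p, n1, hpp.one_le, n3, hpM'.trans m3, ?_, ?_, by linarith, by linarith⟩
  · nlinarith
  · linarith

/-- Existence of constellation sizes close to `A` and `B` with few collisions at two receivers. -/
theorem exists_sizes {A B Λ : ℝ} (hA : 1 ≤ A) (hB : 1 ≤ B) (hΛ : 1 ≤ Λ)
    (hAΛ : Real.log A ≤ Λ) (hBΛ : Real.log B ≤ Λ) {G G' H H' : ℝ} (h : Fits A B G G')
    (h' : Fits A B H H') :
    ∃ N₁ N₂ : ℕ, 1 ≤ N₁ ∧ 1 ≤ N₂ ∧ (N₁ : ℝ) ≤ A ∧ (N₂ : ℝ) ≤ B ∧ A ≤ 44 * Λ * N₁ ∧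
      B ≤ 44 * Λ * N₂ ∧ coll N₁ G N₂ G' ≤ 10 ^ 8 * Λ ^ 3 ∧ coll N₁ H N₂ H' ≤ 10 ^ 8 * Λ ^ 3 := by
  rcases le_total A B with hAB | hAB
  · exact exists_sizes_of_le hA hAB hΛ hBΛ h h'
  · obtain ⟨N₂, N₁, a1, a2, a3, a4, a5, a6, a7, a8⟩ := exists_sizes_of_le hB hAB hΛ hAΛ h.symm h'.symm
    exact ⟨N₁, N₂, a2, a1, a4, a3, a6, a5, by rwa [coll_comm], by rwa [coll_comm]⟩

/-! ### Achievability criterion -/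

/-- Criterion for a user with gain `g`, interfering gain `g'`, and mixed inputs with parameters
`(N, δ)` and `(N', δ')`, to achieve the rate `(1/2) log₂ u` up to a gap of `log₂ Γ` bits. -/
def RateOK (g g' : ℝ) (N N' : ℕ) (δ δ' u Γ : ℝ) : Prop :=
  49 * coll N (amp g δ (1 + g' ^ 2 * δ' + g ^ 2 * δ)) N' (amp g' δ' (1 + g' ^ 2 * δ' + g ^ 2 * δ)) ^ 2 *
    ((1 + g' ^ 2 * δ') * u) ≤ Γ ^ 2 * (N ^ 2 * (1 + g' ^ 2 * δ' + g ^ 2 * δ))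

theorem RateOK.mono {g g' : ℝ} {N N' : ℕ} {δ δ' u Γ Γ' : ℝ} (h : RateOK g g' N N' δ δ' u Γ)
    (hδ : 0 ≤ δ) (hδ' : 0 ≤ δ') (hΓ : 0 ≤ Γ) (hΓ' : Γ ≤ Γ') : RateOK g g' N N' δ δ' u Γ' :=
  le_trans h (by gcongr)

theorem RateOK.le_mutualInfo {g g' : ℝ} {N N' : ℕ} {δ δ' R gap : ℝ}
    (h : RateOK g g' N N' δ δ' ((2 : ℝ) ^ (2 * R)) ((2 : ℝ) ^ gap)) (hN : 1 ≤ N) (hN' : 1 ≤ N')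
    (hδ : 0 ≤ δ) (hδ' : 0 ≤ δ') :
    ENNReal.ofReal (max (R - gap) 0) ≤
      mutualInfo (inputOutputLaw g g' (mixedInput N δ) (mixedInput N' δ')) := by
  refine le_trans ?_ (GaussianIC.le_mutualInfo hN hN' hδ hδ' rfl rfl)
  rw [RateOK] at h
  set w := 1 + g' ^ 2 * δ' with hw
  set s := w + g ^ 2 * δ with hs
  set K := coll N (amp g δ s) N' (amp g' δ' s)
  have hw0 : 0 < w := by positivity
  have hs0 : 0 < s := by positivity
  have hK : 1 ≤ K := one_le_coll hN hN' _ _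
  have hN0 : (0 : ℝ) < N := by exact_mod_cast hN
  have e : ∀ x : ℝ, ENNReal.ofReal (max x 0) = ENNReal.ofReal x := by
    intro x
    rcases le_total x 0 with hx | hx
    · rw [max_eq_right hx, ENNReal.ofReal_of_nonpos hx, ENNReal.ofReal_zero]
    · rw [max_eq_left hx]
  rw [e]
  apply ENNReal.ofReal_le_ofReal
  rw [Real.le_logb_iff_rpow_le (by norm_num) (by positivity), Real.rpow_sub (by norm_num),
    div_le_div_iff₀ (by positivity) (by positivity)]
  apply le_of_sq_le_sq _ (by positivity)
  rw [mul_pow, mul_pow, mul_pow, mul_pow, Real.sq_sqrt (by positivity)]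
  have e2 : (2 : ℝ) ^ (2 * R) = ((2 : ℝ) ^ R) ^ 2 := by
    rw [← Real.rpow_natCast, ← Real.rpow_mul (by norm_num)]
    congr 1
    push_cast
    ring
  rw [e2] at h
  rw [mul_div_assoc', div_mul_eq_mul_div, le_div_iff₀ hw0]
  calc _ = 49 * K ^ 2 * (w * ((2 : ℝ) ^ R) ^ 2) := by ring
    _ ≤ _ := h
    _ = _ := by ring

/-- The pair of rates `((1/2) log₂ u, (1/2) log₂ v)` is achieved by some mixed inputs up to
a gap of `log₂ Γ` bits. -/
def Achieves (h : Channel) (u v Γ : ℝ) : Prop :=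
  ∃ (N₁ N₂ : ℕ) (δ₁ δ₂ : ℝ), 1 ≤ N₁ ∧ 1 ≤ N₂ ∧ (0 ≤ δ₁ ∧ δ₁ ≤ 1) ∧ (0 ≤ δ₂ ∧ δ₂ ≤ 1) ∧
    RateOK h.h11 h.h12 N₁ N₂ δ₁ δ₂ u Γ ∧ RateOK h.h22 h.h21 N₂ N₁ δ₂ δ₁ v Γ

theorem Achieves.mono {h : Channel} {u v Γ Γ' : ℝ} (H : Achieves h u v Γ) (hΓ : 0 ≤ Γ)
    (hΓ' : Γ ≤ Γ') : Achieves h u v Γ' := by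
  obtain ⟨N₁, N₂, δ₁, δ₂, a1, a2, a3, a4, a5, a6⟩ := H
  exact ⟨N₁, N₂, δ₁, δ₂, a1, a2, a3, a4, a5.mono a3.1 a4.1 hΓ hΓ', a6.mono a4.1 a3.1 hΓ hΓ'⟩

/-- The channel with the users exchanged. -/
def Channel.swap (h : Channel) : Channel := ⟨h.h22, h.h21, h.h12, h.h11⟩

theorem Achieves.of_swap {h : Channel} {u v Γ : ℝ} (H : Achieves h.swap v u Γ) :
    Achieves h u v Γ := by
  obtain ⟨N₁, N₂, δ₁, δ₂, a1, a2, a3, a4, a5, a6⟩ := H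
  exact ⟨N₂, N₁, δ₂, δ₁, a2, a1, a4, a3, a6, a5⟩

theorem Achieves.mem_tinNoTSRegion {h : Channel} {R₁ R₂ gap : ℝ}
    (H : Achieves h ((2 : ℝ) ^ (2 * R₁)) ((2 : ℝ) ^ (2 * R₂)) ((2 : ℝ) ^ gap)) :
    (max (R₁ - gap) 0, max (R₂ - gap) 0) ∈ tinNoTSRegion h mixedInputs := by
  obtain ⟨N₁, N₂, δ₁, δ₂, a1, a2, a3, a4, a5, a6⟩ := H
  exact ⟨mixedInput N₁ δ₁, ⟨N₁, δ₁, a1, a3.1, a3.2, rfl⟩, mixedInput N₂ δ₂,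
    ⟨N₂, δ₂, a2, a4.1, a4.2, rfl⟩, ⟨le_max_right _ _, a5.le_mutualInfo a1 a2 a3.1 a4.1⟩,
    ⟨le_max_right _ _, a6.le_mutualInfo a2 a1 a4.1 a3.1⟩⟩

/-! ### The outer bound in multiplicative form -/

/-- The outer bound in terms of `u = 2 ^ (2 R₁)` and `v = 2 ^ (2 R₂)`. -/
structure OuterMul (h : Channel) (u v : ℝ) : Prop where
  one_le_u : 1 ≤ u
  one_le_v : 1 ≤ v
  u_le : u ≤ 1 + h.h11 ^ 2
  v_le : v ≤ 1 + h.h22 ^ 2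
  uv_le : u * v ≤ max ((1 + h.h11 ^ 2) / (1 + h.h21 ^ 2)) 1 * (1 + (h.h21 ^ 2 + h.h22 ^ 2))
  uv_le' : u * v ≤ max ((1 + h.h22 ^ 2) / (1 + h.h12 ^ 2)) 1 * (1 + (h.h11 ^ 2 + h.h12 ^ 2))
  uv_le_mul : u * v ≤ (1 + (h.h12 ^ 2 + h.h11 ^ 2 / (1 + h.h21 ^ 2))) *
    (1 + (h.h21 ^ 2 + h.h22 ^ 2 / (1 + h.h12 ^ 2)))
  uuv_le : u ^ 2 * v ≤ (1 + (h.h11 ^ 2 + h.h12 ^ 2)) *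
    (1 + (h.h21 ^ 2 + h.h22 ^ 2 / (1 + h.h12 ^ 2))) *
    max ((1 + h.h11 ^ 2) / (1 + h.h21 ^ 2)) 1
  uvv_le : v ^ 2 * u ≤ (1 + (h.h22 ^ 2 + h.h21 ^ 2)) *
    (1 + (h.h12 ^ 2 + h.h11 ^ 2 / (1 + h.h21 ^ 2))) *
    max ((1 + h.h22 ^ 2) / (1 + h.h12 ^ 2)) 1

theorem OuterMul.swap {h : Channel} {u v : ℝ} (O : OuterMul h u v) : OuterMul h.swap v u where
  one_le_u := O.one_le_v
  one_le_v := O.one_le_u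
  u_le := O.v_le
  v_le := O.u_le
  uv_le := by rw [mul_comm]; have := O.uv_le'; rwa [add_comm (h.h11 ^ 2)] at this
  uv_le' := by rw [mul_comm]; have := O.uv_le; rwa [add_comm (h.h21 ^ 2)] at this
  uv_le_mul := by
    rw [mul_comm]; have := O.uv_le_mul; rwa [mul_comm (1 + (h.h12 ^ 2 + _))] at this
  uuv_le := O.uvv_le
  uvv_le := O.uuv_le

theorem two_rpow_two_mul_Ig {x : ℝ} (hx : 0 ≤ x) : (2 : ℝ) ^ (2 * Ig x) = 1 + x := by
  rw [Ig, ← mul_assoc]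
  norm_num
  exact Real.rpow_logb (by norm_num) (by norm_num) (by linarith)

theorem two_rpow_two_mul_max {x y : ℝ} (hx : 0 ≤ x) (hy : 0 ≤ y) :
    (2 : ℝ) ^ (2 * max (Ig x - Ig y) 0) = max ((1 + x) / (1 + y)) 1 := by
  have h1 : (2 : ℝ) ^ (2 * (Ig x - Ig y)) = (1 + x) / (1 + y) := by
    rw [mul_sub, Real.rpow_sub (by norm_num), two_rpow_two_mul_Ig hx, two_rpow_two_mul_Ig hy]
  rw [← h1]
  rcases le_total (Ig x - Ig y) 0 with h | h
  · rw [max_eq_right h, max_eq_right]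
    · simp
    · exact Real.rpow_le_one_of_one_le_of_nonpos (by norm_num) (by linarith)
  · rw [max_eq_left h, max_eq_left]
    exact Real.one_le_rpow (by norm_num) (by linarith)

theorem outerMul_of_mem {h : Channel} {R : ℝ × ℝ} (hR : R ∈ outerBound h) :
    OuterMul h ((2 : ℝ) ^ (2 * R.1)) ((2 : ℝ) ^ (2 * R.2)) := by
  obtain ⟨⟨p1, p2⟩, q1, q2, q3, q4, q5, q6, q7⟩ := hR
  have mono : ∀ {x y : ℝ}, x ≤ y → (2 : ℝ) ^ (2 * x) ≤ (2 : ℝ) ^ (2 * y) := fun {x y} hxy =>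
    Real.rpow_le_rpow_of_exponent_le (by norm_num) (by linarith)
  have add : ∀ x y : ℝ, (2 : ℝ) ^ (2 * (x + y)) = (2 : ℝ) ^ (2 * x) * (2 : ℝ) ^ (2 * y) :=
    fun x y => by rw [mul_add, Real.rpow_add (by norm_num)]
  have two : ∀ x : ℝ, (2 : ℝ) ^ (2 * (2 * x)) = ((2 : ℝ) ^ (2 * x)) ^ 2 := fun x => by
    rw [sq, ← add]; ring_nf
  have n11 := sq_nonneg h.h11
  have n12 := sq_nonneg h.h12
  have n21 := sq_nonneg h.h21
  have n22 := sq_nonneg h.h22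
  have d1 : 0 ≤ h.h11 ^ 2 / (1 + h.h21 ^ 2) := by positivity
  have d2 : 0 ≤ h.h22 ^ 2 / (1 + h.h12 ^ 2) := by positivity
  refine ⟨Real.one_le_rpow (by norm_num) (by linarith), Real.one_le_rpow (by norm_num) (by linarith),
    ?_, ?_, ?_, ?_, ?_, ?_, ?_⟩
  · simpa only [two_rpow_two_mul_Ig n11] using mono q1
  · simpa only [two_rpow_two_mul_Ig n22] using mono q2
  · have := mono q3
    rwa [add, add, two_rpow_two_mul_max n11 n21, two_rpow_two_mul_Ig (by linarith)] at this
  · have := mono q4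
    rwa [add, add, two_rpow_two_mul_max n22 n12, two_rpow_two_mul_Ig (by linarith)] at this
  · have := mono q5
    rwa [add, add, two_rpow_two_mul_Ig (by linarith), two_rpow_two_mul_Ig (by linarith)] at this
  · have := mono q6
    rwa [add, add, add, two, two_rpow_two_mul_max n11 n21, two_rpow_two_mul_Ig (by linarith),
      two_rpow_two_mul_Ig (by linarith)] at this
  · have := mono q7
    rw [add, add, add, two, two_rpow_two_mul_max n22 n12, two_rpow_two_mul_Ig (by linarith),
      two_rpow_two_mul_Ig (by linarith)] at this
    rw [mul_comm, add_comm (h.h22 ^ 2)]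
    exact this

/-! ### Amplitudes -/

theorem sqrt_le_abs_amp {g δ s X : ℝ} (hδ : δ ≤ 1) (hs : 0 < s)
    (h : X * s ≤ 12 * (g ^ 2 * (1 - δ))) : Real.sqrt X ≤ |amp g δ s| := by
  apply Real.sqrt_le_iff.mpr ⟨abs_nonneg _, ?_⟩
  rw [sq_abs, amp, div_pow, mul_pow, mul_pow, Real.sq_sqrt (by norm_num), Real.sq_sqrt (by linarith),
    Real.sq_sqrt hs.le, le_div_iff₀ hs]
  exact h

theorem sqrt_one_add_le {X : ℝ} (hX : 0 ≤ X) : Real.sqrt (1 + X) ≤ 1 + Real.sqrt X := by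
  apply Real.sqrt_le_iff.mpr ⟨by positivity, ?_⟩
  nlinarith [Real.sq_sqrt hX, Real.sqrt_nonneg X]

/-- Squared form of the packing conditions: `X` and `Y` are lower bounds for the squared amplitudes,
so each scheme needs only polynomial inequalities between powers. -/
theorem fits_sqrt {a b X Y g δ g' δ' s : ℝ} (ha : 0 ≤ a) (hδ : δ ≤ 1) (hδ' : δ' ≤ 1) (hs : 0 < s)
    (hX0 : 0 ≤ X) (hY0 : 0 ≤ Y) (hX : X * s ≤ 12 * (g ^ 2 * (1 - δ)))
    (hY : Y * s ≤ 12 * (g' ^ 2 * (1 - δ'))) (haX : a ≤ 1 + X) (hbY : b ≤ 1 + Y)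
    (hab : a * b ≤ 1 + max X Y) :
    Fits (Real.sqrt a) (Real.sqrt b) |amp g δ s| |amp g' δ' s| := by
  have h1 := sqrt_le_abs_amp hδ hs hX
  have h2 := sqrt_le_abs_amp hδ' hs hY
  refine ⟨abs_nonneg _, abs_nonneg _, ?_, ?_, ?_⟩
  · exact (Real.sqrt_le_sqrt haX).trans ((sqrt_one_add_le hX0).trans (by linarith))
  · exact (Real.sqrt_le_sqrt hbY).trans ((sqrt_one_add_le hY0).trans (by linarith))
  · rw [← Real.sqrt_mul ha]
    refine (Real.sqrt_le_sqrt hab).trans ((sqrt_one_add_le (le_max_of_le_left hX0)).trans ?_)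
    rcases le_total X Y with h | h
    · rw [max_eq_right h]
      have := le_max_right |amp g δ s| |amp g' δ' s|
      linarith
    · rw [max_eq_left h]
      have := le_max_left |amp g δ s| |amp g' δ' s|
      linarith

/-- Reduces `RateOK` to an inequality between the parameters. -/
theorem RateOK.of_coll_le {g g' : ℝ} {N N' : ℕ} {δ δ' u Γ κ : ℝ} (hu : 0 ≤ u) (hδ' : 0 ≤ δ')
    (hN : 1 ≤ N) (hN' : 1 ≤ N')
    (hK : coll N (amp g δ (1 + g' ^ 2 * δ' + g ^ 2 * δ)) N'
      (amp g' δ' (1 + g' ^ 2 * δ' + g ^ 2 * δ)) ≤ κ)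
    (h : 49 * κ ^ 2 * ((1 + g' ^ 2 * δ') * u) ≤ Γ ^ 2 * (N ^ 2 * (1 + g' ^ 2 * δ' + g ^ 2 * δ))) :
    RateOK g g' N N' δ δ' u Γ := by
  have := one_le_coll hN hN' (amp g δ (1 + g' ^ 2 * δ' + g ^ 2 * δ))
    (amp g' δ' (1 + g' ^ 2 * δ' + g ^ 2 * δ))
  refine le_trans ?_ h
  gcongr

/-! ### Gaussian inputs with power control -/

theorem Channel.exists_sq (h : Channel) : ∃ s₁ s₂ c d : ℝ, 1 ≤ s₁ ∧ 1 ≤ s₂ ∧ 1 ≤ c ∧ 1 ≤ d ∧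
    h.h11 ^ 2 = s₁ - 1 ∧ h.h22 ^ 2 = s₂ - 1 ∧ h.h12 ^ 2 = c - 1 ∧ h.h21 ^ 2 = d - 1 :=
  ⟨1 + h.h11 ^ 2, 1 + h.h22 ^ 2, 1 + h.h12 ^ 2, 1 + h.h21 ^ 2, by nlinarith, by nlinarith,
    by nlinarith, by nlinarith, by ring, by ring, by ring, by ring⟩

/-- A single parameter `t`, the level of user 2 at receiver 1, fixes both powers: user 1 arrives
there at level `u t`, and user 2 arrives at its own receiver at level about `s₂ t / c`. The bound `u
v c d ≤ 9 s₁ s₂` then secures `v`. -/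
theorem achieves_gaussian {h : Channel} {u v : ℝ} (O : OuterMul h u v)
    (h₁ : (1 + h.h12 ^ 2) * (1 + h.h21 ^ 2) ≤ 2 * (1 + h.h11 ^ 2))
    (h₂ : (1 + h.h12 ^ 2) * (1 + h.h21 ^ 2) ≤ 2 * (1 + h.h22 ^ 2)) :
    Achieves h u v 42 := by
  obtain ⟨hu1, hv1, hu, hv, -, -, huv, -, -⟩ := O
  obtain ⟨s₁, s₂, c, d, hs1, hs2, hc, hd, e11, e22, e12, e21⟩ := h.exists_sq
  rw [e11, e12, e21] at h₁
  rw [e22, e12, e21] at h₂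
  rw [e11] at hu
  rw [e22] at hv
  rw [e11, e12, e21, e22] at huv
  simp only [add_sub_cancel] at h₁ h₂ hu hv huv
  have hc0 : 0 < c := by linarith
  have hd0 : 0 < d := by linarith
  have hs10 : 0 < s₁ := by linarith
  have hs20 : 0 < s₂ := by linarith
  have hu0 : 0 < u := by linarith
  have hv0 : 0 < v := by linarith
  have huv' : u * v * (c * d) ≤ 9 * (s₁ * s₂) := by
    have a1 : 1 + (c - 1 + (s₁ - 1) / d) ≤ 3 * s₁ / d := by
      rw [le_div_iff₀ hd0, add_mul, add_mul, div_mul_cancel₀ _ hd0.ne']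
      nlinarith
    have a2 : 1 + (d - 1 + (s₂ - 1) / c) ≤ 3 * s₂ / c := by
      rw [le_div_iff₀ hc0, add_mul, add_mul, div_mul_cancel₀ _ hc0.ne']
      nlinarith
    have a3 : u * v ≤ 3 * s₁ / d * (3 * s₂ / c) := by
      refine huv.trans (mul_le_mul a1 a2 ?_ (by positivity))
      have : 0 ≤ (s₂ - 1) / c := div_nonneg (by linarith) hc0.le
      linarith
    calc u * v * (c * d) ≤ 3 * s₁ / d * (3 * s₂ / c) * (c * d) := by gcongr
      _ = _ := by field_simp; ring
  -- The largest level that keeps user 1 below the noise at receiver 2, capped at full power `t =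
  -- c`. If even `t = 1` is too loud there, `t = 1` is taken.
  obtain ⟨t, ht1, htc, hut, ht⟩ : ∃ t : ℝ, 1 ≤ t ∧ t ≤ c ∧ u * t ≤ s₁ ∧
      ((t = 1 ∧ s₁ ≤ d * u) ∨ (d * u * t ≤ s₁ ∧ (t = c ∨ d * u * t = s₁))) := by
    rcases le_total s₁ (d * u) with h1 | h1
    · exact ⟨1, le_rfl, hc, by linarith, Or.inl ⟨rfl, h1⟩⟩
    · have hdu : 0 < d * u := by positivity
      refine ⟨min (s₁ / (d * u)) c, le_min (by rwa [le_div_iff₀ hdu, one_mul]) hc, min_le_right _ _,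
        ?_, Or.inr ⟨?_, ?_⟩⟩
      · have h2 : min (s₁ / (d * u)) c ≤ s₁ / (d * u) := min_le_left _ _
        calc u * min (s₁ / (d * u)) c ≤ u * (s₁ / (d * u)) := by gcongr
          _ = s₁ / d := by field_simp
          _ ≤ s₁ := div_le_self hs10.le hd
      · calc d * u * min (s₁ / (d * u)) c ≤ d * u * (s₁ / (d * u)) := by
              gcongr; exact min_le_left _ _
          _ = s₁ := by field_simp
      · rcases min_choice (s₁ / (d * u)) c with h2 | h2
        · right; rw [h2]; field_simp
        · left; exact h2
  have ht0 : 0 < t := by linarith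
  refine ⟨1, 1, u * t / s₁, t / c, le_rfl, le_rfl,
    ⟨by positivity, by rw [div_le_one hs10]; exact hut⟩,
    ⟨by positivity, by rw [div_le_one hc0]; exact htc⟩, ?_, ?_⟩
  · refine RateOK.of_coll_le hu0.le (by positivity) le_rfl le_rfl (coll_one_one _ _).le ?_
    rw [e11, e12]
    have x1 : (c - 1) * (t / c) ≤ t := by
      rw [mul_div_assoc', div_le_iff₀ hc0]; nlinarith
    have x2 : 0 ≤ (c - 1) * (t / c) := mul_nonneg (by linarith) (by positivity)
    have x3 : 0 ≤ (s₁ - 1) * (u * t / s₁) := mul_nonneg (by linarith) (by positivity)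
    have key : (1 + (c - 1) * (t / c)) * u ≤
        4 * (1 + (c - 1) * (t / c) + (s₁ - 1) * (u * t / s₁)) := by
      rcases le_total s₁ 2 with h2 | h2
      · nlinarith
      · have x4 : u * t / 2 ≤ (s₁ - 1) * (u * t / s₁) := by
          rw [mul_div_assoc', div_le_div_iff₀ (by norm_num) hs10]
          have : 0 < u * t := by positivity
          nlinarith
        nlinarith
    push_cast
    linarith
  · refine RateOK.of_coll_le hv0.le (by positivity) le_rfl le_rfl (coll_one_one _ _).le ?_
    rw [e22, e21]
    have y2 : 0 ≤ (d - 1) * (u * t / s₁) := mul_nonneg (by linarith) (by positivity)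
    have y3 : 0 ≤ (s₂ - 1) * (t / c) := mul_nonneg (by linarith) (by positivity)
    have key : (1 + (d - 1) * (u * t / s₁)) * v ≤
        36 * (1 + (d - 1) * (u * t / s₁) + (s₂ - 1) * (t / c)) := by
      rcases le_total s₂ 2 with h2 | h2
      · nlinarith
      · have y4 : s₂ * t / c ≤ 2 * ((s₂ - 1) * (t / c)) := by
          rw [mul_div_assoc]
          have : 0 < t / c := by positivity
          nlinarith
        rcases ht with ⟨ht1, hdu⟩ | ⟨hdu, ht2⟩
        · subst ht1
          have y5 : 1 + (d - 1) * (u * 1 / s₁) ≤ 2 * (d * u / s₁) := by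
            have z1 : 1 ≤ d * u / s₁ := by rwa [le_div_iff₀ hs10, one_mul]
            have z2 : (d - 1) * (u * 1 / s₁) ≤ d * u / s₁ := by
              rw [mul_div_assoc', mul_one]; gcongr; linarith
            linarith
          have y6 : d * u / s₁ * v ≤ 9 * (s₂ * 1 / c) := by
            rw [div_mul_eq_mul_div, mul_div_assoc', div_le_div_iff₀ hs10 hc0]
            linarith
          calc _ ≤ 2 * (d * u / s₁) * v := mul_le_mul_of_nonneg_right y5 hv0.le
            _ ≤ _ := by linarith
        · have y5 : 1 + (d - 1) * (u * t / s₁) ≤ 2 := by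
            have : (d - 1) * (u * t / s₁) ≤ 1 := by
              rw [mul_div_assoc', div_le_one hs10]
              have : 0 < u * t := by positivity
              linarith
            linarith
          rcases ht2 with ht2 | ht2
          · have y7 : s₂ * t / c = s₂ := by rw [ht2]; field_simp
            rw [y7] at y4
            calc _ ≤ 2 * v := mul_le_mul_of_nonneg_right y5 hv0.le
              _ ≤ _ := by linarith
          · have y6 : v ≤ 9 * (s₂ * t / c) := by
              rw [mul_div_assoc', le_div_iff₀ hc0]
              have z : 0 < u * d := by positivity
              have : u * d * (v * c) ≤ u * d * (9 * (s₂ * t)) := by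
                calc u * d * (v * c) = u * v * (c * d) := by ring
                  _ ≤ 9 * (s₁ * s₂) := huv'
                  _ = u * d * (9 * (s₂ * t)) := by rw [← ht2]; ring
              exact le_of_mul_le_mul_left this z
            calc _ ≤ 2 * v := mul_le_mul_of_nonneg_right y5 hv0.le
              _ ≤ _ := by linarith
    push_cast
    linarith

/-! ### Schemes with a bounded gap -/

theorem exists_nat_le_le_two_mul {x : ℝ} (hx : 1 ≤ x) : ∃ N : ℕ, 1 ≤ N ∧ (N : ℝ) ≤ x ∧ x ≤ 2 * N := by
  have h1 : 1 ≤ ⌊x⌋₊ := Nat.one_le_floor_iff x |>.mpr hx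
  have h2 := Nat.lt_floor_add_one x
  have h3 : (1 : ℝ) ≤ ⌊x⌋₊ := by exact_mod_cast h1
  exact ⟨⌊x⌋₊, h1, Nat.floor_le (by linarith), by linarith⟩

/-- The private (Gaussian) part of the input of a user with direct gain `s - 1` and gain `d - 1`
towards the other receiver: it is received at level `m` at its own receiver, and below the noise level
at the other receiver. -/
theorem exists_private {s d u : ℝ} (hs : 1 ≤ s) (hd : 1 ≤ d) (hu : 1 ≤ u) (hus : u ≤ s) :
    ∃ m δ : ℝ, 1 ≤ m ∧ m ≤ u ∧ (m = u ∨ m = max (s / d) 1) ∧ m ≤ max (s / d) 1 ∧ 0 ≤ δ ∧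
      δ ≤ 1 / 2 ∧ m / 4 ≤ 1 + (s - 1) * δ ∧ (s - 1) * δ ≤ (m - 1) / 2 ∧ (d - 1) * δ ≤ 1 / 2 := by
  have hs0 : 0 < s := by linarith
  have hd0 : 0 < d := by linarith
  set m := min u (max (s / d) 1) with hm
  have hm1 : 1 ≤ m := le_min hu (le_max_right _ _)
  have hmu : m ≤ u := min_le_left _ _
  have hme : m ≤ max (s / d) 1 := min_le_right _ _
  have hms : m ≤ s := hmu.trans hus
  -- The cap `m ≤ max (s / d) 1` keeps the private part below the noise at the other receiver; the 2
  -- leaves at least half of the power to the discrete part.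
  refine ⟨m, (m - 1) / (2 * s), hm1, hmu, min_choice _ _, hme, div_nonneg (by linarith) (by linarith),
    ?_, ?_, ?_, ?_⟩
  · rw [div_le_div_iff₀ (by linarith) (by norm_num)]; linarith
  · rw [mul_div_assoc']
    rcases le_total s 2 with h | h
    · have : 0 ≤ (s - 1) * (m - 1) / (2 * s) := by
        apply div_nonneg (mul_nonneg _ _) <;> linarith
      linarith
    · have : (m - 1) / 4 ≤ (s - 1) * (m - 1) / (2 * s) := by
        rw [div_le_div_iff₀ (by norm_num) (by linarith)]
        nlinarith
      linarith
  · rw [mul_div_assoc', div_le_div_iff₀ (by linarith) (by norm_num)]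
    nlinarith
  · rw [mul_div_assoc', div_le_div_iff₀ (by linarith) (by norm_num)]
    rcases le_total (s / d) 1 with h | h
    · rw [max_eq_right h] at hme
      have : m = 1 := le_antisymm hme hm1
      rw [this]
      nlinarith
    · rw [max_eq_left h, le_div_iff₀ hd0] at hme
      nlinarith

/-- Bounded gap when the interference at the first receiver is negligible, and the second
receiver can decode the interference. -/
theorem achieves_of_weak_of_strong {h : Channel} {u v : ℝ} (O : OuterMul h u v)
    (h₁ : h.h12 ^ 2 ≤ 1) (h₂ : h.h22 ^ 2 ≤ h.h21 ^ 2) : Achieves h u v 1000 := by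
  obtain ⟨hu1, hv1, hu, hv, huv, -, -, -, -⟩ := O
  obtain ⟨s₁, s₂, c, d, hs1, hs2, hc, hd, e11, e22, e12, e21⟩ := h.exists_sq
  rw [e12] at h₁
  rw [e22, e21] at h₂
  rw [e11] at hu
  rw [e22] at hv
  rw [e11, e21, e22] at huv
  simp only [add_sub_cancel] at hu hv huv
  have hs20 : 0 < s₂ := by linarith
  have hu0 : 0 < u := by linarith
  have hv0 : 0 < v := by linarith
  obtain ⟨m, δ₁, hm1, hmu, hm, hme, hδ0, hδ, hδ4, hδm, hδd⟩ := exists_private hs1 hd hu1 hu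
  have hm0 : 0 < m := by linarith
  have ha1 : 1 ≤ u / m := by rwa [le_div_iff₀ hm0, one_mul]
  obtain ⟨N, hN1, hNA, hAN⟩ := exists_nat_le_le_two_mul (Real.one_le_sqrt.mpr ha1)
  have hN0 : (0 : ℝ) < N := by exact_mod_cast hN1
  have haN : u ≤ 4 * N ^ 2 * m := by
    have : u / m ≤ 4 * N ^ 2 := by
      calc u / m = Real.sqrt (u / m) ^ 2 := (Real.sq_sqrt (by positivity)).symm
        _ ≤ (2 * N) ^ 2 := by gcongr
        _ = _ := by ring
    rwa [div_le_iff₀ hm0] at this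
  have hNle : ∀ X y : ℝ, 0 ≤ X → u / m ≤ 1 + X → Real.sqrt X ≤ y → (N : ℝ) ≤ 1 + y := by
    intro X y hX h1 h2
    exact hNA.trans ((Real.sqrt_le_sqrt h1).trans ((sqrt_one_add_le hX).trans (by linarith)))
  -- User 2 uses only the power its rate needs. Receiver 2 must resolve user 1's constellation over
  -- this signal, whose level is thus of order `v` and not `s₂`.
  have hδ₂0 : 0 ≤ (v - 1) / s₂ := div_nonneg (by linarith) hs20.le
  have hδ₂1 : (v - 1) / s₂ ≤ 1 := by rw [div_le_one hs20]; linarith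
  have hδ₂a : (s₂ - 1) * ((v - 1) / s₂) ≤ v - 1 := by
    rw [mul_div_assoc', div_le_iff₀ hs20]; nlinarith
  have hδ₂b : v / 2 ≤ 1 + (s₂ - 1) * ((v - 1) / s₂) := by
    rcases le_total s₂ 2 with h | h
    · have : 0 ≤ (s₂ - 1) * ((v - 1) / s₂) := mul_nonneg (by linarith) hδ₂0
      linarith
    · have : (v - 1) / 2 ≤ (s₂ - 1) * ((v - 1) / s₂) := by
        rw [mul_div_assoc', div_le_div_iff₀ (by norm_num) hs20]
        nlinarith
      linarith
  set δ₂ := (v - 1) / s₂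
  have hcδ : (c - 1) * δ₂ ≤ 1 := by nlinarith
  have hcδ0 : 0 ≤ (c - 1) * δ₂ := mul_nonneg (by linarith) hδ₂0
  have hsδ0 : 0 ≤ (s₁ - 1) * δ₁ := mul_nonneg (by linarith) hδ0
  have hdδ0 : 0 ≤ (d - 1) * δ₁ := mul_nonneg (by linarith) hδ0
  have hsδ20 : 0 ≤ (s₂ - 1) * δ₂ := mul_nonneg (by linarith) hδ₂0
  refine ⟨N, 1, δ₁, δ₂, hN1, le_rfl, ⟨hδ0, by linarith⟩, ⟨hδ₂0, hδ₂1⟩, ?_, ?_⟩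
  · refine RateOK.of_coll_le (κ := 24) hu0.le hδ₂0 hN1 le_rfl ?_ ?_
    · rw [← coll_abs]
      refine coll_one_right_le hN1 (abs_nonneg _) (hNle ((s₁ - 1) / m) _
        (div_nonneg (by linarith) hm0.le) ?_ (sqrt_le_abs_amp (by linarith) ?_ ?_))
      · rw [div_le_iff₀ hm0, add_mul, div_mul_cancel₀ _ hm0.ne']
        linarith
      · rw [e11, e12]; linarith
      · rw [e11, e12, div_mul_eq_mul_div, div_le_iff₀ hm0]
        nlinarith
    · rw [e11, e12]
      have k1 : u ≤ 16 * (N ^ 2 * (1 + (c - 1) * δ₂ + (s₁ - 1) * δ₁)) := by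
        calc u ≤ 4 * N ^ 2 * m := haN
          _ ≤ 4 * N ^ 2 * (4 * (1 + (c - 1) * δ₂ + (s₁ - 1) * δ₁)) := by gcongr; linarith
          _ = _ := by ring
      have k2 : (1 + (c - 1) * δ₂) * u ≤ 2 * u := by gcongr; linarith
      linarith
  · refine RateOK.of_coll_le (κ := 24) hv0.le hδ0 le_rfl hN1 ?_ ?_
    · rw [← coll_abs]
      refine (coll_le_mul le_rfl hN1 (abs_nonneg _) (hNle (4 * (d - 1) / v) _
        (div_nonneg (by linarith) hv0.le) ?_ (sqrt_le_abs_amp (by linarith) ?_ ?_))).trans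
        (by norm_num)
      · rcases hm with hm | hm
        · rw [hm, div_self hu0.ne']
          have : 0 ≤ 4 * (d - 1) / v := div_nonneg (by linarith) hv0.le
          linarith
        -- With `m = max (s₁ / d) 1` and `s₂ ≤ d`, this is exactly the first sum-rate bound.
        · have k1 : u / m ≤ (2 * d - 1) / v := by
            rw [div_le_div_iff₀ hm0 hv0, mul_comm (2 * d - 1)]
            refine huv.trans ?_
            rw [hm]
            gcongr
            linarith
          refine k1.trans ?_
          rw [div_le_iff₀ hv0, add_mul, div_mul_cancel₀ _ hv0.ne']
          linarith
      · rw [e22, e21]; linarith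
      · rw [e22, e21, div_mul_eq_mul_div, div_le_iff₀ hv0]
        have k1 : 4 * (d - 1) * (1 + (d - 1) * δ₁ + (s₂ - 1) * δ₂) ≤ 4 * (d - 1) * (3 / 2 * v) := by
          gcongr
          linarith
        have k2 : 4 * (d - 1) * (3 / 2 * v) = 12 * ((d - 1) * (1 / 2)) * v := by ring
        have k3 : 12 * ((d - 1) * (1 / 2)) * v ≤ 12 * ((d - 1) * (1 - δ₁)) * v := by
          gcongr
          linarith
        linarith
    · rw [e22, e21]
      push_cast
      have k2 : (1 + (d - 1) * δ₁) * v ≤ 2 * v := by gcongr; linarith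
      linarith

/-- Bounded gap in very strong interference. -/
theorem achieves_of_veryStrong {h : Channel} {u v : ℝ} (O : OuterMul h u v)
    (hvs : VeryStrong h) : Achieves h u v 14000 := by
  obtain ⟨hu1, hv1, hu, hv, -, -, -, -, -⟩ := O
  -- The size is about a tenth of the one the direct gain would allow. This slack provides the
  -- factor `1 + 4 G₁` in the layering condition; flooring makes 10 into 20, and `14000 = 7 * 100 *
  -- 20`.
  have aux : ∀ x : ℝ, ∃ N : ℕ, 1 ≤ N ∧ 1 + x ^ 2 ≤ 400 * N ^ 2 ∧
      (N = 1 ∨ 100 * (N : ℝ) ^ 2 ≤ 1 + x ^ 2) := by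
    intro x
    obtain ⟨N, a1, a2, a3⟩ := exists_nat_le_le_two_mul (le_max_left 1 (Real.sqrt (1 + x ^ 2) / 10))
    have hx : Real.sqrt (1 + x ^ 2) ^ 2 = 1 + x ^ 2 := Real.sq_sqrt (by positivity)
    refine ⟨N, a1, ?_, ?_⟩
    · have := (le_max_right 1 (Real.sqrt (1 + x ^ 2) / 10)).trans a3
      have h2 : Real.sqrt (1 + x ^ 2) ≤ 20 * N := by linarith
      calc 1 + x ^ 2 = Real.sqrt (1 + x ^ 2) ^ 2 := hx.symm
        _ ≤ (20 * N) ^ 2 := by gcongr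
        _ = _ := by ring
    · rcases a1.eq_or_lt with h1 | h1
      · left; exact h1.symm
      · right
        have hN2 : (2 : ℝ) ≤ N := by exact_mod_cast h1
        have : (N : ℝ) ≤ Real.sqrt (1 + x ^ 2) / 10 := by
          rcases le_max_iff.mp a2 with h3 | h3
          · linarith
          · exact h3
        calc 100 * (N : ℝ) ^ 2 ≤ 100 * (Real.sqrt (1 + x ^ 2) / 10) ^ 2 := by gcongr
          _ = Real.sqrt (1 + x ^ 2) ^ 2 := by ring
          _ = _ := hx
  have hamp : ∀ g g' : ℝ, |amp g 0 (1 + g' ^ 2 * 0 + g ^ 2 * 0)| = Real.sqrt (12 * g ^ 2) ∧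
      |amp g' 0 (1 + g' ^ 2 * 0 + g ^ 2 * 0)| = Real.sqrt (12 * g' ^ 2) := by
    intro g g'
    constructor <;> simp [amp, abs_mul, Real.sqrt_sq_eq_abs]
  have main : ∀ (g g' x y : ℝ) (N N' : ℕ), 1 ≤ N → 1 ≤ N' → 1 + g ^ 2 ≤ 400 * N ^ 2 →
      (N = 1 ∨ 100 * (N : ℝ) ^ 2 ≤ 1 + g ^ 2) → (N' = 1 ∨ 100 * (N' : ℝ) ^ 2 ≤ 1 + y ^ 2) →
      y ^ 2 * (1 + g ^ 2) ≤ g' ^ 2 → 0 ≤ x → x ≤ 1 + g ^ 2 → RateOK g g' N N' 0 0 x 14000 := by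
    intro g g' x y N N' hN hN' h1 h2 h3 h4 hx0 hx
    have hN0 : (1 : ℝ) ≤ N := by exact_mod_cast hN
    refine RateOK.of_coll_le (κ := 100) hx0 le_rfl hN hN' ?_ (by nlinarith)
    rw [← coll_abs, (hamp g g').1, (hamp g g').2]
    refine coll_le_of_layered hN hN' (Real.sqrt_nonneg _) ?_ ?_
    · rcases h2 with h2 | h2
      · rw [h2]; have := Real.sqrt_nonneg (12 * g ^ 2); push_cast; linarith
      · have : (N : ℝ) ≤ Real.sqrt (1 + 12 * g ^ 2) := Real.le_sqrt_of_sq_le (by nlinarith)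
        exact this.trans (sqrt_one_add_le (by positivity))
    · rcases h3 with h3 | h3
      · left; exact h3
      · right
        rcases hN'.eq_or_lt with h5 | h5
        · rw [← h5] at h3 ⊢
          push_cast at h3 ⊢
          apply Real.le_sqrt_of_sq_le
          have := Real.sq_sqrt (show 0 ≤ 12 * g ^ 2 by positivity)
          nlinarith [sq_nonneg (1 - 4 * Real.sqrt (12 * g ^ 2)), sq_nonneg g]
        have hN2 : (2 : ℝ) ≤ N' := by exact_mod_cast h5
        apply Real.le_sqrt_of_sq_le
        have e1 := Real.sq_sqrt (show 0 ≤ 12 * g ^ 2 by positivity)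
        have e2 : (1 + 4 * Real.sqrt (12 * g ^ 2)) ^ 2 ≤ 400 * (1 + g ^ 2) := by
          nlinarith [sq_nonneg (1 - 4 * Real.sqrt (12 * g ^ 2)), sq_nonneg g]
        have e3 : (1 : ℝ) ≤ y ^ 2 := by nlinarith
        rw [mul_pow]
        calc (N' : ℝ) ^ 2 * (1 + 4 * Real.sqrt (12 * g ^ 2)) ^ 2 ≤
              ((1 + y ^ 2) / 100) * (400 * (1 + g ^ 2)) := by
              gcongr
              linarith
          _ ≤ (2 * y ^ 2 / 100) * (400 * (1 + g ^ 2)) := by gcongr; linarith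
          _ = 8 * (y ^ 2 * (1 + g ^ 2)) := by ring
          _ ≤ 8 * g' ^ 2 := by gcongr
          _ ≤ 12 * g' ^ 2 := by nlinarith [sq_nonneg g']
  obtain ⟨N₁, a1, a2, a3⟩ := aux h.h11
  obtain ⟨N₂, b1, b2, b3⟩ := aux h.h22
  refine ⟨N₁, N₂, 0, 0, a1, b1, ⟨le_rfl, by norm_num⟩, ⟨le_rfl, by norm_num⟩,
    main _ _ _ _ _ _ a1 b1 a2 a3 b3 hvs.2 (by linarith) hu,
    main _ _ _ _ _ _ b1 a1 b2 b3 a3 hvs.1 (by linarith) hv⟩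

/-! ### Schemes with a doubly logarithmic gap -/

theorem le_max_div_add {x y m : ℝ} (hm : 1 ≤ m) {z : ℝ}
    (h : z * m ≤ 1 + max x y) : z ≤ 1 + max (x / m) (y / m) := by
  have hm0 : 0 < m := by linarith
  rw [max_div_div_right hm0.le, ← sub_le_iff_le_add', le_div_iff₀ hm0, sub_mul]
  linarith

/-- Constellation sizes for prescribed squared sizes `a` and `b`. -/
theorem exists_sizes_sq {a b Λ : ℝ} (ha : 1 ≤ a) (hb : 1 ≤ b) (hΛ : 1 ≤ Λ)
    (haΛ : Real.log a ≤ 2 * Λ) (hbΛ : Real.log b ≤ 2 * Λ) {G G' H H' : ℝ}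
    (h : Fits (Real.sqrt a) (Real.sqrt b) |G| |G'|)
    (h' : Fits (Real.sqrt a) (Real.sqrt b) |H| |H'|) :
    ∃ N₁ N₂ : ℕ, 1 ≤ N₁ ∧ 1 ≤ N₂ ∧ (N₁ : ℝ) ^ 2 ≤ a ∧ (N₂ : ℝ) ^ 2 ≤ b ∧
      a ≤ (44 * Λ) ^ 2 * N₁ ^ 2 ∧ b ≤ (44 * Λ) ^ 2 * N₂ ^ 2 ∧
      coll N₁ G N₂ G' ≤ 10 ^ 8 * Λ ^ 3 ∧ coll N₁ H N₂ H' ≤ 10 ^ 8 * Λ ^ 3 := by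
  have hlog : ∀ x : ℝ, 1 ≤ x → Real.log x ≤ 2 * Λ → Real.log (Real.sqrt x) ≤ Λ := by
    intro x hx h
    rw [Real.log_sqrt (by linarith)]
    linarith
  obtain ⟨N₁, N₂, a1, a2, a3, a4, a5, a6, a7, a8⟩ := exists_sizes (Real.one_le_sqrt.mpr ha)
    (Real.one_le_sqrt.mpr hb) hΛ (hlog a ha haΛ) (hlog b hb hbΛ) h h'
  rw [coll_abs] at a7 a8
  have ea := Real.sq_sqrt (show 0 ≤ a by linarith)
  have eb := Real.sq_sqrt (show 0 ≤ b by linarith)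
  refine ⟨N₁, N₂, a1, a2, ?_, ?_, ?_, ?_, a7, a8⟩
  · rw [← ea]; gcongr
  · rw [← eb]; gcongr
  · rw [← mul_pow, ← ea]; gcongr
  · rw [← mul_pow, ← eb]; gcongr

/-- The signal-to-noise condition of `fits_sqrt`, from a bound `s ≤ 12 r m / k` on the noise. -/
theorem mul_mul_le_of_noise {x s δ k r m : ℝ} (hx : 0 ≤ x) (hm : 0 ≤ m) (hr : r ≤ 1 - δ)
    (hs : k * s ≤ 12 * (r * m)) : k * x * s ≤ 12 * (x * (1 - δ)) * m := by
  calc k * x * s = x * (k * s) := by ring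
    _ ≤ x * (12 * ((1 - δ) * m)) := by
        apply mul_le_mul_of_nonneg_left _ hx
        exact hs.trans (by gcongr)
    _ = _ := by ring

set_option maxHeartbeats 1000000 in
/-- The scheme in which the second receiver treats the interference as noise. -/
theorem achieves_of_noisy {h : Channel} {u v Λ : ℝ} (O : OuterMul h u v) (hΛ : 1 ≤ Λ)
    (hΛ₁ : Real.log (2 * (1 + h.h11 ^ 2)) ≤ 2 * Λ) (hΛ₂ : Real.log (2 * (1 + h.h22 ^ 2)) ≤ 2 * Λ)
    (h₁ : 1 + h.h11 ^ 2 ≤ (1 + h.h12 ^ 2) * (1 + h.h21 ^ 2))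
    (h₂ : (1 + h.h12 ^ 2) * (1 + h.h21 ^ 2) ≤ 2 * (1 + h.h22 ^ 2)) :
    Achieves h u v (10 ^ 11 * Λ ^ 4) := by
  obtain ⟨hu1, hv1, hu, hv, -, -, huv, huuv, -⟩ := O
  obtain ⟨s₁, s₂, c, d, hs1, hs2, hc, hd, e11, e22, e12, e21⟩ := h.exists_sq
  rw [e11] at hu hΛ₁
  rw [e22] at hv hΛ₂
  rw [e11, e12, e21] at h₁
  rw [e12, e21, e22] at h₂
  rw [e11, e12, e21, e22] at huv huuv
  simp only [add_sub_cancel] at hu hv huv huuv h₁ h₂ hΛ₁ hΛ₂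
  have hc0 : 0 < c := by linarith
  have hd0 : 0 < d := by linarith
  have hs10 : 0 < s₁ := by linarith
  have hs20 : 0 < s₂ := by linarith
  have hu0 : 0 < u := by linarith
  have hv0 : 0 < v := by linarith
  have hcs : c ≤ 2 * s₂ := (le_mul_of_one_le_right hc0.le hd).trans h₂
  set e := max (s₁ / d) 1 with he
  have he0 : 0 < e := lt_of_lt_of_le one_pos (le_max_right _ _)
  set M := max s₁ c with hM
  have hMs : s₁ ≤ M := le_max_left _ _
  have hMc : c ≤ M := le_max_right _ _
  have hsd : s₁ / d ≤ c := by rwa [div_le_iff₀ hd0]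
  have hb2 : 1 + (d - 1 + (s₂ - 1) / c) ≤ 3 * s₂ / c := by
    rw [le_div_iff₀ hc0, add_mul, add_mul, div_mul_cancel₀ _ hc0.ne']
    linarith
  have hb20 : 0 ≤ 1 + (d - 1 + (s₂ - 1) / c) := by
    have : 0 ≤ (s₂ - 1) / c := div_nonneg (by linarith) hc0.le
    linarith
  have huv6 : u * v ≤ 6 * s₂ := by
    have b1 : 1 + (c - 1 + (s₁ - 1) / d) ≤ 2 * c := by
      have : (s₁ - 1) / d ≤ s₁ / d := by gcongr; linarith
      linarith
    calc u * v ≤ 2 * c * (3 * s₂ / c) :=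
          huv.trans (mul_le_mul b1 hb2 hb20 (by linarith))
      _ = 6 * s₂ := by field_simp; ring
  have huuv6 : u ^ 2 * v ≤ 6 * M * (s₂ / c) * e := by
    have b1 : 1 + (s₁ - 1 + (c - 1)) ≤ 2 * M := by linarith
    calc u ^ 2 * v ≤ 2 * M * (3 * s₂ / c) * e :=
          huuv.trans (mul_le_mul_of_nonneg_right (mul_le_mul b1 hb2 hb20 (by linarith)) he0.le)
      _ = _ := by ring
  obtain ⟨m, δ₁, hm1, hmu, hm, hme, hδ0, hδ, hδ4, hδm, hδd⟩ := exists_private hs1 hd hu1 hu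
  rw [← he] at hm hme
  have hm0 : 0 < m := by linarith
  have hmc : m ≤ c := hme.trans (max_le hsd hc)
  -- When the private level is capped by `u` rather than `e`, the bound follows from `u v ≤ 6 s₂`
  -- and `c ≤ M`.
  have huuv6' : u ^ 2 * v ≤ 6 * M * (s₂ / c) * m := by
    rcases hm with hm | hm
    · rw [hm]
      have : s₂ ≤ M * (s₂ / c) := by
        rw [mul_div_assoc', le_div_iff₀ hc0, mul_comm M]
        gcongr
      calc u ^ 2 * v = u * (u * v) := by ring
        _ ≤ u * (6 * (M * (s₂ / c))) := by
            apply mul_le_mul_of_nonneg_left _ hu0.le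
            linarith
        _ = _ := by ring
    · rwa [hm]
  -- The Gaussian part of user 2 is received below the noise at receiver 1.
  have hδ₂0 : 0 ≤ 1 / (2 * c) := by positivity
  have hδ₂1 : 1 / (2 * c) ≤ 1 / 2 := by
    rw [div_le_div_iff₀ (by positivity) (by norm_num)]; linarith
  have hcδ : (c - 1) * (1 / (2 * c)) ≤ 1 / 2 := by
    rw [mul_one_div, div_le_div_iff₀ (by positivity) (by norm_num)]; linarith
  have hcδ0 : 0 ≤ (c - 1) * (1 / (2 * c)) := mul_nonneg (by linarith) hδ₂0
  have hsδ : (s₂ - 1) * (1 / (2 * c)) = s₂ / c / 2 - 1 / (2 * c) := by field_simp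
  set δ₂ := 1 / (2 * c)
  have hsδ0 : 0 ≤ (s₁ - 1) * δ₁ := mul_nonneg (by linarith) hδ0
  have hdδ0 : 0 ≤ (d - 1) * δ₁ := mul_nonneg (by linarith) hδ0
  have hsδ20 : 0 ≤ (s₂ - 1) * δ₂ := mul_nonneg (by linarith) hδ₂0
  set a := u / m with ha
  -- The largest squared size of user 2's constellation that receiver 1 can resolve: `c / m` is its
  -- room over the private level, and `M / u` expresses `a b m ≤ M` for the superposition.
  set b := min (c / m) (M / u) with hb
  have ha1 : 1 ≤ a := by rwa [ha, le_div_iff₀ hm0, one_mul]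
  have hb1 : 1 ≤ b := by
    apply le_min
    · rwa [le_div_iff₀ hm0, one_mul]
    · rw [le_div_iff₀ hu0, one_mul]; linarith
  have hbc : b ≤ c := (min_le_left _ _).trans (div_le_self hc0.le hm1)
  have hF : Fits (Real.sqrt a) (Real.sqrt b) |amp h.h11 δ₁ (1 + h.h12 ^ 2 * δ₂ + h.h11 ^ 2 * δ₁)|
      |amp h.h12 δ₂ (1 + h.h12 ^ 2 * δ₂ + h.h11 ^ 2 * δ₁)| := by
    rw [e11, e12]
    refine fits_sqrt (X := (s₁ - 1) / m) (Y := (c - 1) / m) (by linarith) (by linarith)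
      (by linarith) (by linarith) (div_nonneg (by linarith) hm0.le)
      (div_nonneg (by linarith) hm0.le) ?_ ?_ ?_ ?_ ?_
    · rw [e11, div_mul_eq_mul_div, div_le_iff₀ hm0]
      have := mul_mul_le_of_noise (x := s₁ - 1) (s := 1 + (c - 1) * δ₂ + (s₁ - 1) * δ₁) (δ := δ₁)
        (k := 1) (r := 1 / 2) (m := m) (by linarith) hm0.le (by linarith) (by linarith)
      rwa [one_mul] at this
    · rw [e12, div_mul_eq_mul_div, div_le_iff₀ hm0]
      have := mul_mul_le_of_noise (x := c - 1) (s := 1 + (c - 1) * δ₂ + (s₁ - 1) * δ₁) (δ := δ₂)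
        (k := 1) (r := 1 / 2) (m := m) (by linarith) hm0.le (by linarith) (by linarith)
      rwa [one_mul] at this
    · rw [ha, div_le_iff₀ hm0, add_mul, div_mul_cancel₀ _ hm0.ne']
      linarith
    · refine (min_le_left _ _).trans ?_
      rw [div_le_iff₀ hm0, add_mul, div_mul_cancel₀ _ hm0.ne']
      linarith
    · apply le_max_div_add hm1
      calc a * b * m ≤ u / m * (M / u) * m := by
            gcongr
            exact min_le_right _ _
        _ = M := by field_simp
        _ ≤ _ := by
            rw [max_sub_sub_right]
            linarith
  have haΛ : Real.log a ≤ 2 * Λ := by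
    refine (Real.log_le_log (by linarith) ?_).trans hΛ₁
    have : a ≤ u := div_le_self hu0.le hm1
    linarith
  have hbΛ : Real.log b ≤ 2 * Λ := by
    refine (Real.log_le_log (by linarith) ?_).trans hΛ₂
    linarith
  -- Only receiver 1 resolves the superposition, so the same condition fills both slots.
  obtain ⟨N₁, N₂, n1, n2, n3, n4, n5, n6, n7, -⟩ := exists_sizes_sq ha1 hb1 hΛ haΛ hbΛ hF hF
  have hN1 : (1 : ℝ) ≤ N₁ := by exact_mod_cast n1
  have hN2 : (1 : ℝ) ≤ N₂ := by exact_mod_cast n2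
  have hΛ28 : Λ ^ 2 ≤ Λ ^ 8 := pow_le_pow_right₀ hΛ (by norm_num)
  refine ⟨N₁, N₂, δ₁, δ₂, n1, n2, ⟨hδ0, by linarith⟩, ⟨hδ₂0, by linarith⟩, ?_, ?_⟩
  · refine RateOK.of_coll_le hu0.le hδ₂0 n1 n2 n7 ?_
    rw [e11, e12]
    set s := 1 + (c - 1) * δ₂ + (s₁ - 1) * δ₁ with hs
    have hs4 : m ≤ 4 * s := by rw [hs]; linarith
    have k1 : u ≤ (44 * Λ) ^ 2 * N₁ ^ 2 * (4 * s) := by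
      calc u = a * m := by rw [ha]; field_simp
        _ ≤ (44 * Λ) ^ 2 * N₁ ^ 2 * (4 * s) := by gcongr
    have k2 : (1 + (c - 1) * δ₂) * u ≤ 3 / 2 * u := by gcongr; linarith
    calc 49 * (10 ^ 8 * Λ ^ 3) ^ 2 * ((1 + (c - 1) * δ₂) * u) ≤
          49 * (10 ^ 8 * Λ ^ 3) ^ 2 * (3 / 2 * ((44 * Λ) ^ 2 * N₁ ^ 2 * (4 * s))) := by
          gcongr; linarith
      _ = (49 * 10 ^ 16 * 6 * 44 ^ 2) * (Λ ^ 8 * (N₁ ^ 2 * s)) := by ring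
      _ ≤ 10 ^ 22 * (Λ ^ 8 * (N₁ ^ 2 * s)) := by
          have : 0 ≤ Λ ^ 8 * (N₁ ^ 2 * s) := by
            have : 0 ≤ s := by linarith
            positivity
          gcongr
          norm_num
      _ = _ := by ring
  -- Receiver 2 leaves user 1's points unresolved and loses a factor `N₁`. This is affordable
  -- because `v a ≤ 6 b s₂ / c`: the two choices in `b` reduce it to the bounds on `u v` and on `u²
  -- v`.
  · refine RateOK.of_coll_le (κ := 24 * N₁) hv0.le hδ0 n2 n1 ?_ ?_
    · rw [coll_comm, ← coll_abs]
      refine coll_le_mul n1 n2 (abs_nonneg _) ?_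
      rcases n2.eq_or_lt with h5 | h5
      · rw [← h5]
        have := abs_nonneg (amp h.h22 δ₂ (1 + h.h21 ^ 2 * δ₁ + h.h22 ^ 2 * δ₂))
        push_cast
        linarith
      · have h6 : (2 : ℝ) ≤ N₂ := by exact_mod_cast h5
        have hc4 : 4 ≤ c := by
          have : (2 : ℝ) ^ 2 ≤ N₂ ^ 2 := by gcongr
          linarith
        have k1 : Real.sqrt (c - 1) ≤ |amp h.h22 δ₂ (1 + h.h21 ^ 2 * δ₁ + h.h22 ^ 2 * δ₂)| := by
          refine sqrt_le_abs_amp (by linarith) (by rw [e21, e22]; linarith) ?_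
          rw [e21, e22]
          have k3 : (c - 1) * ((s₂ - 1) * δ₂) ≤ (s₂ - 1) / 2 := by
            calc (c - 1) * ((s₂ - 1) * δ₂) = (s₂ - 1) * ((c - 1) * δ₂) := by ring
              _ ≤ (s₂ - 1) * (1 / 2) := by
                  apply mul_le_mul_of_nonneg_left hcδ; linarith
              _ = _ := by ring
          have k5 : (c - 1) * (1 + (d - 1) * δ₁) ≤ (c - 1) * (3 / 2) := by
            apply mul_le_mul_of_nonneg_left _ (by linarith); linarith
          have k6 : (s₂ - 1) * (1 / 2) ≤ (s₂ - 1) * (1 - δ₂) := by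
            apply mul_le_mul_of_nonneg_left _ (by linarith); linarith
          rw [mul_add]
          linarith
        have k2 : (N₂ : ℝ) ≤ Real.sqrt (1 + (c - 1)) := by
          apply Real.le_sqrt_of_sq_le
          linarith
        have := sqrt_one_add_le (show 0 ≤ c - 1 by linarith)
        linarith
    · rw [e21, e22]
      set s := 1 + (d - 1) * δ₁ + (s₂ - 1) * δ₂ with hs
      have hs2 : s₂ / c ≤ 2 * s := by
        have : δ₂ ≤ 1 := by linarith
        rw [hs, hsδ]
        have : 0 ≤ s₂ / c := by positivity
        linarith
      have k1 : v * a ≤ 6 * (b * (s₂ / c)) := by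
        rcases min_choice (c / m) (M / u) with h5 | h5
        · have : b = c / m := h5
          rw [this, ha]
          have e1 : 6 * (c / m * (s₂ / c)) = 6 * s₂ / m := by field_simp
          rw [e1, mul_div_assoc']
          apply div_le_div_of_nonneg_right _ hm0.le
          linarith
        · have : b = M / u := h5
          rw [this, ha, mul_div_assoc', div_mul_eq_mul_div, mul_div_assoc', div_le_div_iff₀ hm0 hu0]
          linarith
      have hs0 : 0 ≤ s := by linarith
      have k2 : (1 + (d - 1) * δ₁) * v ≤ 3 / 2 * v := by gcongr; linarith
      calc 49 * (24 * N₁) ^ 2 * ((1 + (d - 1) * δ₁) * v) = 49 * 24 ^ 2 *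
            (((1 + (d - 1) * δ₁) * v) * N₁ ^ 2) := by ring
        _ ≤ 49 * 24 ^ 2 * ((3 / 2 * v) * a) := by gcongr
        _ = 49 * 24 ^ 2 * 3 / 2 * (v * a) := by ring
        _ ≤ 49 * 24 ^ 2 * 3 / 2 * (6 * (b * (s₂ / c))) := by gcongr
        _ ≤ 49 * 24 ^ 2 * 3 / 2 * (6 * ((44 * Λ) ^ 2 * N₂ ^ 2 * (2 * s))) := by gcongr
        _ = (49 * 24 ^ 2 * 18 * 44 ^ 2) * Λ ^ 2 * (N₂ ^ 2 * s) := by ring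
        _ ≤ 10 ^ 22 * Λ ^ 8 * (N₂ ^ 2 * s) := by
            gcongr
            norm_num
        _ = _ := by ring

set_option maxHeartbeats 1000000 in
/-- The scheme in which both receivers resolve the discrete parts of both inputs. -/
theorem achieves_of_strong {h : Channel} {u v Λ : ℝ} (O : OuterMul h u v) (hΛ : 1 ≤ Λ)
    (hΛ₁ : Real.log (2 * (1 + h.h11 ^ 2)) ≤ 2 * Λ) (hΛ₂ : Real.log (2 * (1 + h.h22 ^ 2)) ≤ 2 * Λ)
    (h₁ : h.h11 ^ 2 ≤ h.h21 ^ 2)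
    (h₂ : h.h11 ^ 2 * (1 + h.h22 ^ 2) ≤ h.h21 ^ 2 * (1 + h.h12 ^ 2)) :
    Achieves h u v (10 ^ 11 * Λ ^ 4) := by
  obtain ⟨hu1, hv1, hu, hv, huv, huv', -, -, -⟩ := O
  obtain ⟨s₁, s₂, c, d, hs1, hs2, hc, hd, e11, e22, e12, e21⟩ := h.exists_sq
  rw [e11] at hu hΛ₁
  rw [e22] at hv hΛ₂
  rw [e11, e21] at h₁
  rw [e11, e12, e21, e22] at h₂
  rw [e11, e21, e22] at huv
  rw [e11, e12, e22] at huv'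
  simp only [add_sub_cancel] at hu hv huv huv' h₂ hΛ₁ hΛ₂
  have hc0 : 0 < c := by linarith
  have hd0 : 0 < d := by linarith
  have hs20 : 0 < s₂ := by linarith
  have hu0 : 0 < u := by linarith
  have hv0 : 0 < v := by linarith
  have huv : u * v ≤ 1 + (d - 1 + (s₂ - 1)) := by
    rwa [max_eq_right (by rw [div_le_one hd0]; linarith), one_mul] at huv
  obtain ⟨m, δ₂, hm1, hmv, hm, hme, hδ0, hδ, hδ4, hδm, hδc⟩ := exists_private hs2 hc hv1 hv
  have hm0 : 0 < m := by linarith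
  have hsδ0 : 0 ≤ (s₂ - 1) * δ₂ := mul_nonneg (by linarith) hδ0
  have hcδ0 : 0 ≤ (c - 1) * δ₂ := mul_nonneg (by linarith) hδ0
  -- The regime condition in usable form: receiver 2 sees user 1, over the private level `m` of user
  -- 2, at least as well as the direct link carries it without interference. So user 1 needs no
  -- private part.
  have hsm : (s₁ - 1) * m ≤ d - 1 := by
    rcases le_total (s₂ / c) 1 with h5 | h5
    · rw [max_eq_right h5] at hme
      calc (s₁ - 1) * m ≤ (s₁ - 1) * 1 := by
            apply mul_le_mul_of_nonneg_left hme; linarith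
        _ ≤ d - 1 := by linarith
    · rw [max_eq_left h5] at hme
      calc (s₁ - 1) * m ≤ (s₁ - 1) * (s₂ / c) := by
            apply mul_le_mul_of_nonneg_left hme; linarith
        _ ≤ d - 1 := by rwa [mul_div_assoc', div_le_iff₀ hc0]
  set b := v / m with hb
  have hb1 : 1 ≤ b := by rwa [hb, le_div_iff₀ hm0, one_mul]
  have hbm : b * m = v := by rw [hb]; field_simp
  have hbv : b ≤ v := div_le_self hv0.le hm1
  -- Packing at receiver 1, where user 2's private part is below the noise; the product condition
  -- comes from the second sum-rate bound.
  have hF : Fits (Real.sqrt u) (Real.sqrt b) |amp h.h11 0 (1 + h.h12 ^ 2 * δ₂ + h.h11 ^ 2 * 0)|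
      |amp h.h12 δ₂ (1 + h.h12 ^ 2 * δ₂ + h.h11 ^ 2 * 0)| := by
    rw [e11, e12]
    refine fits_sqrt (X := 8 * (s₁ - 1)) (Y := 4 * (c - 1)) (by linarith) (by linarith)
      (by linarith) (by linarith) (by linarith) (by linarith) ?_ ?_ (by linarith) ?_ ?_
    · rw [e11, ← mul_one (12 * _)]
      apply mul_mul_le_of_noise (r := 1) <;> linarith
    · rw [e12, ← mul_one (12 * _)]
      apply mul_mul_le_of_noise (r := 1 / 2) <;> linarith
    · rcases hm with hm | hm
      · rw [hb, hm, div_self hv0.ne']; linarith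
      · have : s₂ / c ≤ m := by rw [hm]; exact le_max_left _ _
        rw [div_le_iff₀ hc0] at this
        have : b ≤ c := by
          rw [hb, div_le_iff₀ hm0]; linarith
        linarith
    · have : u * b ≤ 1 + (s₁ - 1 + (c - 1)) := by
        rcases hm with hm | hm
        · rw [hb, hm, div_self hv0.ne']; linarith
        · rw [← hm] at huv'
          rw [hb, mul_div_assoc', div_le_iff₀ hm0]
          linarith
      have m1 := le_max_left (8 * (s₁ - 1)) (4 * (c - 1))
      have m2 := le_max_right (8 * (s₁ - 1)) (4 * (c - 1))
      linarith
  -- Packing at receiver 2, above level `m`; since `b m = v`, the product condition is the first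
  -- sum-rate bound.
  have hF' : Fits (Real.sqrt u) (Real.sqrt b) |amp h.h21 0 (1 + h.h21 ^ 2 * 0 + h.h22 ^ 2 * δ₂)|
      |amp h.h22 δ₂ (1 + h.h21 ^ 2 * 0 + h.h22 ^ 2 * δ₂)| := by
    rw [e21, e22]
    refine fits_sqrt (X := 12 * (d - 1) / m) (Y := 6 * (s₂ - 1) / m) (by linarith) (by linarith)
      (by linarith) (by linarith) (div_nonneg (by linarith) hm0.le)
      (div_nonneg (by linarith) hm0.le) ?_ ?_ ?_ ?_ ?_
    · rw [e21, div_mul_eq_mul_div, div_le_iff₀ hm0]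
      apply mul_mul_le_of_noise (r := 1) <;> linarith
    · rw [e22, div_mul_eq_mul_div, div_le_iff₀ hm0]
      apply mul_mul_le_of_noise (r := 1 / 2) <;> linarith
    · have : s₁ - 1 ≤ 12 * (d - 1) / m := by
        rw [le_div_iff₀ hm0]
        linarith
      linarith
    · rw [hb, div_le_iff₀ hm0, add_mul, div_mul_cancel₀ _ hm0.ne']
      linarith
    · apply le_max_div_add hm1
      have m1 := le_max_left (12 * (d - 1)) (6 * (s₂ - 1))
      have m2 := le_max_right (12 * (d - 1)) (6 * (s₂ - 1))
      rw [mul_assoc, hbm]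
      linarith
  obtain ⟨N₁, N₂, n1, n2, n3, n4, n5, n6, n7, n8⟩ := exists_sizes_sq hu1 hb1 hΛ
    ((Real.log_le_log hu0 (by linarith)).trans hΛ₁)
    ((Real.log_le_log (by linarith) (by linarith)).trans hΛ₂) hF hF'
  have hN1 : (1 : ℝ) ≤ N₁ := by exact_mod_cast n1
  have hN2 : (1 : ℝ) ≤ N₂ := by exact_mod_cast n2
  refine ⟨N₁, N₂, 0, δ₂, n1, n2, ⟨le_rfl, by norm_num⟩, ⟨hδ0, by linarith⟩, ?_, ?_⟩
  · refine RateOK.of_coll_le hu0.le hδ0 n1 n2 n7 ?_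
    rw [e11, e12]
    have k2 : (1 + (c - 1) * δ₂) * u ≤ 3 / 2 * u := by gcongr; linarith
    calc 49 * (10 ^ 8 * Λ ^ 3) ^ 2 * ((1 + (c - 1) * δ₂) * u) ≤
          49 * (10 ^ 8 * Λ ^ 3) ^ 2 * (3 / 2 * ((44 * Λ) ^ 2 * N₁ ^ 2)) := by
          gcongr; linarith
      _ = (49 * 10 ^ 16 * 3 / 2 * 44 ^ 2) * Λ ^ 8 * (N₁ ^ 2 * 1) := by ring
      _ ≤ 10 ^ 22 * Λ ^ 8 * (N₁ ^ 2 * (1 + (c - 1) * δ₂ + (s₁ - 1) * 0)) := by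
          gcongr
          · norm_num
          · linarith
      _ = _ := by ring
  · rw [coll_comm] at n8
    refine RateOK.of_coll_le hv0.le le_rfl n2 n1 n8 ?_
    rw [e21, e22]
    have k1 : v ≤ (44 * Λ) ^ 2 * N₂ ^ 2 * (4 * (1 + (s₂ - 1) * δ₂)) := by
      rw [← hbm]
      gcongr
      linarith
    rw [mul_zero, add_zero, one_mul]
    calc 49 * (10 ^ 8 * Λ ^ 3) ^ 2 * v ≤
          49 * (10 ^ 8 * Λ ^ 3) ^ 2 * ((44 * Λ) ^ 2 * N₂ ^ 2 * (4 * (1 + (s₂ - 1) * δ₂))) := by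
          gcongr
      _ = (49 * 10 ^ 16 * 4 * 44 ^ 2) * (Λ ^ 8 * (N₂ ^ 2 * (1 + (s₂ - 1) * δ₂))) := by ring
      _ ≤ 10 ^ 22 * (Λ ^ 8 * (N₂ ^ 2 * (1 + (s₂ - 1) * δ₂))) := by
          gcongr
          norm_num
      _ = _ := by ring

/-! ### The regimes -/

theorem withinGap_of_achieves {h : Channel} {gap : ℝ}
    (H : ∀ u v, OuterMul h u v → Achieves h u v ((2 : ℝ) ^ gap)) :
    WithinGap (tinNoTSRegion h mixedInputs) (outerBound h) gap :=
  fun _ hR => (H _ _ (outerMul_of_mem hR)).mem_tinNoTSRegion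

/-- Turns a weak-interference condition into the hypothesis of `achieves_gaussian`. The alternative
it excludes, `x < 1` and `y > s`, is the territory of `achieves_of_weak_of_strong`. -/
theorem one_add_mul_one_add_le {x y s : ℝ} (hy : 0 ≤ y) (hxy : x * (1 + y) ≤ s)
    (h : 1 ≤ x ∨ y ≤ s) : (1 + x) * (1 + y) ≤ 2 * (1 + s) := by
  rcases h with h | h
  · nlinarith
  · linarith

theorem achieves_of_veryWeak {h : Channel} {u v : ℝ} (O : OuterMul h u v) (hw : VeryWeak h) :
    Achieves h u v 1000 := by
  have n12 := sq_nonneg h.h12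
  have n21 := sq_nonneg h.h21
  obtain ⟨w₁, w₂⟩ := hw
  rw [le_div_iff₀ (by positivity)] at w₁ w₂
  by_cases c₁ : h.h12 ^ 2 ≤ 1 ∧ h.h22 ^ 2 ≤ h.h21 ^ 2
  · exact achieves_of_weak_of_strong O c₁.1 c₁.2
  by_cases c₂ : h.h21 ^ 2 ≤ 1 ∧ h.h11 ^ 2 ≤ h.h12 ^ 2
  · exact (achieves_of_weak_of_strong O.swap c₂.1 c₂.2).of_swap
  have d₁ : 1 ≤ h.h12 ^ 2 ∨ h.h21 ^ 2 ≤ h.h22 ^ 2 := by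
    by_contra! hc
    exact c₁ ⟨hc.1.le, hc.2.le⟩
  have d₂ : 1 ≤ h.h21 ^ 2 ∨ h.h12 ^ 2 ≤ h.h11 ^ 2 := by
    by_contra! hc
    exact c₂ ⟨hc.1.le, hc.2.le⟩
  refine (achieves_gaussian O ?_ (one_add_mul_one_add_le n21 w₁ d₁)).mono (by norm_num)
    (by norm_num)
  rw [mul_comm (1 + h.h12 ^ 2)]
  exact one_add_mul_one_add_le n12 w₂ d₂

/-- One-sided weakness gives the product condition at user 2 only. At user 1 it either holds too,
and Gaussian inputs suffice, or fails, which is what `achieves_of_noisy` needs. -/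
theorem achieves_of_mul_le {h : Channel} {u v Λ : ℝ} (O : OuterMul h u v) (hΛ : 1 ≤ Λ)
    (hΛ₁ : Real.log (2 * (1 + h.h11 ^ 2)) ≤ 2 * Λ) (hΛ₂ : Real.log (2 * (1 + h.h22 ^ 2)) ≤ 2 * Λ)
    (hw : h.h12 ^ 2 * (1 + h.h21 ^ 2) ≤ h.h22 ^ 2) : Achieves h u v (10 ^ 11 * Λ ^ 4) := by
  have n21 := sq_nonneg h.h21
  have hΓ : 1000 ≤ 10 ^ 11 * Λ ^ 4 := by
    have := one_le_pow₀ hΛ (n := 4)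
    linarith
  by_cases c₁ : h.h12 ^ 2 ≤ 1 ∧ h.h22 ^ 2 ≤ h.h21 ^ 2
  · exact (achieves_of_weak_of_strong O c₁.1 c₁.2).mono (by norm_num) hΓ
  have d₁ : 1 ≤ h.h12 ^ 2 ∨ h.h21 ^ 2 ≤ h.h22 ^ 2 := by
    by_contra! hc
    exact c₁ ⟨hc.1.le, hc.2.le⟩
  have h₂ := one_add_mul_one_add_le n21 hw d₁
  rcases le_total ((1 + h.h12 ^ 2) * (1 + h.h21 ^ 2)) (1 + h.h11 ^ 2) with h₁ | h₁
  · refine (achieves_gaussian O ?_ h₂).mono (by norm_num) (by linarith)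
    have := sq_nonneg h.h11
    linarith
  · exact achieves_of_noisy O hΛ hΛ₁ hΛ₂ h₁ h₂

/-- If `h11 ^ 2 > h21 ^ 2`, the hypothesis forces `h22 ^ 2 ≤ h12 ^ 2` and implies its own mirror
image, so the strong scheme applies with the users exchanged. -/
theorem achieves_of_le_mul {h : Channel} {u v Λ : ℝ} (O : OuterMul h u v) (hΛ : 1 ≤ Λ)
    (hΛ₁ : Real.log (2 * (1 + h.h11 ^ 2)) ≤ 2 * Λ) (hΛ₂ : Real.log (2 * (1 + h.h22 ^ 2)) ≤ 2 * Λ)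
    (hs : h.h11 ^ 2 * (1 + h.h22 ^ 2) ≤ h.h21 ^ 2 * (1 + h.h12 ^ 2)) :
    Achieves h u v (10 ^ 11 * Λ ^ 4) := by
  rcases le_or_gt (h.h11 ^ 2) (h.h21 ^ 2) with h₁ | h₁
  · exact achieves_of_strong O hΛ hΛ₁ hΛ₂ h₁ hs
  have n21 := sq_nonneg h.h21
  have n22 := sq_nonneg h.h22
  have h₂ : h.h22 ^ 2 ≤ h.h12 ^ 2 := by
    by_contra! hc
    have k₁ : h.h21 ^ 2 * (1 + h.h12 ^ 2) ≤ h.h21 ^ 2 * (1 + h.h22 ^ 2) := by gcongr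
    have k₂ : h.h21 ^ 2 * (1 + h.h22 ^ 2) < h.h11 ^ 2 * (1 + h.h22 ^ 2) := by gcongr
    linarith
  refine (achieves_of_strong O.swap hΛ hΛ₂ hΛ₁ h₂ ?_).of_swap
  change h.h22 ^ 2 * (1 + h.h11 ^ 2) ≤ h.h12 ^ 2 * (1 + h.h21 ^ 2)
  linarith

/-- Failure of any one of the four strict inequalities suffices; they pair up under exchange of the
users. -/
theorem achieves_of_not_openRegime {h : Channel} {u v Λ : ℝ} (O : OuterMul h u v) (hΛ : 1 ≤ Λ)
    (hΛ₁ : Real.log (2 * (1 + h.h11 ^ 2)) ≤ 2 * Λ) (hΛ₂ : Real.log (2 * (1 + h.h22 ^ 2)) ≤ 2 * Λ)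
    (ho : ¬ OpenRegime h) : Achieves h u v (10 ^ 11 * Λ ^ 4) := by
  have n12 : 0 < 1 + h.h12 ^ 2 := by positivity
  have n21 : 0 < 1 + h.h21 ^ 2 := by positivity
  rw [OpenRegime, not_and_or, not_and_or, not_and_or, not_lt, not_lt, not_lt, not_lt,
    le_div_iff₀ n21, le_div_iff₀ n12, div_mul_eq_mul_div, div_mul_eq_mul_div,
    div_le_iff₀ n21, div_le_iff₀ n12] at ho
  rcases ho with (ho | ho) | (ho | ho)
  · exact achieves_of_mul_le O hΛ hΛ₁ hΛ₂ ho
  · exact (achieves_of_le_mul O.swap hΛ hΛ₂ hΛ₁ ho).of_swap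
  · exact (achieves_of_mul_le O.swap hΛ hΛ₂ hΛ₁ ho).of_swap
  · exact achieves_of_le_mul O hΛ hΛ₁ hΛ₂ ho

theorem log_two_mul_le {x T : ℝ} (hx : 0 ≤ x) (hT : 16 ≤ T) (hxT : x ≤ T) :
    Real.log (2 * (1 + x)) ≤ 2 * Real.log T := by
  have e : 2 * Real.log T = Real.log (T ^ 2) := by rw [Real.log_pow]; norm_num
  rw [e]
  apply Real.log_le_log (by linarith)
  nlinarith

end GaussianIC
end

theorem mainTheorem3 :
    ∃ C : ℝ, 0 < C ∧ ∀ h : GaussianIC.Channel,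
      (GaussianIC.VeryStrong h ∨ GaussianIC.VeryWeak h →
        GaussianIC.WithinGap (GaussianIC.tinNoTSRegion h GaussianIC.mixedInputs)
          (GaussianIC.outerBound h) C) ∧
      (¬ GaussianIC.OpenRegime h →
        GaussianIC.WithinGap (GaussianIC.tinNoTSRegion h GaussianIC.mixedInputs)
          (GaussianIC.outerBound h)
          (C * Real.logb 2 (Real.log (max 16 (max (h.h11 ^ 2) (h.h22 ^ 2)))))) := by
  refine ⟨50, by norm_num, fun h => ⟨fun hh => ?_, fun ho => ?_⟩⟩
  · refine GaussianIC.withinGap_of_achieves fun u v O => ?_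
    have e : (2 : ℝ) ^ (50 : ℝ) = 2 ^ (50 : ℕ) := by
      rw [← Real.rpow_natCast]
      norm_num
    rw [e]
    rcases hh with hh | hh
    · exact (GaussianIC.achieves_of_veryStrong O hh).mono (by norm_num) (by norm_num)
    · exact (GaussianIC.achieves_of_veryWeak O hh).mono (by norm_num) (by norm_num)
  · refine GaussianIC.withinGap_of_achieves fun u v O => ?_
    set T := max 16 (max (h.h11 ^ 2) (h.h22 ^ 2))
    have hT : 16 ≤ T := le_max_left _ _
    have hΛ : 2 ≤ Real.log T := by
      have k₁ : Real.log 16 ≤ Real.log T := Real.log_le_log (by norm_num) hT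
      have k₂ : Real.log 16 = 4 * Real.log 2 := by
        rw [show (16 : ℝ) = 2 ^ 4 by norm_num, Real.log_pow]
        norm_num
      have := Real.log_two_gt_d9
      linarith
    have e : (2 : ℝ) ^ (50 * Real.logb 2 (Real.log T)) = Real.log T ^ 50 := by
      rw [mul_comm, Real.rpow_mul (by norm_num),
        Real.rpow_logb (by norm_num) (by norm_num) (by linarith), ← Real.rpow_natCast]
      norm_num
    rw [e]
    refine (GaussianIC.achieves_of_not_openRegime O (by linarith)
      (GaussianIC.log_two_mul_le (sq_nonneg _) hT
        ((le_max_left _ _).trans (le_max_right _ _)))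
      (GaussianIC.log_two_mul_le (sq_nonneg _) hT
        ((le_max_right _ _).trans (le_max_right _ _))) ho).mono (by positivity) ?_
    -- The floor 16 in `T` ensures `log T ≥ 2`, so the constant is absorbed into a power of `log T`;
    -- `46 + 4` is the constant 50.
    calc 10 ^ 11 * Real.log T ^ 4 ≤ 2 ^ 46 * Real.log T ^ 4 := by
          gcongr
          norm_num
      _ ≤ Real.log T ^ 46 * Real.log T ^ 4 := by gcongr
      _ = _ := by ring
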